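/- Let $(N,\phi,\xi,\eta,g)$ be an almost contact metric manifold of dimension $2n+1$: $g$ is a Riemannian metric, $\phi^2=-I+\eta\otimes\xi$, $\eta(\xi)=1$ and $g(\phi X,\phi Y)=g(X,Y)-\eta(X)\eta(Y)$, all data being smooth. Write $\overline\nabla$ for the Levi-Civita connection of $g$, $\Phi(X,Y)=g(X,\phi Y)$, $2\,d\eta(X,Y)=X\eta(Y)-Y\eta(X)-\eta([X,Y])$, and $N_\phi(X,Y)=\phi^2[X,Y]+[\phi X,\phi Y]-\phi[\phi X,Y]-\phi[X,\phi Y]$; the structure is normal if $N_\phi+2\,d\eta\otimes\xi=0$. The manifold $N$ is *cosymplectic* if it is normal and $d\eta=0$, $d\Phi=0$; *Sasakian* if it is normal and $\Phi=d\eta$; *Kenmotsu* if $(\overline\nabla_X\phi)Y=g(\phi X,Y)\xi-\eta(Y)\phi X$ for all vector fields $X,Y$. Let $M$ be a proper pointwise semi-slant (immersed) submanifold of $N$. That is, there is a smooth distribution $\mathcal D_1\subset TM$ with $\phi(\mathcal D_1)\subset\mathcal D_1$ such that, with $\mathcal D_2$ the orthogonal complement of $\mathcal D_1$ in $TM$,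 at each $p\in M$ one has $\phi X\ne0$ for all nonzero $X\in(\mathcal D_2)_p$, and the angle between $\phi X$ and $(\mathcal D_2)_p$ is the same number $\theta(p)\in(0,\frac{\pi}{2})$ for all of them. For $X$ tangent to $M$ let $TX$ and $FX$ be the tangential and the normal part of $\phi X$. For a normal vector field $\zeta$ let $A_\zeta X$ be the tangential part of $-\overline\nabla_X\zeta$. Give $M$ the induced metric. A distribution *defines a totally geodesic foliation* of $M$ if it is integrable and its integral manifolds are totally geodesic submanifolds of $M$. Then the following hold. 1. If $\xi$ is tangent to $M$ and $N$ is cosymplectic, Sasakian or Kenmotsu, then $\mathcal D_1$ defines a totally geodesic foliation if and only if $g(A_{FZ}\phi X-A_{FTZ}X,\,Y)=0$ for all $X,Y\in\Gamma(\mathcal D_1)$ and $Z\in\Gamma(\mathcal D_2)$. 2. If $\xi$ is normal to $M$ and $N$ is cosymplectic or Kenmotsu, then $\mathcal D_1$ defines a totally geodesic foliation if and only if $g(A_{FZ}\phi X-A_{FTZ}X,\,Y)=0$ for all $X,Y\in\Gamma(\mathcal D_1)$ and $Z\in\Gamma(\mathcal D_2)$. 3. If $\xi$ is normal to $M$ and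 $N$ is cosymplectic or Kenmotsu, then $\mathcal D_2$ defines a totally geodesic foliation if and only if $g(A_{FZ}\phi X-A_{FTZ}X,\,W)=0$ for all $X\in\Gamma(\mathcal D_1)$ and $Z,W\in\Gamma(\mathcal D_2)$. 4. Let $\xi$ be tangent to $M$. If $N$ is cosymplectic or Sasakian, then $\mathcal D_2$ defines a totally geodesic foliation if and only if $g(A_{FZ}\phi X-A_{FTZ}X,\,W)=0$ for all $X\in\Gamma(\mathcal D_1)$ and $Z,W\in\Gamma(\mathcal D_2)$. If $N$ is Kenmotsu, then $\mathcal D_2$ defines a totally geodesic foliation if and only if $g(A_{FZ}\phi X-A_{FTZ}X,\,W)+\sin^2\theta\;\eta(X)\,g(W,Z)=0$ for all $X\in\Gamma(\mathcal D_1)$ and $Z,W\in\Gamma(\mathcal D_2)$. 5. If either $\xi$ is tangent to $M$ and $N$ is cosymplectic or Sasakian, or $\xi$ is normal to $M$ and $N$ is cosymplectic or Kenmotsu, then $M$ is locally a Riemannian product $M_1\times M_2$ of integral manifolds $M_1$ of $\mathcal D_1$ and $M_2$ of $\mathcal D_2$ if and only if $A_{FZ}\phi X=A_{FTZ}X$ for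 all $X\in\Gamma(\mathcal D_1)$ and $Z\in\Gamma(\mathcal D_2)$. -/

import Mathlib

open Bundle Set Filter
open scoped Manifold ContDiff Topology

noncomputable section

namespace SemiSlant

/-- The model space `ℝᵏ`. -/
abbrev Eu (k : ℕ) : Type := EuclideanSpace ℝ (Fin k)

/-! ### Linear algebra: orthogonal projection for a scalar product given as a bilinear form -/

section LinearAlgebra

variable {V V' : Type*} [AddCommGroup V] [Module ℝ V] [TopologicalSpace V]
  [IsTopologicalAddGroup V] [ContinuousSMul ℝ V]
  [AddCommGroup V'] [Module ℝ V'] [TopologicalSpace V']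
  [IsTopologicalAddGroup V'] [ContinuousSMul ℝ V']

/-- The pull-back `(u, v) ↦ B (L u) (L v)` of a bilinear form `B` on `V` by `L : V' → V`. -/
def pullForm (B : V →L[ℝ] V →L[ℝ] ℝ) (L : V' →L[ℝ] V) : V' →L[ℝ] V' →L[ℝ] ℝ :=
  (ContinuousLinearMap.precomp ℝ L).comp (B.comp L)

/-- For a scalar product `B` on `V` and an injective `L : V' → V` (finite dimensions), the vector
`w ∈ V'` such that `L w` is the `B`-orthogonal projection of `v` to the range of `L`, that is, the
unique `w` with `B (L w) (L u) = B v (L u)` for all `u`. -/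
def pullProj (B : V →L[ℝ] V →L[ℝ] ℝ) (L : V' →L[ℝ] V) (v : V) : V' :=
  (pullForm B L).inverse ((B v).comp L)

/-- The angle (in `[0, π/2]`) between a nonzero vector `v` and a subspace `W`, for the scalar
product `B`: its cosine is the quotient of the length of the orthogonal projection of `v` to `W` by
the length of `v`. -/
def angleToSubspace (B : V →L[ℝ] V →L[ℝ] ℝ) (v : V) (W : Submodule ℝ V) : ℝ :=
  let w : V := (pullProj B W.subtypeL v : W)
  Real.arccos (Real.sqrt (B w w) / Real.sqrt (B v v))

end LinearAlgebra

/-! ### Vector fields, metrics, Levi-Civita connection -/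

section Connection

variable {m d : ℕ}
  {M : Type*} [TopologicalSpace M] [ChartedSpace (Eu m) M]
  {N : Type*} [TopologicalSpace N] [ChartedSpace (Eu d) N] [IsManifold (𝓡 d) ∞ N]

/-- `X` is a smooth vector field on `N`. -/
def IsSmoothVF (X : ∀ x : N, TangentSpace (𝓡 d) x) : Prop :=
  ContMDiff (𝓡 d) (𝓡 d).tangent ∞ (fun x => (TotalSpace.mk' (Eu d) x (X x) : TangentBundle (𝓡 d) N))

/-- A field of bilinear forms on the tangent spaces of `N`. Riemannian metrics enter in this form.
-/
abbrev FormField (d : ℕ) (N : Type*) [TopologicalSpace N] [ChartedSpace (Eu d) N] : Type _ :=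
  ∀ x : N, TangentSpace (𝓡 d) x →L[ℝ] TangentSpace (𝓡 d) x →L[ℝ] ℝ

/-- The metric induced on `M` by a map `f : M → N` from a metric on `N`. -/
def inducedMetric (g : FormField d N) (f : M → N) : FormField m M :=
  fun p => pullForm (g (f p)) (mfderiv (𝓡 m) (𝓡 d) f p)

/-- The coefficients `y ↦ (g_{ij}(y))` of the metric in the preferred coordinates at `x₀`, as a
function with values in the bilinear forms on `ℝᵈ`. -/
def metricCoeff (g : FormField d N) (x₀ y : N) : Eu d →L[ℝ] Eu d →L[ℝ] ℝ :=
  pullForm (g y)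
    ((trivializationAt (Eu d) (TangentSpace (𝓡 d) : N → Type _) x₀).symmL ℝ y)

/-- The Christoffel symbols of the metric `g` at `x`, in the preferred coordinates at `x`:
`Γ (a, b)` is determined by
`2 g (Γ (a, b), c) = ∂_a g (b, c) + ∂_b g (a, c) - ∂_c g (a, b)`. -/
def christoffel (g : FormField d N) (x : N) (a b : TangentSpace (𝓡 d) x) : TangentSpace (𝓡 d) x :=
  let dG : Eu d →L[ℝ] Eu d →L[ℝ] Eu d →L[ℝ] ℝ :=
    mfderiv (𝓡 d) 𝓘(ℝ, Eu d →L[ℝ] Eu d →L[ℝ] ℝ) (metricCoeff g x) x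
  let ℓ : Eu d →L[ℝ] ℝ := (1 / 2 : ℝ) • (dG a b + dG b a - (dG.flip a).flip b)
  (g x).inverse ℓ

/-- The covariant derivative `(∇_u V)(p)` of a vector field `V` along a map `f : M → N`, for the
Levi-Civita connection `∇` of the metric `g` on `N`: in the preferred coordinates at `f p` it is
the derivative of the components of `V` in the direction `u`, plus `Γ (df u, V)`. -/
def covAlong (g : FormField d N) (f : M → N) (V : ∀ q : M, TangentSpace (𝓡 d) (f q)) (p : M)
    (u : TangentSpace (𝓡 m) p) : TangentSpace (𝓡 d) (f p) :=
  let V' : M → Eu d := fun q =>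
    (trivializationAt (Eu d) (TangentSpace (𝓡 d) : N → Type _) (f p) ⟨f q, V q⟩).2
  let D : Eu d := mfderiv (𝓡 m) 𝓘(ℝ, Eu d) V' p u
  let D' : TangentSpace (𝓡 d) (f p) := D
  D' + christoffel g (f p) (mfderiv (𝓡 m) (𝓡 d) f p u) (V p)

/-- The Levi-Civita covariant derivative `(∇_u Y)(x)` of a vector field `Y` on `N`. -/
def leviCivita (g : FormField d N) (Y : ∀ x : N, TangentSpace (𝓡 d) x) (x : N)
    (u : TangentSpace (𝓡 d) x) : TangentSpace (𝓡 d) x :=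
  covAlong (M := N) g (fun y => y) Y x u

/-- The derivative `X f` of a function along a vector field. -/
def dirDeriv (X : ∀ x : N, TangentSpace (𝓡 d) x) (f : N → ℝ) (x : N) : ℝ :=
  mfderiv (𝓡 d) 𝓘(ℝ, ℝ) f x (X x)

end Connection

/-! ### Submanifolds -/

section Submanifold

variable {m d : ℕ}
  {M : Type*} [TopologicalSpace M] [ChartedSpace (Eu m) M] [IsManifold (𝓡 m) ∞ M]
  {N : Type*} [TopologicalSpace N] [ChartedSpace (Eu d) N] [IsManifold (𝓡 d) ∞ N]

/-- `f : M → N` presents `M` as an (immersed) submanifold of `N`. -/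
def IsSubmanifoldMap (f : M → N) : Prop :=
  ContMDiff (𝓡 m) (𝓡 d) ∞ f ∧ ∀ p : M, Function.Injective (mfderiv (𝓡 m) (𝓡 d) f p)

/-- The tangential part of `v ∈ T_{f p} N`, as a vector of `T_p M`. -/
def tanPart (g : FormField d N) (f : M → N) (p : M) (v : TangentSpace (𝓡 d) (f p)) :
    TangentSpace (𝓡 m) p :=
  pullProj (g (f p)) (mfderiv (𝓡 m) (𝓡 d) f p) v

/-- The normal part of `v ∈ T_{f p} N`. -/
def norPart (g : FormField d N) (f : M → N) (p : M) (v : TangentSpace (𝓡 d) (f p)) :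
    TangentSpace (𝓡 d) (f p) :=
  v - mfderiv (𝓡 m) (𝓡 d) f p (tanPart g f p v)

/-- The second fundamental form `h (u, Y)` by the Gauss formula: the normal part of the ambient
covariant derivative of the tangent vector field `Y`. -/
def secondFF (g : FormField d N) (f : M → N) (Y : ∀ q : M, TangentSpace (𝓡 m) q) (p : M)
    (u : TangentSpace (𝓡 m) p) : TangentSpace (𝓡 d) (f p) :=
  norPart (m := m) g f p (covAlong g f (fun q => mfderiv (𝓡 m) (𝓡 d) f q (Y q)) p u)

/-- The shape operator `A_ζ u` by the Weingarten formula, for a normal vector field `ζ`: minus the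
tangential part of the ambient covariant derivative of `ζ`. -/
def shapeOp (g : FormField d N) (f : M → N) (ζ : ∀ q : M, TangentSpace (𝓡 d) (f q)) (p : M)
    (u : TangentSpace (𝓡 m) p) : TangentSpace (𝓡 m) p :=
  -tanPart g f p (covAlong g f ζ p u)

/-- A field of tangent subspaces on `M`. -/
abbrev SubspaceField (m : ℕ) (M : Type*) [TopologicalSpace M] [ChartedSpace (Eu m) M] : Type _ :=
  ∀ p : M, Submodule ℝ (TangentSpace (𝓡 m) p)

/-- `D` is a smooth distribution: near every point it is spanned by a smooth local frame. -/
def IsDistribution (D : SubspaceField m M) : Prop :=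
  ∀ p : M, ∃ (k : ℕ) (U : Set M) (X : Fin k → ∀ q : M, TangentSpace (𝓡 m) q),
    IsOpen U ∧ p ∈ U ∧
    (∀ i, ContMDiffOn (𝓡 m) (𝓡 m).tangent ∞
      (fun q => (TotalSpace.mk' (Eu m) q (X i q) : TangentBundle (𝓡 m) M)) U) ∧
    ∀ q ∈ U, LinearIndependent ℝ (fun i => X i q) ∧
      Submodule.span ℝ (Set.range fun i => X i q) = D q

/-- `X ∈ Γ(D)`. -/
def IsSectionOf (D : SubspaceField m M) (X : ∀ q : M, TangentSpace (𝓡 m) q) : Prop :=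
  IsSmoothVF X ∧ ∀ q, X q ∈ D q

/-- The orthogonal complement of `D` in `TM`. -/
def orthoCompl (gM : FormField m M) (D : SubspaceField m M) : SubspaceField m M := fun p =>
  { carrier := {v | ∀ u ∈ D p, gM p u v = 0}
    add_mem' := by
      intro a b ha hb u hu
      rw [map_add, ha u hu, hb u hu, add_zero]
    zero_mem' := by
      intro u _
      rw [map_zero]
    smul_mem' := by
      intro c a ha u hu
      rw [map_smul, ha u hu, smul_zero] }

/-- `ψ : Ω → M`, with `Ω ⊆ ℝᵏ` open, is a parametrized piece of an integral manifold of `D`: an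
immersion whose tangent spaces are the subspaces `D`. -/
def IsIntegralPatch {k : ℕ} (D : SubspaceField m M) (Ω : Set (Eu k)) (ψ : Eu k → M) : Prop :=
  IsOpen Ω ∧ ContMDiffOn (𝓡 k) (𝓡 m) ∞ ψ Ω ∧
  ∀ a ∈ Ω, Function.Injective (mfderiv (𝓡 k) (𝓡 m) ψ a) ∧
    ∀ v : TangentSpace (𝓡 m) (ψ a),
      v ∈ D (ψ a) ↔ ∃ u : TangentSpace (𝓡 k) a, mfderiv (𝓡 k) (𝓡 m) ψ a u = v

/-- The distribution `D` on the Riemannian manifold `(M, gM)` defines a totally geodesic foliation: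
it is integrable (an integral manifold passes through every point), and its integral manifolds are
totally geodesic in `(M, gM)`, that is, their second fundamental forms vanish. -/
def DefinesTotallyGeodesicFoliation (gM : FormField m M) (D : SubspaceField m M) : Prop :=
  (∀ p : M, ∃ (k : ℕ) (Ω : Set (Eu k)) (ψ : Eu k → M),
    IsIntegralPatch D Ω ψ ∧ ∃ a ∈ Ω, ψ a = p) ∧
  ∀ (k : ℕ) (Ω : Set (Eu k)) (ψ : Eu k → M), IsIntegralPatch D Ω ψ →
    ∀ Y : ∀ a : Eu k, TangentSpace (𝓡 k) a, IsSmoothVF Y →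
      ∀ a ∈ Ω, ∀ u : TangentSpace (𝓡 k) a, secondFF gM ψ Y a u = 0

/-- `(M, gM)` is locally the Riemannian product of integral manifolds `M₁` of `D₁` and `M₂` of `D₂`:
every point `p = Ψ (a₀, b₀)` has a neighbourhood which is the diffeomorphic image under some `Ψ` of
a product `U₁ × U₂` of open sets, such that the slices `Ψ (·, b)` and `Ψ (a, ·)` parametrize
integral manifolds of `D₁` and `D₂`, and `Ψ` is an isometry for the product of the metrics of the
two slices `M₁ = Ψ (U₁ × {b₀})` and `M₂ = Ψ ({a₀} × U₂)` through `p`. -/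
def IsLocallyRiemannianProduct (gM : FormField m M) (D₁ D₂ : SubspaceField m M) : Prop :=
  ∀ p : M, ∃ (k₁ k₂ : ℕ) (U₁ : Set (Eu k₁)) (U₂ : Set (Eu k₂))
    (Ψ : OpenPartialHomeomorph (Eu k₁ × Eu k₂) M),
    Ψ.source = U₁ ×ˢ U₂ ∧
    ContMDiffOn 𝓘(ℝ, Eu k₁ × Eu k₂) (𝓡 m) ∞ Ψ Ψ.source ∧
    ContMDiffOn (𝓡 m) 𝓘(ℝ, Eu k₁ × Eu k₂) ∞ Ψ.symm Ψ.target ∧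
    (∀ b ∈ U₂, IsIntegralPatch D₁ U₁ (fun a => Ψ (a, b))) ∧
    (∀ a ∈ U₁, IsIntegralPatch D₂ U₂ (fun b => Ψ (a, b))) ∧
    ∃ a₀ ∈ U₁, ∃ b₀ ∈ U₂, Ψ (a₀, b₀) = p ∧
      ∀ a ∈ U₁, ∀ b ∈ U₂, ∀ (u v : Eu k₁) (u' v' : Eu k₂),
        gM (Ψ (a, b)) (mfderiv 𝓘(ℝ, Eu k₁ × Eu k₂) (𝓡 m) Ψ (a, b) (u, u'))
            (mfderiv 𝓘(ℝ, Eu k₁ × Eu k₂) (𝓡 m) Ψ (a, b) (v, v')) =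
          inducedMetric (m := k₁) gM (fun a' => Ψ (a', b₀)) a u v +
          inducedMetric (m := k₂) gM (fun b' => Ψ (a₀, b')) b u' v'

end Submanifold

/-! ### Almost contact metric manifolds -/

/-- An almost contact metric structure `(φ, ξ, η, g)` on a manifold `N` of dimension `2n+1`. -/
structure AlmostContactMetric (n : ℕ) (N : Type*) [TopologicalSpace N]
    [ChartedSpace (Eu (2 * n + 1)) N] [IsManifold (𝓡 (2 * n + 1)) ∞ N] where
  /-- the Riemannian metric -/
  metric : ContMDiffRiemannianMetric (𝓡 (2 * n + 1)) ∞ (Eu (2 * n + 1))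
    (TangentSpace (𝓡 (2 * n + 1)) : N → Type _)
  /-- the tensor field of type `(1,1)` -/
  φ : ∀ x : N, TangentSpace (𝓡 (2 * n + 1)) x →L[ℝ] TangentSpace (𝓡 (2 * n + 1)) x
  /-- the characteristic vector field -/
  ξ : ∀ x : N, TangentSpace (𝓡 (2 * n + 1)) x
  /-- the one-form -/
  η : ∀ x : N, TangentSpace (𝓡 (2 * n + 1)) x →L[ℝ] ℝ
  smooth_φ : ContMDiff (𝓡 (2 * n + 1))
    ((𝓡 (2 * n + 1)).prod 𝓘(ℝ, Eu (2 * n + 1) →L[ℝ] Eu (2 * n + 1))) ∞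
    (fun x => TotalSpace.mk' (Eu (2 * n + 1) →L[ℝ] Eu (2 * n + 1))
      (E := fun x : N => TangentSpace (𝓡 (2 * n + 1)) x →L[ℝ] TangentSpace (𝓡 (2 * n + 1)) x)
      x (φ x))
  smooth_ξ : IsSmoothVF ξ
  smooth_η : ∀ X : ∀ x : N, TangentSpace (𝓡 (2 * n + 1)) x, IsSmoothVF X →
    ContMDiff (𝓡 (2 * n + 1)) 𝓘(ℝ, ℝ) ∞ (fun x => η x (X x))
  φ_φ : ∀ x v, φ x (φ x v) = -v + η x v • ξ x
  η_ξ : ∀ x, η x (ξ x) = 1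
  compat : ∀ x u v, metric.inner x (φ x u) (φ x v) = metric.inner x u v - η x u * η x v

namespace AlmostContactMetric

variable {n : ℕ} {N : Type*} [TopologicalSpace N] [ChartedSpace (Eu (2 * n + 1)) N]
  [IsManifold (𝓡 (2 * n + 1)) ∞ N] (S : AlmostContactMetric n N)

/-- The metric as a field of bilinear forms. -/
def g : FormField (2 * n + 1) N := S.metric.inner

/-- The exterior derivative of `η`, with the convention
`2 dη(X, Y) = X η(Y) - Y η(X) - η([X, Y])`. -/
def dη (X Y : ∀ x : N, TangentSpace (𝓡 (2 * n + 1)) x) (x : N) : ℝ :=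
  (1 / 2 : ℝ) * (dirDeriv X (fun y => S.η y (Y y)) x - dirDeriv Y (fun y => S.η y (X y)) x
    - S.η x (VectorField.mlieBracket (𝓡 (2 * n + 1)) X Y x))

/-- The fundamental 2-form `Φ(X, Y) = g(X, φ Y)`. -/
def Φ (X Y : ∀ x : N, TangentSpace (𝓡 (2 * n + 1)) x) (x : N) : ℝ :=
  S.g x (X x) (S.φ x (Y x))

/-- The exterior derivative of `Φ`, with the convention that goes with the one for `dη`. -/
def dΦ (X Y Z : ∀ x : N, TangentSpace (𝓡 (2 * n + 1)) x) (x : N) : ℝ :=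
  (1 / 3 : ℝ) * (dirDeriv X (S.Φ Y Z) x + dirDeriv Y (S.Φ Z X) x + dirDeriv Z (S.Φ X Y) x
    - S.Φ (VectorField.mlieBracket (𝓡 (2 * n + 1)) X Y) Z x
    - S.Φ (VectorField.mlieBracket (𝓡 (2 * n + 1)) Y Z) X x
    - S.Φ (VectorField.mlieBracket (𝓡 (2 * n + 1)) Z X) Y x)

/-- `φ X` for a vector field `X`. -/
def φVF (X : ∀ x : N, TangentSpace (𝓡 (2 * n + 1)) x) : ∀ x : N, TangentSpace (𝓡 (2 * n + 1)) x :=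
  fun x => S.φ x (X x)

/-- The Nijenhuis tensor of `φ`. -/
def nijenhuis (X Y : ∀ x : N, TangentSpace (𝓡 (2 * n + 1)) x) (x : N) :
    TangentSpace (𝓡 (2 * n + 1)) x :=
  S.φ x (S.φ x (VectorField.mlieBracket (𝓡 (2 * n + 1)) X Y x))
    + VectorField.mlieBracket (𝓡 (2 * n + 1)) (S.φVF X) (S.φVF Y) x
    - S.φ x (VectorField.mlieBracket (𝓡 (2 * n + 1)) (S.φVF X) Y x)
    - S.φ x (VectorField.mlieBracket (𝓡 (2 * n + 1)) X (S.φVF Y) x)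

/-- The structure is normal. -/
def IsNormal : Prop :=
  ∀ X Y : ∀ x : N, TangentSpace (𝓡 (2 * n + 1)) x, IsSmoothVF X → IsSmoothVF Y →
    ∀ x, S.nijenhuis X Y x + (2 * S.dη X Y x) • S.ξ x = 0

/-- Contact metric manifold: `Φ = dη`. -/
def IsContactMetric : Prop :=
  ∀ X Y : ∀ x : N, TangentSpace (𝓡 (2 * n + 1)) x, IsSmoothVF X → IsSmoothVF Y →
    ∀ x, S.Φ X Y x = S.dη X Y x

/-- Sasakian manifold: contact metric and normal. -/
def IsSasakian : Prop := S.IsContactMetric ∧ S.IsNormal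

/-- Almost cosymplectic manifold: `η` and `Φ` are closed. -/
def IsAlmostCosymplectic : Prop :=
  (∀ X Y : ∀ x : N, TangentSpace (𝓡 (2 * n + 1)) x, IsSmoothVF X → IsSmoothVF Y →
    ∀ x, S.dη X Y x = 0) ∧
  ∀ X Y Z : ∀ x : N, TangentSpace (𝓡 (2 * n + 1)) x,
    IsSmoothVF X → IsSmoothVF Y → IsSmoothVF Z → ∀ x, S.dΦ X Y Z x = 0

/-- Cosymplectic manifold: almost cosymplectic and normal. -/
def IsCosymplectic : Prop := S.IsAlmostCosymplectic ∧ S.IsNormal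

/-- Kenmotsu manifold: `(∇_X φ) Y = g(φ X, Y) ξ - η(Y) φ X`. -/
def IsKenmotsu : Prop :=
  ∀ X Y : ∀ x : N, TangentSpace (𝓡 (2 * n + 1)) x, IsSmoothVF X → IsSmoothVF Y →
    ∀ x, leviCivita S.g (S.φVF Y) x (X x) - S.φ x (leviCivita S.g Y x (X x)) =
      S.g x (S.φ x (X x)) (Y x) • S.ξ x - S.η x (Y x) • S.φ x (X x)

/-! ### Pointwise semi-slant submanifolds -/

variable {m : ℕ} {M : Type*} [TopologicalSpace M] [ChartedSpace (Eu m) M]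
  [IsManifold (𝓡 m) ∞ M] (f : M → N)

/-- `T X`: the tangential part of `φ X`, for a vector field `X` on the submanifold. -/
def T (X : ∀ p : M, TangentSpace (𝓡 m) p) : ∀ p : M, TangentSpace (𝓡 m) p :=
  fun p => tanPart S.g f p (S.φ (f p) (mfderiv (𝓡 m) (𝓡 (2 * n + 1)) f p (X p)))

/-- `F X`: the normal part of `φ X`, for a vector field `X` on the submanifold. -/
def F (S : AlmostContactMetric n N) (f : M → N)
    (X : ∀ p : M, TangentSpace (𝓡 m) p) : ∀ p : M, TangentSpace (𝓡 (2 * n + 1)) (f p) :=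
  fun p => norPart (m := m) S.g f p (S.φ (f p) (mfderiv (𝓡 m) (𝓡 (2 * n + 1)) f p (X p)))

/-- The metric of the submanifold. -/
def gM : FormField m M := inducedMetric S.g f

/-- The distribution `D₂`: the orthogonal complement of `D₁` in `TM`. -/
def D₂ (D₁ : SubspaceField m M) : SubspaceField m M := orthoCompl (S.gM f) D₁

/-- `ξ` is tangent to the submanifold. -/
def XiTangent : Prop :=
  ∀ p : M, ∃ v : TangentSpace (𝓡 m) p, mfderiv (𝓡 m) (𝓡 (2 * n + 1)) f p v = S.ξ (f p)

/-- `ξ` is normal to the submanifold. -/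
def XiNormal : Prop :=
  ∀ (p : M) (v : TangentSpace (𝓡 m) p),
    S.g (f p) (S.ξ (f p)) (mfderiv (𝓡 m) (𝓡 (2 * n + 1)) f p v) = 0

/-- The submanifold `f : M → N` is pointwise semi-slant, with the distribution `D₁` and the
semi-slant function `θ`: `D₁` is a distribution with `φ D₁ ⊆ D₁`, and at each point `p` the angle
between `φ X` and `D₂` is defined (`φ X ≠ 0`) and equal to `θ p` for every nonzero `X ∈ D₂`. -/
def IsPointwiseSemiSlant (D₁ : SubspaceField m M) (θ : M → ℝ) : Prop :=
  IsSubmanifoldMap (m := m) (d := 2 * n + 1) f ∧ IsDistribution D₁ ∧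
  (∀ (p : M), ∀ u ∈ D₁ p, ∃ w ∈ D₁ p, mfderiv (𝓡 m) (𝓡 (2 * n + 1)) f p w =
    S.φ (f p) (mfderiv (𝓡 m) (𝓡 (2 * n + 1)) f p u)) ∧
  ∀ (p : M), ∀ u ∈ S.D₂ f D₁ p, u ≠ 0 →
    S.φ (f p) (mfderiv (𝓡 m) (𝓡 (2 * n + 1)) f p u) ≠ 0 ∧
    angleToSubspace (S.g (f p)) (S.φ (f p) (mfderiv (𝓡 m) (𝓡 (2 * n + 1)) f p u))
      ((S.D₂ f D₁ p).map (mfderiv (𝓡 m) (𝓡 (2 * n + 1)) f p).toLinearMap) = θ p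

/-- Proper: the semi-slant function takes values in `(0, π/2)`. -/
def IsProperPointwiseSemiSlant (D₁ : SubspaceField m M) (θ : M → ℝ) : Prop :=
  S.IsPointwiseSemiSlant f D₁ θ ∧ ∀ p, θ p ∈ Ioo 0 (Real.pi / 2)

/-- The tangent vector field `A_{FZ} φX - A_{FTZ} X`, for `X ∈ Γ(D₁)` (so that `φ X = T X` is
tangent to the submanifold) and `Z ∈ Γ(D₂)`. -/
def shapeDefect (X Z : ∀ p : M, TangentSpace (𝓡 m) p) (p : M) : TangentSpace (𝓡 m) p :=
  shapeOp S.g f (S.F f Z) p (S.T f X p) - shapeOp S.g f (S.F f (S.T f Z)) p (X p)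

end AlmostContactMetric

end SemiSlant

end

/-! A distribution `D` on a Riemannian manifold defines a totally geodesic foliation exactly when
one tensorial expression vanishes: `g(∇_X Z, Y) = 0` for `X, Y` in `D` and `Z` orthogonal to `D`
(`definesTotallyGeodesicFoliation_iff`). The condition says that differentiating sections of `D` in
directions of `D` stays in `D`. As `∇` is torsion-free, brackets then stay in `D`, Frobenius'
theorem yields the leaves, and their second fundamental forms vanish. If both `D` and its complement
satisfy the condition, first integrals of the two distributions together form coordinates in which
the metric splits into two blocks, each depending on its own variables only; the Koszul formula
gives the converse (`isLocallyRiemannianProduct_iff`).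

What remains is to express `g(∇_u Z, X)`, for `X` in `D₁`, `Z` in `D₂` and `u` tangent, by shape
operators. This is `gM_shapeDefect`. One expands `FZ = φZ - TZ` in the Weingarten formula and uses
that shape operators are self-adjoint, that `φ` is skew and isometric up to `η`, and that `T² =
-cos²θ` on `D₂` (`tanφ_tanφ`). The result is that `g(A_{FZ}φX - A_{FTZ}X, u)` equals `-sin²θ g(∇_u
Z, X)` plus terms in the ambient tensors `∇φ` and `∇ξ`.

The ambient terms are computed class by class. `∇ξ` is recovered from `∇φ` (`α_eq`). In the Kenmotsu
case `∇φ` is given by definition. In the cosymplectic and Sasakian cases it follows from normality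
and the exterior derivatives by Blair's formula (`two_mul_P`), which yields `∇φ = 0` and `(∇_X φ)Y =
g(X, Y)ξ - η(Y)X`. Because `η` vanishes on `D₂` (`η_push_eq_zero`), the ambient terms cancel in
these two cases and leave `-sin²θ η(X) g(u, Z)` in the Kenmotsu case. That remainder disappears if
`ξ` is normal, and also if `u` lies in `D₁`. Since `sin²θ` is never zero, all the criteria follow.

Frobenius' theorem is proved by integrating along rays. The ray equation is an integral equation in
a Banach space of curves, so smooth dependence on the endpoint and on the initial value comes from
the inverse function theorem there. -/

noncomputable section

set_option linter.unusedSectionVars false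

namespace SemiSlant

/-! ### Smoothness of superposition operators on spaces of continuous curves -/

section Superposition

universe u

variable {I : Type*} [TopologicalSpace I] [CompactSpace I]

/-- The superposition operator `γ ↦ A ∘ γ` on spaces of continuous functions. -/
def superposition {V W : Type*} [TopologicalSpace V] [TopologicalSpace W] (A : V → W)
    (hA : Continuous A) (γ : C(I, V)) : C(I, W) := ContinuousMap.comp ⟨A, hA⟩ γ

variable {V W X : Type u} [NormedAddCommGroup V] [NormedSpace ℝ V]
  [NormedAddCommGroup W] [NormedSpace ℝ W] [NormedAddCommGroup X] [NormedSpace ℝ X]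

/-- Pointwise application of a continuous bilinear map to continuous curves. -/
def pointwiseBilin (I : Type*) [TopologicalSpace I] [CompactSpace I] (b : X →L[ℝ] V →L[ℝ] W) :
    C(I, X) →L[ℝ] C(I, V) →L[ℝ] C(I, W) :=
  LinearMap.mkContinuous₂
    (LinearMap.mk₂ ℝ (fun (B : C(I, X)) (δ : C(I, V)) =>
        (⟨fun s => b (B s) (δ s), by fun_prop⟩ : C(I, W)))
      (fun _ _ _ => by ext; simp) (fun _ _ _ => by ext; simp)
      (fun _ _ _ => by ext; simp) (fun _ _ _ => by ext; simp)) ‖b‖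
    (fun B δ => by
      rw [ContinuousMap.norm_le _ (by positivity)]
      intro s
      exact (b.le_opNorm₂ (B s) (δ s)).trans (by
        gcongr <;> exact ContinuousMap.norm_coe_le_norm _ s))

theorem pointwiseBilin_apply (b : X →L[ℝ] V →L[ℝ] W) (B : C(I, X)) (δ : C(I, V)) (s : I) :
    pointwiseBilin I b B δ s = b (B s) (δ s) := rfl

/-- The range of `γ` is compact, so the mean value inequality, applied at each parameter `s`, gives
a remainder estimate uniform in `s`. Writing the derivative as `b (A' v)` exhibits the derivative of
a superposition operator as a fixed bilinear map applied to another superposition operator. -/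
theorem hasFDerivAt_superposition (b : X →L[ℝ] V →L[ℝ] W) {A : V → W} {A' : V → X}
    (hA : Continuous A) (hA' : Continuous A') (h : ∀ v, HasFDerivAt A (b (A' v)) v) (γ : C(I, V)) :
    HasFDerivAt (superposition (I := I) A hA)
      (pointwiseBilin I b (superposition A' hA' γ)) γ := by
  rw [hasFDerivAt_iff_isLittleO_nhds_zero, Asymptotics.isLittleO_iff]
  intro ε hε
  have hK : IsCompact (Set.range γ) := isCompact_range γ.continuous
  have hbA : Continuous fun v => b (A' v) := b.continuous.comp hA'
  -- This form of uniform continuity asks only one of the two points to lie on the curve; the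
  -- perturbed point need not.
  have hu := hK.uniformContinuousAt_of_continuousAt (fun v => b (A' v))
    (fun v _ => hbA.continuousAt) (Metric.dist_mem_uniformity hε)
  obtain ⟨ρ, hρ, hρ'⟩ := Metric.mem_uniformity_dist.1 hu
  filter_upwards [Metric.ball_mem_nhds (0 : C(I, V)) hρ] with δ hδ
  rw [ContinuousMap.norm_le _ (by positivity)]
  intro s
  have hδ' : ‖δ‖ < ρ := by simpa using hδ
  have hδs : ‖δ s‖ ≤ ‖δ‖ := δ.norm_coe_le_norm s
  have h1 := (convex_ball (γ s) ρ).norm_image_sub_le_of_norm_hasFDerivWithin_le' (f := A) (𝕜 := ℝ)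
    (φ := b (A' (γ s))) (C := ε) (x := γ s) (y := γ s + δ s) (f' := fun v => b (A' v))
    (fun z _ => (h z).hasFDerivWithinAt) (fun z hz => by
      have := @hρ' (γ s) z (by rw [dist_comm]; exact hz) ⟨s, rfl⟩
      simp only [Set.mem_ofPred_eq] at this
      rw [← dist_eq_norm, dist_comm]; exact this.le) (Metric.mem_ball_self hρ)
    (by simpa using hδs.trans_lt hδ')
  simp only [add_sub_cancel_left] at h1
  calc _ = ‖A (γ s + δ s) - A (γ s) - b (A' (γ s)) (δ s)‖ := rfl
    _ ≤ ε * ‖δ s‖ := h1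
    _ ≤ ε * ‖δ‖ := by gcongr

/-- The derivative is a continuous linear map composed with the superposition operator of `A'`,
hence exactly as smooth as the latter. -/
theorem contDiff_succ_superposition (b : X →L[ℝ] V →L[ℝ] W) {A : V → W} {A' : V → X} {n : ℕ}
    (hA : Continuous A) (hA' : Continuous A') (h : ∀ v, HasFDerivAt A (b (A' v)) v)
    (hn : ContDiff ℝ n (superposition (I := I) A' hA')) :
    ContDiff ℝ (n + 1) (superposition (I := I) A hA) :=
  contDiff_succ_iff_hasFDerivAt.2 ⟨_, (pointwiseBilin I b).contDiff.comp hn,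
    hasFDerivAt_superposition b hA hA' h⟩

/-- Induction on the order of differentiability, with the target varying because `fderiv ℝ A` takes
values in `V →L[ℝ] W`. This is why all the spaces share one universe. -/
theorem contDiff_superposition {A : V → W} (hA : ContDiff ℝ ∞ A) :
    ContDiff ℝ ∞ (superposition (I := I) A hA.continuous) := by
  rw [contDiff_infty]
  intro n
  induction n generalizing W with
  | zero =>
    rw [Nat.cast_zero, contDiff_zero]
    exact ContinuousMap.continuous_postcomp _
  | succ n ih =>
    have hA' : ContDiff ℝ ∞ (fderiv ℝ A) := hA.fderiv_right (by simp)
    exact contDiff_succ_superposition (ContinuousLinearMap.id ℝ (V →L[ℝ] W)) _ hA'.continuous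
      (fun v => (hA.differentiable (by simp) v).hasFDerivAt) (ih hA')

end Superposition

/-! ### Integration of curves and the inverse function theorem -/

/-- Indefinite integration on the unit interval. -/
def primitive (F : Type*) [NormedAddCommGroup F] [NormedSpace ℝ F] [CompleteSpace F] :
    C(unitInterval, F) →L[ℝ] C(unitInterval, F) :=
  LinearMap.mkContinuous
    { toFun := fun β => ⟨fun t => ∫ s in (0 : ℝ)..t, Set.IccExtend zero_le_one β s, by
        have hc : Continuous (Set.IccExtend (zero_le_one (α := ℝ)) β) := β.continuous.Icc_extend'
        exact (intervalIntegral.continuous_primitive (fun a b => hc.intervalIntegrable a b) 0).comp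
          continuous_subtype_val⟩
      map_add' := fun β β' => by
        ext t
        simp only [ContinuousMap.coe_mk, ContinuousMap.add_apply]
        rw [← intervalIntegral.integral_add (Continuous.intervalIntegrable β.continuous.Icc_extend' _ _)
          (Continuous.intervalIntegrable β'.continuous.Icc_extend' _ _)]
        rfl
      map_smul' := fun c β => by
        ext t
        simp only [ContinuousMap.coe_mk, ContinuousMap.smul_apply, RingHom.id_apply]
        rw [← intervalIntegral.integral_smul]
        rfl } 1
    (fun β => by
      rw [ContinuousMap.norm_le _ (by positivity)]
      intro t
      have := intervalIntegral.norm_integral_le_of_norm_le_const (a := (0:ℝ)) (b := t)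
        (f := Set.IccExtend (zero_le_one (α := ℝ)) β) (C := ‖β‖)
        (fun s _ => β.norm_coe_le_norm _)
      refine this.trans ?_
      rw [one_mul]
      refine mul_le_of_le_one_right (norm_nonneg _) ?_
      rw [sub_zero, abs_of_nonneg t.2.1]; exact t.2.2)

/-- The inverse function theorem, with smoothness of the local inverse on its whole domain. -/
theorem exists_smooth_openPartialHomeomorph {E F : Type*} [NormedAddCommGroup E] [NormedSpace ℝ E]
    [CompleteSpace E] [NormedAddCommGroup F] [NormedSpace ℝ F] {f : E → F} {O : Set E}
    (hO : IsOpen O) (hf : ContDiffOn ℝ ∞ f O) {a : E} (ha : a ∈ O) (f' : E ≃L[ℝ] F)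
    (hf' : HasFDerivAt f (f' : E →L[ℝ] F) a) :
    ∃ e : OpenPartialHomeomorph E F, a ∈ e.source ∧ e.source ⊆ O ∧ (∀ x, e x = f x) ∧
      ContDiffOn ℝ ∞ e.symm e.target ∧ ∀ x ∈ e.source, (fderiv ℝ f x).IsInvertible := by
  have hfa : ContDiffAt ℝ ∞ f a := hf.contDiffAt (hO.mem_nhds ha)
  let e₀ := hfa.toOpenPartialHomeomorph f hf' (by simp)
  have hcont : ContinuousOn (fderiv ℝ f) O := hf.continuousOn_fderiv_of_isOpen hO (by simp)
  -- Invertibility of the derivative is an open condition. Restricting to it makes the local inverse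
  -- smooth on its whole target, not merely at the image of `a`.
  have hU : IsOpen (O ∩ fderiv ℝ f ⁻¹' Set.range ((↑) : (E ≃L[ℝ] F) → E →L[ℝ] F)) :=
    hcont.isOpen_inter_preimage hO (ContinuousLinearEquiv.isOpen)
  let U := O ∩ fderiv ℝ f ⁻¹' Set.range ((↑) : (E ≃L[ℝ] F) → E →L[ℝ] F)
  have haU : a ∈ U := ⟨ha, f', hf'.fderiv.symm⟩
  refine ⟨e₀.restrOpen U hU, ⟨hfa.mem_toOpenPartialHomeomorph_source hf' (by simp), haU⟩,
    fun x hx => hx.2.1, fun x => rfl, ?_, ?_⟩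
  · intro y hy
    obtain ⟨hxO, g, hg⟩ := ((e₀.restrOpen U hU).map_target hy).2
    refine ContDiffAt.contDiffWithinAt ?_
    refine (e₀.restrOpen U hU).contDiffAt_symm (f₀' := g) hy ?_ ?_
    · rw [hg]
      exact ((hf.contDiffAt (hO.mem_nhds hxO)).differentiableAt (by simp)).hasFDerivAt
    · exact hf.contDiffAt (hO.mem_nhds hxO)
  · rintro x ⟨_, _, g, hg⟩
    exact ⟨g, hg⟩

/-! ### Integration along rays of an integrable family of linear maps -/

section FlatFamily

universe u
variable {E F : Type u} [NormedAddCommGroup E] [NormedSpace ℝ E] [FiniteDimensional ℝ E]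
  [NormedAddCommGroup F] [NormedSpace ℝ F] [FiniteDimensional ℝ F]

/-- The right hand side `(x', x, y) ↦ A (x', y) x` of the equation along rays. -/
def rayField (A : E × F → E →L[ℝ] F) (z : E × E × F) : F := A (z.1, z.2.2) z.2.1

omit [FiniteDimensional ℝ E] [FiniteDimensional ℝ F] in
theorem contDiff_rayField {A : E × F → E →L[ℝ] F} (hA : ContDiff ℝ ∞ A) :
    ContDiff ℝ ∞ (rayField A) := by
  unfold rayField
  exact (hA.comp (contDiff_fst.prodMk contDiff_snd.snd)).clm_apply contDiff_snd.fst

omit [FiniteDimensional ℝ E] [FiniteDimensional ℝ F] in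
theorem fderiv_rayField {A : E × F → E →L[ℝ] F} (hA : ContDiff ℝ ∞ A) (z h : E × E × F) :
    fderiv ℝ (rayField A) z h =
      fderiv ℝ A (z.1, z.2.2) (h.1, h.2.2) z.2.1 + A (z.1, z.2.2) h.2.1 := by
  have h1 : HasFDerivAt (fun z : E × E × F => A (z.1, z.2.2)) _ z :=
    HasFDerivAt.comp z (hA.differentiable (by simp) (z.1, z.2.2)).hasFDerivAt
      (hasFDerivAt_fst.prodMk hasFDerivAt_snd.snd)
  have h2 : HasFDerivAt (rayField A) _ z := h1.clm_apply hasFDerivAt_snd.fst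
  rw [h2.fderiv]
  simp [add_comm]

/-- The curve `s ↦ (s x, x, γ s)`. -/
def rayCurve (E F : Type u) [NormedAddCommGroup E] [NormedSpace ℝ E] [FiniteDimensional ℝ E]
    [NormedAddCommGroup F] [NormedSpace ℝ F] :
    E × C(unitInterval, F) →L[ℝ] C(unitInterval, E × E × F) :=
  (LinearMap.toContinuousLinearMap
    ({ toFun := fun x => ⟨fun s => ((s : ℝ) • x, x, 0), by fun_prop⟩
       map_add' := fun x y => by ext s <;> simp
       map_smul' := fun c x => by ext s <;> simp [smul_comm (c : ℝ)] } :
       E →ₗ[ℝ] C(unitInterval, E × E × F))).comp (ContinuousLinearMap.fst ℝ _ _) +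
  (ContinuousLinearMap.compLeftContinuous ℝ unitInterval
    ((ContinuousLinearMap.inr ℝ E (E × F)).comp (ContinuousLinearMap.inr ℝ E F))).comp
    (ContinuousLinearMap.snd ℝ _ _)

omit [FiniteDimensional ℝ F] in
theorem rayCurve_apply (x : E) (γ : C(unitInterval, F)) (s : unitInterval) :
    rayCurve E F (x, γ) s = ((s : ℝ) • x, x, γ s) := by
  simp [rayCurve]

/-- The integral operator of the equation along rays. -/
def rayOperator (A : E × F → E →L[ℝ] F) (hA : ContDiff ℝ ∞ A) (z : E × C(unitInterval, F)) :
    C(unitInterval, F) :=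
  primitive F (superposition (rayField A) (contDiff_rayField hA).continuous (rayCurve E F z))

theorem contDiff_rayOperator {A : E × F → E →L[ℝ] F} (hA : ContDiff ℝ ∞ A) :
    ContDiff ℝ ∞ (rayOperator A hA) :=
  (primitive F).contDiff.comp
    ((contDiff_superposition (contDiff_rayField hA)).comp (rayCurve E F).contDiff)

/-- The integrand `A (s x, γ s) x` is linear in the last `x`. Consequently constant curves solve the
equation for `x = 0`, and the derivative of the operator in the curve variable is zero there, which
makes the inverse function theorem applicable. -/
theorem rayOperator_zero {A : E × F → E →L[ℝ] F} (hA : ContDiff ℝ ∞ A) (γ : C(unitInterval, F)) :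
    rayOperator A hA (0, γ) = 0 := by
  have : superposition (rayField A) (contDiff_rayField hA).continuous (rayCurve E F (0, γ)) = 0 := by
    ext s
    simp [superposition, rayCurve_apply, rayField]
  rw [rayOperator, this, map_zero]

theorem hasFDerivAt_rayOperator {A : E × F → E →L[ℝ] F} (hA : ContDiff ℝ ∞ A)
    (z : E × C(unitInterval, F)) :
    HasFDerivAt (rayOperator A hA) ((primitive F).comp
      ((pointwiseBilin unitInterval (ContinuousLinearMap.id ℝ (E × E × F →L[ℝ] F))
        (superposition (fderiv ℝ (rayField A))
          ((contDiff_rayField hA).continuous_fderiv (by simp)) (rayCurve E F z))).comp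
        (rayCurve E F))) z :=
  (primitive F).hasFDerivAt.comp z
    ((hasFDerivAt_superposition (ContinuousLinearMap.id ℝ (E × E × F →L[ℝ] F))
      (contDiff_rayField hA).continuous _
      (fun v => ((contDiff_rayField hA).differentiable (by simp) v).hasFDerivAt) _).comp z
      (rayCurve E F).hasFDerivAt)

omit [FiniteDimensional ℝ E] in
theorem exists_norm_fderiv_le {X : Type*} [NormedAddCommGroup X] [NormedSpace ℝ X] {A : E → X}
    (hA : Continuous (fderiv ℝ A)) {z : ℝ → E} (hz : Continuous z) :
    ∃ C, ∀ t ∈ Icc (0 : ℝ) 1, ∀ v, ‖fderiv ℝ A (z t) v‖ ≤ C * ‖v‖ := by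
  obtain ⟨C, hC⟩ := isCompact_Icc.exists_bound_of_continuousOn (s := Icc (0 : ℝ) 1)
    (hA.comp hz).continuousOn
  exact ⟨C, fun t ht v => ContinuousLinearMap.le_of_opNorm_le _ (hC t ht) v⟩

/-- Here `w` is the variation of the solution `γ` when the endpoint `x` moves in the direction `h`.
The integrability condition makes `t ↦ t • A (t x, γ t) h` a solution of the same linear equation
with the same initial value, so Gronwall's inequality identifies the two curves, and `t = 1` is the
claim. -/
theorem ray_variation {A : E × F → E →L[ℝ] F} (hA : ContDiff ℝ ∞ A) {x h : E} {y : F}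
    {γ w : C(unitInterval, F)}
    (hint : ∀ s : unitInterval, ∀ k l, fderiv ℝ A ((s : ℝ) • x, γ s) (k, A ((s : ℝ) • x, γ s) k) l =
      fderiv ℝ A ((s : ℝ) • x, γ s) (l, A ((s : ℝ) • x, γ s) l) k)
    (hγ : γ = ContinuousMap.const _ y + rayOperator A hA (x, γ))
    (hw : w = fderiv ℝ (rayOperator A hA) (x, γ) (h, w)) :
    w 1 = A (x, γ 1) h := by
  set β : C(unitInterval, F) :=
    superposition (rayField A) (contDiff_rayField hA).continuous (rayCurve E F (x, γ)) with hβ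
  rw [(hasFDerivAt_rayOperator hA _).fderiv] at hw
  set om : C(unitInterval, F) := pointwiseBilin unitInterval
    (ContinuousLinearMap.id ℝ (E × E × F →L[ℝ] F)) (superposition (fderiv ℝ (rayField A))
      ((contDiff_rayField hA).continuous_fderiv (by simp)) (rayCurve E F (x, γ)))
      (rayCurve E F (h, w)) with h_om
  have hβs : ∀ s : unitInterval, β s = A ((s : ℝ) • x, γ s) x := fun s => by
    simp [hβ, superposition, rayCurve_apply, rayField]
  have h_oms : ∀ s : unitInterval, om s =
      fderiv ℝ A ((s : ℝ) • x, γ s) ((s : ℝ) • h, w s) x + A ((s : ℝ) • x, γ s) h := fun s => by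
    rw [h_om, pointwiseBilin_apply]
    simp only [ContinuousLinearMap.id_apply, superposition, ContinuousMap.comp_apply,
      ContinuousMap.coe_mk, rayCurve_apply, fderiv_rayField hA]
  -- Both curves are continued to the whole line, with integrands constant outside the unit
  -- interval, so that two-sided derivatives exist also at the endpoints.
  let γ' : ℝ → F := fun t => y + ∫ s in (0 : ℝ)..t, Set.IccExtend zero_le_one β s
  let w' : ℝ → F := fun t => ∫ s in (0 : ℝ)..t, Set.IccExtend zero_le_one om s
  have hγ'e : ∀ t : unitInterval, γ' t = γ t := fun t => by
    conv_rhs => rw [hγ]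
    rfl
  have hw'e : ∀ t : unitInterval, w' t = w t := fun t => by
    conv_rhs => rw [hw]
    rfl
  have hγ'd : ∀ t, HasDerivAt γ' (Set.IccExtend zero_le_one β t) t := fun t => by
    have hc : Continuous (Set.IccExtend (zero_le_one (α := ℝ)) β) := β.continuous.Icc_extend'
    exact (hc.integral_hasStrictDerivAt 0 t).hasDerivAt.const_add y
  have hw'd : ∀ t, HasDerivAt w' (Set.IccExtend zero_le_one om t) t := fun t => by
    have hc : Continuous (Set.IccExtend (zero_le_one (α := ℝ)) om) := om.continuous.Icc_extend'
    exact (hc.integral_hasStrictDerivAt 0 t).hasDerivAt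
  have hz : ∀ t, HasDerivAt (fun t : ℝ => (t • x, γ' t)) (x, Set.IccExtend zero_le_one β t) t :=
    fun t => by simpa using ((hasDerivAt_id t).smul_const x).prodMk (hγ'd t)
  let v : ℝ → F := fun t => w' t - t • A (t • x, γ' t) h
  have hv : ∀ t, HasDerivAt v (Set.IccExtend zero_le_one om t -
      (t • fderiv ℝ A (t • x, γ' t) (x, Set.IccExtend zero_le_one β t) h + A (t • x, γ' t) h)) t := by
    intro t
    have h1 : HasDerivAt (fun t : ℝ => A (t • x, γ' t)) _ t :=
      (hA.differentiable (by simp) (t • x, γ' t)).hasFDerivAt.comp_hasDerivAt t (hz t)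
    have h2 := (hasDerivAt_id t).smul (h1.clm_apply (hasDerivAt_const t h))
    exact ((hw'd t).sub h2).congr_deriv (by simp)
  obtain ⟨C, hC⟩ := exists_norm_fderiv_le (hA.continuous_fderiv (by simp))
    (continuous_iff_continuousAt.2 fun t => (hz t).continuousAt)
  have key := norm_le_gronwallBound_of_norm_deriv_right_le (f := v) (a := 0) (b := 1) (δ := 0)
    (K := C * ‖x‖) (ε := 0)
    (continuous_iff_continuousAt.2 fun t => (hv t).continuousAt).continuousOn
    (fun t _ => (hv t).hasDerivWithinAt) (by simp [v, w']) (fun t ht => by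
      have ht' : t ∈ Icc (0 : ℝ) 1 := Ico_subset_Icc_self ht
      have e1 := hγ'e ⟨t, ht'⟩
      have e2 := hw'e ⟨t, ht'⟩
      simp only at e1 e2
      rw [Set.IccExtend_of_mem _ _ ht', Set.IccExtend_of_mem _ _ ht', h_oms, hβs, ← e1, ← e2]
      simp only
      have hi := hint ⟨t, ht'⟩ x h
      simp only at hi
      rw [← e1] at hi
      -- After exchanging `x` and `h` by integrability, the inhomogeneous terms cancel, and the
      -- difference `v` satisfies a homogeneous linear equation with `v 0 = 0`.
      have hvt : fderiv ℝ A (t • x, γ' t) (t • h, w' t) x + A (t • x, γ' t) h -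
          (t • fderiv ℝ A (t • x, γ' t) (x, A (t • x, γ' t) x) h + A (t • x, γ' t) h) =
          fderiv ℝ A (t • x, γ' t) (0, v t) x := by
        rw [hi]
        have : ((0 : E), v t) = (t • h, w' t) - t • (h, A (t • x, γ' t) h) := by
          ext <;> simp [v]
        rw [this, map_sub, map_smul]
        simp
      rw [hvt, add_zero]
      calc ‖fderiv ℝ A (t • x, γ' t) (0, v t) x‖ ≤ ‖fderiv ℝ A (t • x, γ' t) (0, v t)‖ * ‖x‖ :=
            ContinuousLinearMap.le_opNorm _ _
        _ ≤ (C * ‖((0 : E), v t)‖) * ‖x‖ := by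
            gcongr
            exact hC t ht' _
        _ = C * ‖x‖ * ‖v t‖ := by rw [Prod.norm_mk, norm_zero, max_eq_right (norm_nonneg _)]; ring)
    1 (by simp)
  rw [gronwallBound_ε0_δ0] at key
  have hv1 : v 1 = 0 := by simpa using key
  have e1 := hγ'e 1
  have e2 := hw'e 1
  simp only [v, one_smul] at hv1
  rw [← e1, ← e2]
  exact sub_eq_zero.1 hv1

/-- `Y (x, y)` is the endpoint of the solution that starts at `y` and runs along the segment from
`0` to `x`. Smoothness in `(x, y)` comes from the inverse function theorem in the space of curves,
and the differential equation in all directions `h`, not only the radial one, from `ray_variation`.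
-/
theorem exists_flat_family {A : E × F → E →L[ℝ] F} (hA : ContDiff ℝ ∞ A) {U : Set (E × F)}
    (hU : IsOpen U) {y₀ : F} (h₀ : (0, y₀) ∈ U)
    (hint : ∀ z ∈ U, ∀ h k, fderiv ℝ A z (h, A z h) k = fderiv ℝ A z (k, A z k) h) :
    ∃ (W : Set (E × F)) (Y : E × F → F), IsOpen W ∧ (0, y₀) ∈ W ∧ ContDiffOn ℝ ∞ Y W ∧
      (∀ y, (0, y) ∈ W → Y (0, y) = y) ∧
      ∀ z ∈ W, (z.1, Y z) ∈ U ∧ ∀ h, fderiv ℝ Y z (h, 0) = A (z.1, Y z) h := by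
  let K := rayOperator A hA
  have hK : ContDiff ℝ ∞ K := contDiff_rayOperator hA
  -- A curve `γ` solves the integral equation with initial value `y` exactly when `Θ (x, γ)` is `(x,
  -- const y)`, so a local inverse of `Θ` is the solution operator.
  let Θ : E × C(unitInterval, F) → E × C(unitInterval, F) := fun z => (z.1, z.2 - K z)
  have hΘ : ContDiff ℝ ∞ Θ := contDiff_fst.prodMk (contDiff_snd.sub hK)
  let c : C(unitInterval, F) := ContinuousMap.const _ y₀
  let K' := fderiv ℝ K (0, c)
  have hK' : ∀ δ, K' (0, δ) = 0 := by
    intro δ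
    have h1 : HasFDerivAt (fun γ : C(unitInterval, F) => K (0, γ)) _ c :=
      HasFDerivAt.comp (g := K) c (hK.differentiable (by simp) (0, c)).hasFDerivAt
        ((hasFDerivAt_const (0 : E) c).prodMk (hasFDerivAt_id c))
    have h2 : (fun γ : C(unitInterval, F) => K (0, γ)) = fun _ => 0 :=
      funext fun γ => rayOperator_zero hA γ
    rw [h2] at h1
    have := congrArg (fun f => f δ) (h1.unique (hasFDerivAt_const 0 c))
    simpa using this
  have hK'' : ∀ z, K' z = K' (z.1, 0) := fun z => by
    have : z = (z.1, 0) + (0, z.2) := by simp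
    rw [this, map_add, hK']; simp
  let f' : (E × C(unitInterval, F)) ≃L[ℝ] (E × C(unitInterval, F)) :=
    ContinuousLinearEquiv.equivOfInverse
      ((ContinuousLinearMap.fst ℝ _ _).prod (ContinuousLinearMap.snd ℝ _ _ - K'))
      ((ContinuousLinearMap.fst ℝ _ _).prod (ContinuousLinearMap.snd ℝ _ _ + K'))
      (fun z => by ext1 <;> simp [hK'' z, hK'' (z.1, z.2 - K' (z.1, 0))])
      (fun z => by ext1 <;> simp [hK'' z, hK'' (z.1, z.2 + K' (z.1, 0))])
  have hf' : HasFDerivAt Θ (f' : _ →L[ℝ] _) (0, c) :=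
    hasFDerivAt_fst.prodMk (hasFDerivAt_snd.sub (hK.differentiable (by simp) (0, c)).hasFDerivAt)
  obtain ⟨e, he0, -, heΘ, hesymm, -⟩ := exists_smooth_openPartialHomeomorph isOpen_univ
    hΘ.contDiffOn (mem_univ (0, c)) f' hf'
  let κ : E × F →L[ℝ] E × C(unitInterval, F) :=
    (ContinuousLinearMap.fst ℝ E F).prod
      ((ContinuousLinearMap.const ℝ unitInterval).comp (ContinuousLinearMap.snd ℝ E F))
  have hκ : ∀ z, κ z = (z.1, ContinuousMap.const _ z.2) := fun z => rfl
  let W₀ : Set (E × F) := κ ⁻¹' e.target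
  have hW₀ : IsOpen W₀ := e.open_target.preimage κ.continuous
  let Γ : E × F → C(unitInterval, F) := fun z => (e.symm (κ z)).2
  have hΓ : ContDiffOn ℝ ∞ Γ W₀ :=
    contDiff_snd.comp_contDiffOn (hesymm.comp κ.contDiff.contDiffOn (fun z hz => hz))
  have hΓeq : ∀ z ∈ W₀, Γ z = ContinuousMap.const _ z.2 + K (z.1, Γ z) := by
    intro z hz
    have h1 : Θ (e.symm (κ z)) = κ z := by rw [← heΘ, e.right_inv hz]
    have h2 : (e.symm (κ z)).1 = z.1 := congrArg Prod.fst h1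
    have h3 : (e.symm (κ z)).2 - K (e.symm (κ z)) = ContinuousMap.const _ z.2 :=
      congrArg Prod.snd h1
    rw [← h3]
    have : e.symm (κ z) = (z.1, Γ z) := Prod.ext h2 rfl
    rw [this]; simp
  have hz₀ : (0, y₀) ∈ W₀ := by
    have : Θ (0, c) = κ (0, y₀) := by
      simp only [Θ, hκ]
      rw [show K (0, c) = 0 from rayOperator_zero hA c, sub_zero]
    show κ (0, y₀) ∈ e.target
    rw [← this, ← heΘ]
    exact e.map_source he0
  -- Integrability is only known on `U`, so the whole path `s ↦ (s x, γ s)` has to stay there; for a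
  -- path on a compact interval this is an open condition in the compact-open topology.
  let τ : E × F → C(unitInterval, E × F) := fun z =>
    superposition (fun w : E × E × F => (w.1, w.2.2)) (by fun_prop) (rayCurve E F (z.1, Γ z))
  have hτ : ∀ z s, τ z s = ((s : ℝ) • z.1, Γ z s) := fun z s => by
    simp [τ, superposition, rayCurve_apply]
  have hτc : ContinuousOn τ W₀ := by
    refine (ContinuousMap.continuous_postcomp _).comp_continuousOn
      ((rayCurve E F).continuous.comp_continuousOn ?_)
    exact continuousOn_fst.prodMk hΓ.continuousOn
  refine ⟨W₀ ∩ τ ⁻¹' {f | MapsTo f univ U}, fun z => Γ z 1,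
    hτc.isOpen_inter_preimage hW₀ (ContinuousMap.isOpen_setOfPred_mapsTo isCompact_univ hU),
    ⟨hz₀, ?_⟩, ?_, ?_, ?_⟩
  · intro s _
    rw [hτ]
    have := hΓeq _ hz₀
    rw [show K ((0 : E), Γ (0, y₀)) = 0 from rayOperator_zero hA _, add_zero] at this
    simp only [this, smul_zero, ContinuousMap.const_apply]
    exact h₀
  · exact (ContinuousMap.evalCLM ℝ (1 : unitInterval)).contDiff.comp_contDiffOn
      (hΓ.mono inter_subset_left)
  · intro y hy
    have := hΓeq _ hy.1
    rw [show K ((0 : E), Γ (0, y)) = 0 from rayOperator_zero hA _, add_zero] at this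
    simp only [this, ContinuousMap.const_apply]
  · rintro z ⟨hz, hzU⟩
    have hzU' : ∀ s : unitInterval, ((s : ℝ) • z.1, Γ z s) ∈ U := fun s => hτ z s ▸ hzU (mem_univ s)
    refine ⟨by simpa using hzU' 1, fun h => ?_⟩
    have hd : HasFDerivAt Γ (fderiv ℝ Γ z) z :=
      ((hΓ.contDiffAt (hW₀.mem_nhds hz)).differentiableAt (by simp)).hasFDerivAt
    have h1 : HasFDerivAt (fun z => Γ z 1) _ z :=
      HasFDerivAt.comp (g := fun γ : C(unitInterval, F) => γ 1) z
        (ContinuousMap.evalCLM ℝ (1 : unitInterval) : C(unitInterval, F) →L[ℝ] F).hasFDerivAt hd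
    rw [h1.fderiv]
    have h2 : HasFDerivAt (fun z : E × F =>
        (ContinuousLinearMap.const ℝ unitInterval) z.2 + K (z.1, Γ z)) _ z :=
      ((ContinuousLinearMap.const ℝ unitInterval).hasFDerivAt.comp z hasFDerivAt_snd).add
        ((hK.differentiable (by simp) (z.1, Γ z)).hasFDerivAt.comp z (hasFDerivAt_fst.prodMk hd))
    have h3 := hd.unique (h2.congr_of_eventuallyEq
      (by filter_upwards [hW₀.mem_nhds hz] with z' hz' using hΓeq z' hz'))
    have h4 := congrArg (fun f => f (h, 0)) h3
    simp at h4
    exact ray_variation hA (fun s k l => hint _ (hzU' s) k l) (hΓeq z hz) h4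

end FlatFamily

/-! ### Frobenius' theorem in a vector space -/

section Frobenius

/-- A locally smooth map agrees near a given point with a globally smooth map. -/
theorem exists_contDiff_eventuallyEq {V W : Type*} [NormedAddCommGroup V] [NormedSpace ℝ V]
    [FiniteDimensional ℝ V] [NormedAddCommGroup W] [NormedSpace ℝ W] {f : V → W} {O : Set V}
    (hO : IsOpen O) (hf : ContDiffOn ℝ ∞ f O) {a : V} (ha : a ∈ O) :
    ∃ f' : V → W, ContDiff ℝ ∞ f' ∧ f' =ᶠ[𝓝 a] f := by
  obtain ⟨ρ, hρ, hρO⟩ := Metric.isOpen_iff.1 hO a ha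
  let χ : ContDiffBump a := ⟨ρ / 4, ρ / 2, by positivity, by linarith⟩
  refine ⟨fun x => χ x • f x, ?_, ?_⟩
  · rw [contDiff_iff_contDiffAt]
    intro x
    by_cases hx : x ∈ O
    · exact χ.contDiff.contDiffAt.smul (hf.contDiffAt (hO.mem_nhds hx))
    · have hx' : x ∉ tsupport χ := by
        rw [χ.tsupport_eq]
        intro h
        refine hx (hρO (Metric.mem_ball.2 ((Metric.mem_closedBall.1 h).trans_lt ?_)))
        show ρ / 2 < ρ
        linarith
      refine ContDiffAt.congr_of_eventuallyEq (f := fun _ => (0 : W)) contDiffAt_const ?_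
      filter_upwards [(isClosed_tsupport χ).isOpen_compl.mem_nhds hx'] with y hy
      rw [image_eq_zero_of_notMem_tsupport hy, zero_smul]
  · filter_upwards [χ.eventuallyEq_one] with x hx
    simp only [hx, Pi.one_apply, one_smul]

/-- Frobenius' theorem for a distribution given as the graphs of a family of linear maps: there is
a local submersion whose fibres are the integral manifolds. -/
theorem exists_first_integral_of_graph {E F : Type} [NormedAddCommGroup E] [NormedSpace ℝ E]
    [FiniteDimensional ℝ E] [NormedAddCommGroup F] [NormedSpace ℝ F] [FiniteDimensional ℝ F]
    {A : E × F → E →L[ℝ] F} {U : Set (E × F)} (hU : IsOpen U) (hA : ContDiffOn ℝ ∞ A U)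
    {y₀ : F} (h₀ : (0, y₀) ∈ U)
    (hint : ∀ z ∈ U, ∀ h k, fderiv ℝ A z (h, A z h) k = fderiv ℝ A z (k, A z k) h) :
    ∃ (O : Set (E × F)) (y : E × F → F), IsOpen O ∧ (0, y₀) ∈ O ∧ O ⊆ U ∧ ContDiffOn ℝ ∞ y O ∧
      ∀ z ∈ O, Function.Surjective (fderiv ℝ y z) ∧
        ∀ v : E × F, fderiv ℝ y z v = 0 ↔ v.2 = A z v.1 := by
  -- The superposition operator needs a globally defined smooth `A'`. It agrees with `A` near the
  -- base point only, and integrability is used only there.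
  obtain ⟨A', hA', hAA'⟩ := exists_contDiff_eventuallyEq hU hA h₀
  obtain ⟨U', hU'A, hU'o, hU'₀⟩ := eventually_nhds_iff.1 (hAA'.and (hU.mem_nhds h₀))
  obtain ⟨W, Y, hW, hW₀, hY, hY₀, hYW⟩ := exists_flat_family hA' hU'o hU'₀ (by
    intro z hz h k
    have : A' =ᶠ[𝓝 z] A := by
      filter_upwards [hU'o.mem_nhds hz] with w hw using (hU'A w hw).1
    rw [this.fderiv_eq, this.eq_of_nhds]
    exact hint z (hU'A z hz).2 h k)
  -- `Ξ` carries the horizontal planes to the integral manifolds. The first integral is therefore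
  -- the second component of its local inverse.
  let Ξ : E × F → E × F := fun z => (z.1, Y z)
  have hΞ : ContDiffOn ℝ ∞ Ξ W := contDiffOn_fst.prodMk hY
  have hYd : ∀ z ∈ W, HasFDerivAt Y (fderiv ℝ Y z) z := fun z hz =>
    ((hY.contDiffAt (hW.mem_nhds hz)).differentiableAt (by simp)).hasFDerivAt
  have hΞd : ∀ z ∈ W, HasFDerivAt Ξ ((ContinuousLinearMap.fst ℝ E F).prod (fderiv ℝ Y z)) z :=
    fun z hz => hasFDerivAt_fst.prodMk (hYd z hz)
  have hY0 : ∀ k, fderiv ℝ Y (0, y₀) (0, k) = k := by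
    intro k
    have h1 : HasFDerivAt (fun y : F => Y (0, y)) _ y₀ :=
      HasFDerivAt.comp (g := Y) y₀ (hYd _ hW₀)
        ((hasFDerivAt_const (0 : E) y₀).prodMk (hasFDerivAt_id y₀))
    have h2 : (fun y : F => Y (0, y)) =ᶠ[𝓝 y₀] fun y => y := by
      have : Continuous fun y : F => ((0 : E), y) := by fun_prop
      filter_upwards [(hW.preimage this).mem_nhds hW₀] with y hy using hY₀ y hy
    have := congrArg (fun f => f k) (h1.unique ((hasFDerivAt_id y₀).congr_of_eventuallyEq h2))
    simpa using this
  let B := fderiv ℝ Y (0, y₀)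
  have hB : ∀ z : E × F, B z = B (z.1, 0) + z.2 := fun z => by
    conv_lhs => rw [show z = (z.1, 0) + (0, z.2) by simp]
    rw [map_add, hY0]
  let f' : (E × F) ≃L[ℝ] (E × F) :=
    ContinuousLinearEquiv.equivOfInverse ((ContinuousLinearMap.fst ℝ E F).prod B)
      ((ContinuousLinearMap.fst ℝ E F).prod (ContinuousLinearMap.snd ℝ E F -
        (B.comp (ContinuousLinearMap.inl ℝ E F)).comp (ContinuousLinearMap.fst ℝ E F)))
      (fun z => by ext1 <;> simp [hB z])
      (fun z => by ext1 <;> simp [hB (z.1, z.2 - B (z.1, 0))])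
  obtain ⟨e, he₀, heW, heΞ, hes, hei⟩ :=
    exists_smooth_openPartialHomeomorph hW hΞ hW₀ f' (hΞd _ hW₀)
  have hΞ0 : Ξ (0, y₀) = (0, y₀) := Prod.ext rfl (hY₀ _ hW₀)
  have htar : ∀ z ∈ e.target, z ∈ U' := by
    intro z hz
    have h1 := (hYW _ (heW (e.map_target hz))).1
    have h2 : Ξ (e.symm z) = z := by rw [← heΞ, e.right_inv hz]
    rw [← h2]; exact h1
  refine ⟨e.target, fun z => (e.symm z).2, e.open_target, ?_, fun z hz => (hU'A z (htar z hz)).2,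
    contDiff_snd.comp_contDiffOn hes, ?_⟩
  · have := e.map_source he₀
    rwa [heΞ, hΞ0] at this
  intro z hz
  set w := e.symm z with hw
  have hws : w ∈ e.source := e.map_target hz
  have hΞw : Ξ w = z := by rw [← heΞ, hw, e.right_inv hz]
  have hsd : HasFDerivAt e.symm (fderiv ℝ e.symm z) z :=
    ((hes.contDiffAt (e.open_target.mem_nhds hz)).differentiableAt (by simp)).hasFDerivAt
  have hAz : A z = A' z := ((hU'A z (htar z hz)).1).symm
  have hDh : ∀ h, fderiv ℝ Y w (h, 0) = A z h := fun h => by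
    rw [(hYW w (heW hws)).2 h, hAz, ← hΞw]
  have hcomp : ∀ v, fderiv ℝ e.symm z (v.1, fderiv ℝ Y w v) = v := by
    intro v
    have h1 : HasFDerivAt (fun x => e.symm (Ξ x)) _ w :=
      HasFDerivAt.comp (g := e.symm) w (by rw [hΞw]; exact hsd) (hΞd w (heW hws))
    have h2 : (fun x => e.symm (Ξ x)) =ᶠ[𝓝 w] id := by
      filter_upwards [e.open_source.mem_nhds hws] with x hx
      rw [← heΞ, e.left_inv hx, id]
    have := congrArg (fun f => f v) (h1.unique ((hasFDerivAt_id w).congr_of_eventuallyEq h2))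
    simpa using this
  have hcomp' : ∀ v, ((fderiv ℝ e.symm z v).1, fderiv ℝ Y w (fderiv ℝ e.symm z v)) = v := by
    intro v
    have h1 : HasFDerivAt (fun x => Ξ (e.symm x)) _ z :=
      HasFDerivAt.comp (g := Ξ) z (hΞd w (heW hws)) hsd
    have h2 : (fun x => Ξ (e.symm x)) =ᶠ[𝓝 z] id := by
      filter_upwards [e.open_target.mem_nhds hz] with x hx
      rw [← heΞ, e.right_inv hx, id]
    have := congrArg (fun f => f v) (h1.unique ((hasFDerivAt_id z).congr_of_eventuallyEq h2))
    simpa using this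
  have hy : HasFDerivAt (fun z => (e.symm z).2) _ z := hsd.snd
  rw [hy.fderiv]
  refine ⟨fun k => ⟨(0, fderiv ℝ Y w (0, k)), ?_⟩, fun v => ?_⟩
  · have := congrArg Prod.snd (hcomp (0, k))
    simpa using this
  · simp only [ContinuousLinearMap.comp_apply, ContinuousLinearMap.coe_snd']
    constructor
    · intro hv
      have h1 := hcomp' v
      have h2 : fderiv ℝ e.symm z v = ((fderiv ℝ e.symm z v).1, 0) := Prod.ext rfl hv
      rw [h2, hDh] at h1
      rw [← h1]
    · intro hv
      have h1 := hcomp (v.1, 0)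
      rw [hDh] at h1
      have : v = (v.1, A z v.1) := Prod.ext rfl hv
      rw [this, h1]

/-- **Frobenius' theorem**: an involutive distribution, given by a smooth frame, is locally the
kernel of the derivative of a submersion. -/
theorem exists_first_integral {V : Type} [NormedAddCommGroup V] [NormedSpace ℝ V]
    [FiniteDimensional ℝ V] {O : Set V} (hO : IsOpen O) {a₀ : V} (ha₀ : a₀ ∈ O)
    (D : V → Submodule ℝ V) {k : ℕ} (X : Fin k → V → V) (hX : ∀ i, ContDiffOn ℝ ∞ (X i) O)
    (hXD : ∀ a ∈ O, LinearIndependent ℝ (fun i => X i a) ∧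
      Submodule.span ℝ (Set.range fun i => X i a) = D a)
    (hinv : ∀ a ∈ O, ∀ Y Z : V → V, ContDiffAt ℝ ∞ Y a → ContDiffAt ℝ ∞ Z a →
      (∀ᶠ b in 𝓝 a, Y b ∈ D b) → (∀ᶠ b in 𝓝 a, Z b ∈ D b) →
      fderiv ℝ Z a (Y a) - fderiv ℝ Y a (Z a) ∈ D a) :
    ∃ (l : ℕ) (O' : Set V) (y : V → Eu l), k + l = Module.finrank ℝ V ∧
      IsOpen O' ∧ a₀ ∈ O' ∧ O' ⊆ O ∧ ContDiffOn ℝ ∞ y O' ∧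
      ∀ a ∈ O', Function.Surjective (fderiv ℝ y a) ∧ ∀ v, fderiv ℝ y a v = 0 ↔ v ∈ D a := by
  -- In the splitting `D a₀ × C`, the nearby subspaces are graphs over `D a₀`, which reduces the
  -- claim to the graph case.
  obtain ⟨C, hC⟩ := Submodule.exists_isCompl (D a₀)
  let Λ : V ≃L[ℝ] (D a₀ × C) :=
    (Submodule.prodEquivOfIsCompl (D a₀) C hC).symm.toContinuousLinearEquiv
  have hΛ : ∀ v : D a₀, Λ (v : V) = (v, 0) := fun v => by
    simp [Λ]
  let bas : Module.Basis (Fin k) ℝ (D a₀) :=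
    (Module.Basis.span (hXD a₀ ha₀).1).map (LinearEquiv.ofEq _ _ (hXD a₀ ha₀).2)
  have hbas : ∀ i, (bas i : V) = X i a₀ := fun i => by
    simp [bas, Module.Basis.span_apply]
  let L : V → (D a₀ →L[ℝ] V) := fun a =>
    ∑ i, (LinearMap.toContinuousLinearMap (bas.coord i)).smulRight (X i a)
  have hLsm : ContDiffOn ℝ ∞ L O := by
    refine ContDiffOn.sum fun i _ => ?_
    exact (ContinuousLinearMap.smulRightL ℝ (D a₀) V
      (LinearMap.toContinuousLinearMap (bas.coord i))).contDiff.comp_contDiffOn (hX i)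
  have hLap : ∀ a h, L a h = ∑ i, bas.repr h i • X i a := fun a h => by
    simp [L, sum_apply]
  have hLrange : ∀ a ∈ O, ∀ v, v ∈ D a ↔ ∃ h, L a h = v := by
    intro a ha v
    rw [← (hXD a ha).2, Submodule.mem_span_range_iff_exists_fun]
    constructor
    · rintro ⟨c, hc⟩
      exact ⟨bas.equivFun.symm c, by
        rw [hLap, ← hc]
        refine Finset.sum_congr rfl fun i _ => ?_
        rw [← Module.Basis.equivFun_apply, LinearEquiv.apply_symm_apply]⟩
    · rintro ⟨h, hh⟩
      exact ⟨fun i => bas.repr h i, by rw [← hh, hLap]⟩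
  let α : V → (D a₀ →L[ℝ] D a₀) := fun a =>
    (ContinuousLinearMap.fst ℝ _ _).comp ((Λ : V →L[ℝ] D a₀ × C).comp (L a))
  let β : V → (D a₀ →L[ℝ] C) := fun a =>
    (ContinuousLinearMap.snd ℝ _ _).comp ((Λ : V →L[ℝ] D a₀ × C).comp (L a))
  have hαsm : ContDiffOn ℝ ∞ α O :=
    contDiffOn_const.clm_comp (contDiffOn_const.clm_comp hLsm)
  have hβsm : ContDiffOn ℝ ∞ β O :=
    contDiffOn_const.clm_comp (contDiffOn_const.clm_comp hLsm)
  have hα0 : α a₀ = ContinuousLinearMap.id ℝ _ := by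
    ext1 h
    have : L a₀ h = (h : V) := by
      have h1 := congrArg (fun v : D a₀ => (v : V)) (bas.sum_repr h)
      simp only [AddSubmonoidClass.coe_finsetSum, Submodule.coe_smul, hbas] at h1
      rw [hLap, h1]
    simp [α, this, hΛ]
  -- `α` and `β` are the components of the frame map along `D a₀` and `C`. Where `α` is invertible,
  -- `D` is the graph of `β α⁻¹`; at `a₀` itself `α` is the identity.
  let G : Set V := O ∩ α ⁻¹' Set.range ((↑) : (D a₀ ≃L[ℝ] D a₀) → (D a₀ →L[ℝ] D a₀))
  have hGo : IsOpen G := hαsm.continuousOn.isOpen_inter_preimage hO ContinuousLinearEquiv.isOpen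
  have hG₀ : a₀ ∈ G := ⟨ha₀, ContinuousLinearEquiv.refl ℝ _, by rw [hα0]; rfl⟩
  have hinvsm : ContDiffOn ℝ ∞ (fun a => (α a).inverse) G := by
    intro a ha
    obtain ⟨g, hg⟩ := ha.2
    refine ContDiffAt.contDiffWithinAt ?_
    exact ContDiffAt.comp a (by rw [← hg]; exact contDiffAt_map_inverse g)
      (hαsm.contDiffAt (hO.mem_nhds ha.1))
  let A₀ : V → (D a₀ →L[ℝ] C) := fun a => (β a).comp (α a).inverse
  have hA₀sm : ContDiffOn ℝ ∞ A₀ G := (hβsm.mono inter_subset_left).clm_comp hinvsm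
  have hA₀D : ∀ a ∈ G, ∀ v, v ∈ D a ↔ (Λ v).2 = A₀ a (Λ v).1 := by
    intro a ha v
    obtain ⟨g, hg⟩ := ha.2
    have hinv' : (α a).inverse = (g.symm : D a₀ →L[ℝ] D a₀) := by
      rw [← hg, ContinuousLinearMap.inverse_equiv]
    have hgα : ∀ h, g h = (Λ (L a h)).1 := fun h => congrArg (fun f => f h) hg
    rw [hLrange a ha.1]
    constructor
    · rintro ⟨h, rfl⟩
      show _ = β a ((α a).inverse _)
      rw [hinv', ← hgα]
      simp [β]
    · intro hv
      refine ⟨g.symm (Λ v).1, ?_⟩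
      apply Λ.injective
      ext1
      · rw [← hgα]; simp
      · rw [hv]
        show _ = β a ((α a).inverse _)
        rw [hinv']
        simp [β]
  let σ : D a₀ × C → V := fun z => a₀ + Λ.symm z
  have hσ : ContDiff ℝ ∞ σ := contDiff_const.add Λ.symm.contDiff
  have hσ0 : σ (0, 0) = a₀ := by
    show a₀ + Λ.symm 0 = a₀
    simp
  have hσd : ∀ z, HasFDerivAt σ (Λ.symm : D a₀ × C →L[ℝ] V) z := fun z =>
    Λ.symm.hasFDerivAt.const_add a₀
  obtain ⟨O', y, hO', h0, hO'U, hysm, hy⟩ := exists_first_integral_of_graph (A := fun z => A₀ (σ z))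
    (U := σ ⁻¹' G) (hGo.preimage hσ.continuous) (hA₀sm.comp hσ.contDiffOn (fun z hz => hz))
    (y₀ := 0) (by rw [mem_preimage, hσ0]; exact hG₀) (by
      intro z hz h k
      have hAd : DifferentiableAt ℝ A₀ (σ z) :=
        (hA₀sm.contDiffAt (hGo.mem_nhds hz)).differentiableAt (by simp)
      have hd : ∀ h k, fderiv ℝ (fun z => A₀ (σ z)) z (h, A₀ (σ z) h) k =
          fderiv ℝ A₀ (σ z) (Λ.symm (h, A₀ (σ z) h)) k := by
        intro h k
        have h1 : HasFDerivAt (fun z => A₀ (σ z)) _ z :=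
          HasFDerivAt.comp (g := A₀) z hAd.hasFDerivAt (hσd z)
        rw [h1.fderiv]; rfl
      -- These sections have constant component along `D a₀`, so their brackets have only a
      -- `C`-component. Such a vector lies in the graph only if it is zero, and this is the
      -- integrability condition.
      let Y : D a₀ → V → V := fun h a => Λ.symm (h, A₀ a h)
      have hYsm : ∀ h, ContDiffAt ℝ ∞ (Y h) (σ z) := fun h =>
        Λ.symm.contDiff.contDiffAt.comp _ (contDiffAt_const.prodMk
          ((hA₀sm.contDiffAt (hGo.mem_nhds hz)).clm_apply contDiffAt_const))
      have hYD : ∀ h, ∀ᶠ b in 𝓝 (σ z), Y h b ∈ D b := fun h => by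
        filter_upwards [hGo.mem_nhds hz] with b hb
        rw [hA₀D b hb]
        simp [Y]
      have hYd : ∀ h v, fderiv ℝ (Y h) (σ z) v = Λ.symm (0, fderiv ℝ A₀ (σ z) v h) := by
        intro h v
        have h1 : HasFDerivAt (Y h) _ (σ z) :=
          HasFDerivAt.comp (g := Λ.symm) (σ z) Λ.symm.hasFDerivAt
            ((hasFDerivAt_const h (σ z)).prodMk
              (hAd.hasFDerivAt.clm_apply (hasFDerivAt_const h (σ z))))
        rw [h1.fderiv]
        simp
      have := hinv (σ z) hz.1 (Y h) (Y k) (hYsm h) (hYsm k) (hYD h) (hYD k)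
      rw [hA₀D _ hz, hYd, hYd, ← map_sub, Λ.apply_symm_apply] at this
      rw [hd, hd]
      simpa [sub_eq_zero] using this)
  have hfin : Module.finrank ℝ C = Module.finrank ℝ (Eu (Module.finrank ℝ C)) := by simp
  let ε : C ≃L[ℝ] Eu (Module.finrank ℝ C) := ContinuousLinearEquiv.ofFinrankEq hfin
  let τ : V → D a₀ × C := fun a => Λ (a - a₀)
  have hτ : ContDiff ℝ ∞ τ := Λ.contDiff.comp (contDiff_id.sub contDiff_const)
  have hστ : ∀ a, σ (τ a) = a := fun a => by simp [σ, τ]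
  have hτd : ∀ a, HasFDerivAt τ (Λ : V →L[ℝ] D a₀ × C) a := fun a =>
    Λ.hasFDerivAt.comp a ((hasFDerivAt_id a).sub_const a₀)
  refine ⟨Module.finrank ℝ C, τ ⁻¹' O', fun a => ε (y (τ a)), ?_, hO'.preimage hτ.continuous,
    ?_, ?_, ?_, ?_⟩
  · rw [← Submodule.finrank_add_eq_of_isCompl hC, Module.finrank_eq_card_basis bas]
    simp
  · have : τ a₀ = (0, 0) := by simp [τ, Prod.ext_iff]
    rw [mem_preimage, this]; exact h0
  · intro a ha
    have := hO'U ha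
    rw [mem_preimage, hστ] at this
    exact this.1
  · exact ε.contDiff.comp_contDiffOn (hysm.comp hτ.contDiffOn (fun a ha => ha))
  · intro a ha
    have h1 : HasFDerivAt (fun a => ε (y (τ a))) _ a :=
      HasFDerivAt.comp (g := ε) a ε.hasFDerivAt (HasFDerivAt.comp (g := y) a
        ((hysm.contDiffAt (hO'.mem_nhds ha)).differentiableAt (by simp)).hasFDerivAt (hτd a))
    rw [h1.fderiv]
    have hG : a ∈ G := by
      have := hO'U ha
      rwa [mem_preimage, hστ] at this
    refine ⟨fun w => ?_, fun v => ?_⟩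
    · obtain ⟨u, hu⟩ := (hy _ ha).1 (ε.symm w)
      exact ⟨Λ.symm u, by simp [hu]⟩
    · have := (hy _ ha).2 (Λ v)
      rw [hστ, ← hA₀D a hG] at this
      rw [← this]
      simp

end Frobenius

/-! ### Pointwise algebra of almost contact metric structures and Blair's formula -/

/-- An almost contact metric structure on a vector space. -/
structure ContactPoint (V : Type*) [AddCommGroup V] [Module ℝ V] where
  g : V →ₗ[ℝ] V →ₗ[ℝ] ℝ
  φ : V →ₗ[ℝ] V
  ξ : V
  η : V →ₗ[ℝ] ℝ
  symm : ∀ u v, g u v = g v u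
  pos : ∀ u, u ≠ 0 → 0 < g u u
  φ_φ : ∀ v, φ (φ v) = -v + η v • ξ
  η_ξ : η ξ = 1
  compat : ∀ u v, g (φ u) (φ v) = g u v - η u * η v

/-- The covariant derivatives `P X Y = (∇_X φ) Y` and `α X = ∇_X ξ` at a point of an almost contact
metric manifold, with the algebraic relations that they satisfy. -/
structure ContactJet (V : Type*) [AddCommGroup V] [Module ℝ V] extends ContactPoint V where
  P : V →ₗ[ℝ] V →ₗ[ℝ] V
  α : V →ₗ[ℝ] V
  P_skew : ∀ u v w, g (P u v) w = - g v (P u w)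
  P_ξ : ∀ u, P u ξ + φ (α u) = 0
  η_α : ∀ u, η (α u) = 0
  P_φ : ∀ u v, P u (φ v) + φ (P u v) = g (α u) v • ξ + η v • α u

namespace ContactPoint

variable {V : Type*} [AddCommGroup V] [Module ℝ V] (J : ContactPoint V)

/-- Evaluating `φ³ξ` in two ways gives `φξ = η(φξ) ξ`, and applying `φ` once more forces `η(φξ)² =
0`. -/
theorem φ_ξ : J.φ J.ξ = 0 := by
  have h1 : J.φ (J.φ J.ξ) = 0 := by rw [J.φ_φ, J.η_ξ]; simp
  have h2 : J.φ J.ξ = J.η (J.φ J.ξ) • J.ξ := by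
    have := J.φ_φ (J.φ J.ξ)
    rw [h1, map_zero] at this
    exact (neg_add_eq_zero.1 this.symm)
  have h3 : J.η (J.φ J.ξ) * J.η (J.φ J.ξ) = 0 := by
    have h4 := congrArg J.η h1
    rw [h2, map_smul, h2] at h4
    simpa [J.η_ξ] using h4
  rw [h2, mul_self_eq_zero.1 h3, zero_smul]

theorem g_ξ (u : V) : J.g u J.ξ = J.η u := by
  have := J.compat u J.ξ
  rw [J.φ_ξ, J.η_ξ, map_zero, mul_one] at this
  linarith

/-- `φ³u` can be computed as `φ(φ²u)` and as `φ²(φu)`; the two results differ by `η(φu) ξ`. -/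
theorem η_φ (u : V) : J.η (J.φ u) = 0 := by
  have h := J.compat (J.φ u) J.ξ
  have h' := J.φ_φ (J.φ u)
  have h2 : J.φ (-u + J.η u • J.ξ) = -J.φ u := by rw [map_add, map_smul, J.φ_ξ]; simp
  rw [J.φ_φ u, h2] at h'
  have h3 : J.η (J.φ u) • J.ξ = 0 := by
    have : -J.φ u + 0 = -J.φ u + J.η (J.φ u) • J.ξ := by rw [add_zero]; exact h'
    exact (add_left_cancel this).symm
  have h4 := congrArg J.η h3
  simpa [J.η_ξ] using h4

theorem φ_skew (u v : V) : J.g (J.φ u) v = - J.g u (J.φ v) := by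
  have h := J.compat u (J.φ v)
  rw [J.φ_φ, J.η_φ, map_add, map_smul, J.g_ξ, J.η_φ, map_neg] at h
  simp at h
  linarith

end ContactPoint

namespace ContactJet

variable {V : Type*} [AddCommGroup V] [Module ℝ V] (J : ContactJet V)

/-- Since `∇_u ξ` is annihilated by `η`, `φ²` acts on it as `-1`, and applying `φ` to the derivative
of `φξ = 0` recovers it. Hence only `∇φ` has to be computed in each class. -/
theorem α_eq (u : V) : J.α u = J.φ (J.P u J.ξ) := by
  have h := congrArg J.φ (J.P_ξ u)
  rw [map_add, J.φ_φ, J.η_α] at h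
  simp at h
  rw [← sub_eq_add_neg, sub_eq_zero] at h
  exact h.symm

/-- Blair's formula for the covariant derivative of `φ` on a normal almost contact metric manifold
with closed fundamental form. -/
theorem two_mul_P (hd : ∀ u v w, J.g (J.P u v) w + J.g (J.P v w) u + J.g (J.P w u) v = 0)
    (hN : ∀ u v, J.P (J.φ u) v - J.P (J.φ v) u + J.φ (J.P v u) - J.φ (J.P u v) +
      (J.g (J.α u) v - J.g (J.α v) u) • J.ξ = 0) (X Y Z : V) :
    2 * J.g (J.P X Y) Z =
      (J.g (J.α (J.φ Y)) X - J.g (J.α X) (J.φ Y)) * J.η Z -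
      (J.g (J.α (J.φ Z)) X - J.g (J.α X) (J.φ Z)) * J.η Y +
      (J.g (J.α (J.φ Y)) Z - J.g (J.α Z) (J.φ Y) - J.g (J.α (J.φ Z)) Y + J.g (J.α Y) (J.φ Z)) *
        J.η X := by
  have skew : ∀ u v w, J.g (J.P u v) w = - J.g (J.P u w) v := fun u v w => by
    rw [J.P_skew, J.symm]
  have pφ : ∀ u v w, J.g (J.P u (J.φ v)) w =
      J.g (J.P u v) (J.φ w) + J.g (J.α u) v * J.η w + J.η v * J.g (J.α u) w := by
    intro u v w
    have h := congrArg (fun t => J.g t w) (J.P_φ u v)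
    simp only [map_add, map_smul, LinearMap.add_apply, LinearMap.smul_apply, smul_eq_mul] at h
    rw [J.symm J.ξ w, J.g_ξ, J.φ_skew] at h
    linarith
  have pξ : ∀ u v, J.g (J.P u v) J.ξ = - J.g (J.α u) (J.φ v) := by
    intro u v
    have h := congrArg (fun t => J.g t v) (J.P_ξ u)
    simp only [map_add, LinearMap.add_apply, map_zero, LinearMap.zero_apply] at h
    rw [J.φ_skew] at h
    rw [skew]; linarith
  -- Pairing normality with `φX` removes its multiple of `ξ`, because `η ∘ φ = 0`.
  have n1 := congrArg (fun t => J.g t (J.φ X)) (hN Y Z)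
  simp only [map_add, map_sub, map_smul, LinearMap.add_apply, LinearMap.sub_apply,
    LinearMap.smul_apply, smul_eq_mul, map_zero, LinearMap.zero_apply] at n1
  rw [J.symm J.ξ, J.g_ξ, J.η_φ, J.φ_skew, J.φ_skew, J.φ_φ] at n1
  simp only [map_add, map_neg, map_smul, smul_eq_mul] at n1
  rw [pξ, pξ] at n1
  have s1 := hd X Y Z
  have s2 := hd X (J.φ Y) (J.φ Z)
  have e1 := pφ (J.φ Y) Z X
  have e2 := pφ (J.φ Z) X Y
  have e3 := pφ X Y (J.φ Z)
  rw [J.φ_φ, J.η_φ] at e3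
  simp only [map_add, map_neg, map_smul, smul_eq_mul] at e3
  rw [pξ] at e3
  have k1 := skew Z Y X
  have k3 := skew (J.φ Z) Y (J.φ X)
  -- Closedness on `(X, Y, Z)` minus closedness on `(X, φY, φZ)` plus normality: after moving `φ`
  -- across `P` the cyclic terms cancel and `2 g((∇_X φ)Y, Z)` survives together with the terms in
  -- `∇ξ`.
  linear_combination s1 - s2 + n1 + e1 - e2 + e3 - k1 + k3

theorem eq_of_g_eq {u v : V} (h : ∀ w, J.g u w = J.g v w) : u = v := by
  by_contra hne
  have := J.pos (u - v) (sub_ne_zero.2 hne)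
  rw [LinearMap.map_sub₂, h, sub_self] at this
  exact lt_irrefl _ this

/-- With `dη = 0` the operator `∇ξ` is self-adjoint, and then each bracket in Blair's formula
vanishes. -/
theorem cosymplectic_P (hd : ∀ u v w, J.g (J.P u v) w + J.g (J.P v w) u + J.g (J.P w u) v = 0)
    (hN : ∀ u v, J.P (J.φ u) v - J.P (J.φ v) u + J.φ (J.P v u) - J.φ (J.P u v) +
      (J.g (J.α u) v - J.g (J.α v) u) • J.ξ = 0)
    (hη : ∀ u v, J.g (J.α u) v - J.g (J.α v) u = 0) (X Y : V) : J.P X Y = 0 := by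
  refine J.eq_of_g_eq fun Z => ?_
  rw [map_zero, LinearMap.zero_apply]
  linear_combination (1 / 2) * J.two_mul_P hd hN X Y Z + (1 / 2) * J.η Z * hη (J.φ Y) X -
    (1 / 2) * J.η Y * hη (J.φ Z) X + (1 / 2) * J.η X * (hη (J.φ Y) Z - hη (J.φ Z) Y)

/-- With `dη = Φ` the brackets in Blair's formula become products `g(φ·, φ·)`, which the
compatibility of the metric turns into `g` and `η`; those multiplied by `η X` cancel by symmetry. -/
theorem sasakian_P (hd : ∀ u v w, J.g (J.P u v) w + J.g (J.P v w) u + J.g (J.P w u) v = 0)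
    (hN : ∀ u v, J.P (J.φ u) v - J.P (J.φ v) u + J.φ (J.P v u) - J.φ (J.P u v) +
      (J.g (J.α u) v - J.g (J.α v) u) • J.ξ = 0)
    (hη : ∀ u v, J.g (J.α u) v - J.g (J.α v) u = 2 * J.g u (J.φ v)) (X Y : V) :
    J.P X Y = J.g X Y • J.ξ - J.η Y • X := by
  refine J.eq_of_g_eq fun Z => ?_
  rw [map_sub, map_smul, map_smul, LinearMap.sub_apply, LinearMap.smul_apply, LinearMap.smul_apply,
    J.symm J.ξ, J.g_ξ, smul_eq_mul, smul_eq_mul]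
  have c1 := J.compat Y X
  have c2 := J.compat Z X
  have c3 := J.compat Y Z
  have c4 := J.compat Z Y
  rw [J.symm Y X] at c1
  rw [J.symm Z X] at c2
  rw [J.symm Z Y] at c4
  linear_combination (1 / 2) * J.two_mul_P hd hN X Y Z + (1 / 2) * J.η Z * hη (J.φ Y) X -
    (1 / 2) * J.η Y * hη (J.φ Z) X + (1 / 2) * J.η X * (hη (J.φ Y) Z - hη (J.φ Z) Y)
    + J.η Z * c1 - J.η Y * c2 + J.η X * (c3 - c4)

end ContactJet

/-! ### Scalar products and orthogonal projection -/

section BilinearForms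

variable {V V' : Type*} [AddCommGroup V] [Module ℝ V] [TopologicalSpace V]
  [IsTopologicalAddGroup V] [ContinuousSMul ℝ V]
  [AddCommGroup V'] [Module ℝ V'] [TopologicalSpace V']
  [IsTopologicalAddGroup V'] [ContinuousSMul ℝ V']

/-- A definite form is injective as a map to the dual, and dimensions agree. This is what gives
meaning to the `inverse` in `pullProj` and `christoffel`, which is zero on non-invertible maps. -/
theorem isInvertible_of_pos [FiniteDimensional ℝ V] [T2Space V] (B : V →L[ℝ] V →L[ℝ] ℝ)
    (hB : ∀ u, u ≠ 0 → 0 < B u u) : B.IsInvertible := by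
  have hinj : Function.Injective (B : V →ₗ[ℝ] V →L[ℝ] ℝ) := by
    rw [← LinearMap.ker_eq_bot, LinearMap.ker_eq_bot']
    intro u hu
    by_contra hne
    have h1 := hB u hne
    have h2 : B u = 0 := hu
    rw [h2] at h1
    simp at h1
  have e : (V →ₗ[ℝ] ℝ) ≃ₗ[ℝ] (V →L[ℝ] ℝ) := LinearMap.toContinuousLinearMap
  have hfd : FiniteDimensional ℝ (V →L[ℝ] ℝ) := e.finiteDimensional
  have hdim : Module.finrank ℝ V = Module.finrank ℝ (V →L[ℝ] ℝ) := by
    rw [← e.finrank_eq]; exact (Subspace.dual_finrank_eq (K := ℝ) (V := V)).symm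
  exact ⟨(LinearEquiv.ofInjectiveOfFinrankEq (B : V →ₗ[ℝ] V →L[ℝ] ℝ) hinj
    hdim).toContinuousLinearEquiv, by ext u v; rfl⟩

theorem inverse_apply_of_isInvertible {B : V →L[ℝ] V'} (hB : B.IsInvertible) (v : V') :
    B (B.inverse v) = v := by
  obtain ⟨e, rfl⟩ := hB
  rw [ContinuousLinearMap.inverse_equiv]; simp

theorem pullForm_apply (B : V →L[ℝ] V →L[ℝ] ℝ) (L : V' →L[ℝ] V) (u v : V') :
    pullForm B L u v = B (L u) (L v) := rfl

variable [FiniteDimensional ℝ V'] [T2Space V']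

theorem pullForm_isInvertible {B : V →L[ℝ] V →L[ℝ] ℝ} {L : V' →L[ℝ] V}
    (hB : ∀ u, u ≠ 0 → 0 < B u u) (hL : Function.Injective L) : (pullForm B L).IsInvertible :=
  isInvertible_of_pos _ fun _ hu => hB _ fun h => hu (hL (h.trans (map_zero L).symm))

/-- The defining property of the orthogonal projection. -/
theorem pullProj_spec {B : V →L[ℝ] V →L[ℝ] ℝ} {L : V' →L[ℝ] V}
    (hB : ∀ u, u ≠ 0 → 0 < B u u) (hL : Function.Injective L) (v : V) (u : V') :
    B (L (pullProj B L v)) (L u) = B v (L u) := by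
  rw [← pullForm_apply, pullProj, inverse_apply_of_isInvertible (pullForm_isInvertible hB hL)]
  rfl

theorem pullProj_eq {B : V →L[ℝ] V →L[ℝ] ℝ} {L : V' →L[ℝ] V}
    (hB : ∀ u, u ≠ 0 → 0 < B u u) (hL : Function.Injective L) {v : V} {w : V'}
    (h : ∀ u, B (L w) (L u) = B v (L u)) : pullProj B L v = w := by
  by_contra hne
  have h1 := hB (L (pullProj B L v - w)) fun h0 =>
    hne (sub_eq_zero.1 (hL (h0.trans (map_zero L).symm)))
  have h2 : B (L (pullProj B L v - w)) (L (pullProj B L v - w)) = 0 := by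
    conv_lhs => rw [map_sub L, map_sub B, ← map_sub L]
    rw [sub_apply, pullProj_spec hB hL, h, sub_self]
  exact h1.ne' h2

end BilinearForms

/-! ### Derivatives of vector-valued functions on a manifold -/

section Coordinates

variable {m d : ℕ}
  {M : Type*} [TopologicalSpace M] [ChartedSpace (Eu m) M]
  {N : Type*} [TopologicalSpace N] [ChartedSpace (Eu d) N]

instance instFiniteDimensionalTangentSpace (x : N) :
    FiniteDimensional ℝ (TangentSpace (𝓡 d) x) :=
  inferInstanceAs (FiniteDimensional ℝ (Eu d))

instance instT2SpaceTangentSpace (x : N) : T2Space (TangentSpace (𝓡 d) x) :=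
  inferInstanceAs (T2Space (Eu d))

/-- The identification of a tangent space with the model space. -/
def toModel (x : N) : TangentSpace (𝓡 d) x ≃L[ℝ] Eu d := ContinuousLinearEquiv.refl ℝ (Eu d)

/-- The derivative of a vector-valued function on a manifold. -/
def derivAt {F : Type*} [NormedAddCommGroup F] [NormedSpace ℝ F] (h : M → F) (p : M) :
    TangentSpace (𝓡 m) p →L[ℝ] F :=
  mfderiv (𝓡 m) 𝓘(ℝ, F) h p

section

variable {F G H : Type*} [NormedAddCommGroup F] [NormedSpace ℝ F] [NormedAddCommGroup G]
  [NormedSpace ℝ G] [NormedAddCommGroup H] [NormedSpace ℝ H]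

/-- The model has no boundary, so the derivative within its range is an honest Fréchet derivative.
The sum and product rules for `derivAt` are transported through this. -/
theorem hasFDerivAt_chart {h : M → F} {p : M} (hh : MDifferentiableAt (𝓡 m) 𝓘(ℝ, F) h p) :
    HasFDerivAt (fun a => h ((extChartAt (𝓡 m) p).symm a))
      ((derivAt h p).comp ((toModel (d := m) p).symm : Eu m →L[ℝ] TangentSpace (𝓡 m) p))
      (extChartAt (𝓡 m) p p) := by
  have h1 : HasFDerivWithinAt (fun a : Eu m => h ((extChartAt (𝓡 m) p).symm a))
    ((derivAt h p).comp ((toModel (d := m) p).symm : Eu m →L[ℝ] TangentSpace (𝓡 m) p))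
    (range (𝓡 m)) (extChartAt (𝓡 m) p p) := hh.hasMFDerivAt.2
  rwa [ModelWithCorners.range_eq_univ, hasFDerivWithinAt_univ] at h1

theorem derivAt_eq {h : M → F} {p : M} (hh : MDifferentiableAt (𝓡 m) 𝓘(ℝ, F) h p)
    {L : Eu m →L[ℝ] F}
    (hL : HasFDerivAt (fun a => h ((extChartAt (𝓡 m) p).symm a)) L (extChartAt (𝓡 m) p p))
    (u : TangentSpace (𝓡 m) p) : derivAt h p u = L (toModel p u) := by
  rw [← (hasFDerivAt_chart hh).unique hL]
  simp

theorem derivAt_clm_apply {B : M → F →L[ℝ] G} {V : M → F} {p : M}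
    (hB : MDifferentiableAt (𝓡 m) 𝓘(ℝ, F →L[ℝ] G) B p)
    (hV : MDifferentiableAt (𝓡 m) 𝓘(ℝ, F) V p) (u : TangentSpace (𝓡 m) p) :
    derivAt (fun q => B q (V q)) p u = derivAt B p u (V p) + B p (derivAt V p u) := by
  rw [derivAt_eq (hB.clm_apply hV) ((hasFDerivAt_chart hB).clm_apply (hasFDerivAt_chart hV))]
  simp [add_comm]

theorem derivAt_clm_apply₂ {B : M → F →L[ℝ] G →L[ℝ] H} {V : M → F} {W : M → G} {p : M}
    (hB : MDifferentiableAt (𝓡 m) 𝓘(ℝ, F →L[ℝ] G →L[ℝ] H) B p)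
    (hV : MDifferentiableAt (𝓡 m) 𝓘(ℝ, F) V p) (hW : MDifferentiableAt (𝓡 m) 𝓘(ℝ, G) W p)
    (u : TangentSpace (𝓡 m) p) :
    derivAt (fun q => B q (V q) (W q)) p u = derivAt B p u (V p) (W p) +
      B p (derivAt V p u) (W p) + B p (V p) (derivAt W p u) := by
  rw [derivAt_clm_apply (hB.clm_apply hV) hW, derivAt_clm_apply hB hV]
  simp

theorem derivAt_add {V W : M → F} {p : M} (hV : MDifferentiableAt (𝓡 m) 𝓘(ℝ, F) V p)
    (hW : MDifferentiableAt (𝓡 m) 𝓘(ℝ, F) W p) (u : TangentSpace (𝓡 m) p) :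
    derivAt (fun q => V q + W q) p u = derivAt V p u + derivAt W p u := by
  have h := derivAt_eq (h := fun q => V q + W q) (hV.add hW)
    ((hasFDerivAt_chart hV).add (hasFDerivAt_chart hW)) u
  rw [h]
  simp

theorem derivAt_sub {V W : M → F} {p : M} (hV : MDifferentiableAt (𝓡 m) 𝓘(ℝ, F) V p)
    (hW : MDifferentiableAt (𝓡 m) 𝓘(ℝ, F) W p) (u : TangentSpace (𝓡 m) p) :
    derivAt (fun q => V q - W q) p u = derivAt V p u - derivAt W p u := by
  have h := derivAt_eq (h := fun q => V q - W q) (hV.sub hW)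
    ((hasFDerivAt_chart hV).sub (hasFDerivAt_chart hW)) u
  rw [h]
  simp

theorem derivAt_congr {V W : M → F} {p : M} (h : V =ᶠ[𝓝 p] W) :
    derivAt (m := m) V p = derivAt W p :=
  h.mfderiv_eq

theorem derivAt_const (c : F) (p : M) : derivAt (m := m) (fun _ : M => c) p = 0 :=
  mfderiv_const

theorem derivAt_comp {h : N → F} {f : M → N} {p : M}
    (hh : MDifferentiableAt (𝓡 d) 𝓘(ℝ, F) h (f p)) (hf : MDifferentiableAt (𝓡 m) (𝓡 d) f p)
    (u : TangentSpace (𝓡 m) p) :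
    derivAt (fun q => h (f q)) p u = derivAt h (f p) (mfderiv (𝓡 m) (𝓡 d) f p u) :=
  congrArg (fun L : Eu m →L[ℝ] F => L u) (mfderiv_comp p hh hf)

end

end Coordinates

/-! ### Tangent coordinates and Christoffel symbols -/

section TangentCoordinates

variable {d : ℕ} {N : Type*} [TopologicalSpace N] [ChartedSpace (Eu d) N] [IsManifold (𝓡 d) ∞ N]

/-- The components of tangent vectors in the preferred coordinates at `x₀`. -/
def coord (x₀ y : N) : TangentSpace (𝓡 d) y →L[ℝ] Eu d :=
  (trivializationAt (Eu d) (TangentSpace (𝓡 d) : N → Type _) x₀).continuousLinearMapAt ℝ y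

/-- The tangent vector with given components in the preferred coordinates at `x₀`. -/
def coordSymm (x₀ y : N) : Eu d →L[ℝ] TangentSpace (𝓡 d) y :=
  (trivializationAt (Eu d) (TangentSpace (𝓡 d) : N → Type _) x₀).symmL ℝ y

theorem trivializationAt_snd {x₀ y : N} (hy : y ∈ (chartAt (Eu d) x₀).source)
    (v : TangentSpace (𝓡 d) y) :
    (trivializationAt (Eu d) (TangentSpace (𝓡 d) : N → Type _) x₀ ⟨y, v⟩).2 = coord x₀ y v :=
  (congrFun (Trivialization.coe_linearMapAt_of_mem (R := ℝ)
    (trivializationAt (Eu d) (TangentSpace (𝓡 d) : N → Type _) x₀) hy) v).symm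

theorem coordSymm_coord {x₀ y : N} (hy : y ∈ (chartAt (Eu d) x₀).source)
    (v : TangentSpace (𝓡 d) y) : coordSymm x₀ y (coord x₀ y v) = v :=
  Trivialization.symmL_continuousLinearMapAt _ hy v

theorem coord_coordSymm {x₀ y : N} (hy : y ∈ (chartAt (Eu d) x₀).source) (v : Eu d) :
    coord x₀ y (coordSymm x₀ y v) = v :=
  Trivialization.continuousLinearMapAt_symmL _ hy v

/-- The tangent space at `x` is by construction the model space read in the preferred chart at `x`,
whose derivative there is the identity. Formulas evaluated at the centre of the chart thus contain
no change of frame. -/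
theorem coord_self (x : N) (v : TangentSpace (𝓡 d) x) : coord x x v = toModel x v := by
  have h1 := TangentBundle.continuousLinearMapAt_trivializationAt (I := 𝓡 d)
    (mem_chart_source (Eu d) x)
  have h2 : mfderiv (𝓡 d) 𝓘(ℝ, Eu d) (extChartAt (𝓡 d) x) x = ContinuousLinearMap.id ℝ _ :=
    mfderiv_extChartAt_self
  exact congrArg (fun L : Eu d →L[ℝ] Eu d => L v) (h1.trans h2)

theorem coordSymm_self (x : N) (v : Eu d) : coordSymm x x v = (toModel x).symm v := by
  have h := coordSymm_coord (mem_chart_source (Eu d) x) ((toModel x).symm v)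
  rwa [coord_self, ContinuousLinearEquiv.apply_symm_apply] at h

theorem coord_injective {x₀ y : N} (hy : y ∈ (chartAt (Eu d) x₀).source) :
    Function.Injective (coord (d := d) x₀ y) := fun a b h => by
  rw [← coordSymm_coord hy a, h, coordSymm_coord hy]

/-- A smooth field of scalar products. -/
structure IsRiemannianForm (g : FormField d N) : Prop where
  symm : ∀ x u v, g x u v = g x v u
  pos : ∀ x u, u ≠ 0 → 0 < g x u u
  smooth : ∀ x, ContMDiffAt (𝓡 d) 𝓘(ℝ, Eu d →L[ℝ] Eu d →L[ℝ] ℝ) ∞ (metricCoeff g x) x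

theorem metricCoeff_apply (g : FormField d N) (x₀ y : N) (a b : Eu d) :
    metricCoeff g x₀ y a b = g y (coordSymm x₀ y a) (coordSymm x₀ y b) := rfl

theorem metricCoeff_coord (g : FormField d N) {x₀ y : N} (hy : y ∈ (chartAt (Eu d) x₀).source)
    (v w : TangentSpace (𝓡 d) y) :
    metricCoeff g x₀ y (coord x₀ y v) (coord x₀ y w) = g y v w := by
  rw [metricCoeff_apply, coordSymm_coord hy, coordSymm_coord hy]

theorem metricCoeff_self (g : FormField d N) (x : N) (a b : TangentSpace (𝓡 d) x) :
    metricCoeff g x x (toModel x a) (toModel x b) = g x a b := by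
  rw [← coord_self, ← coord_self, metricCoeff_coord g (mem_chart_source (Eu d) x)]

variable {g : FormField d N}

theorem IsRiemannianForm.ext_iff (hg : IsRiemannianForm g) {x : N} {u v : TangentSpace (𝓡 d) x} :
    u = v ↔ ∀ w, g x u w = g x v w := by
  refine ⟨fun h w => by rw [h], fun h => ?_⟩
  by_contra hne
  have h1 := hg.pos x (u - v) (sub_ne_zero.2 hne)
  have h2 : g x (u - v) (u - v) = g x u (u - v) - g x v (u - v) := by
    rw [ContinuousLinearMap.map_sub₂]
  rw [h2, h, sub_self] at h1
  exact lt_irrefl _ h1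

/-- The derivatives of the metric coefficients. -/
def metricDeriv (g : FormField d N) (x : N) (a b c : TangentSpace (𝓡 d) x) : ℝ :=
  derivAt (metricCoeff g x) x a (toModel x b) (toModel x c)

theorem metricDeriv_symm (hg : IsRiemannianForm g) (x : N) (a b c : TangentSpace (𝓡 d) x) :
    metricDeriv g x a b c = metricDeriv g x a c b := by
  have hd := (hg.smooth x).mdifferentiableAt (by simp)
  have h : ∀ b c : Eu d, derivAt (fun q => metricCoeff g x q b c) x a =
      derivAt (metricCoeff g x) x a b c := by
    intro b c
    rw [derivAt_clm_apply₂ (V := fun _ => b) (W := fun _ => c) hd mdifferentiableAt_const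
      mdifferentiableAt_const]
    simp [derivAt_const]
  rw [metricDeriv, metricDeriv, ← h, ← h]
  congr 2
  ext q
  exact hg.symm _ _ _

theorem christoffel_spec (hg : IsRiemannianForm g) (x : N) (a b c : TangentSpace (𝓡 d) x) :
    g x (christoffel g x a b) c = (1 / 2) * (metricDeriv g x a b c + metricDeriv g x b a c -
      metricDeriv g x c a b) := by
  let dG : Eu d →L[ℝ] Eu d →L[ℝ] Eu d →L[ℝ] ℝ := derivAt (metricCoeff g x) x
  let l : TangentSpace (𝓡 d) x →L[ℝ] ℝ :=
    (1 / 2 : ℝ) • (dG a b + dG b a - (dG.flip a).flip b)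
  have h := inverse_apply_of_isInvertible (isInvertible_of_pos (g x) (hg.pos x)) l
  exact congrArg (fun L : TangentSpace (𝓡 d) x →L[ℝ] ℝ => L c) h

theorem christoffel_symm (hg : IsRiemannianForm g) (x : N) (a b : TangentSpace (𝓡 d) x) :
    christoffel g x a b = christoffel g x b a := by
  rw [hg.ext_iff]
  intro c
  rw [christoffel_spec hg, christoffel_spec hg, metricDeriv_symm hg x c a b]
  ring

/-- In the sum of the two Koszul expressions the terms differentiated along `b` and `c` cancel. This
is the pointwise form of metric compatibility. -/
theorem christoffel_metric (hg : IsRiemannianForm g) (x : N) (a b c : TangentSpace (𝓡 d) x) :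
    g x (christoffel g x a b) c + g x b (christoffel g x a c) = metricDeriv g x a b c := by
  rw [hg.symm x b, christoffel_spec hg, christoffel_spec hg, metricDeriv_symm hg x a c b,
    metricDeriv_symm hg x c a b, metricDeriv_symm hg x b a c]
  ring

theorem metricDeriv_add_left (x : N) (a a' b c : TangentSpace (𝓡 d) x) :
    metricDeriv g x (a + a') b c = metricDeriv g x a b c + metricDeriv g x a' b c := by
  unfold metricDeriv
  rw [ContinuousLinearMap.map_add]; rfl

theorem metricDeriv_smul_left (x : N) (t : ℝ) (a b c : TangentSpace (𝓡 d) x) :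
    metricDeriv g x (t • a) b c = t * metricDeriv g x a b c := by
  unfold metricDeriv
  rw [ContinuousLinearMap.map_smul]; rfl

theorem metricDeriv_add_middle (x : N) (a b b' c : TangentSpace (𝓡 d) x) :
    metricDeriv g x a (b + b') c = metricDeriv g x a b c + metricDeriv g x a b' c := by
  unfold metricDeriv
  rw [map_add, ContinuousLinearMap.map_add]; rfl

theorem metricDeriv_smul_middle (x : N) (t : ℝ) (a b c : TangentSpace (𝓡 d) x) :
    metricDeriv g x a (t • b) c = t * metricDeriv g x a b c := by
  unfold metricDeriv
  rw [map_smul, ContinuousLinearMap.map_smul]; rfl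

theorem christoffel_add_left (hg : IsRiemannianForm g) (x : N) (a a' b : TangentSpace (𝓡 d) x) :
    christoffel g x (a + a') b = christoffel g x a b + christoffel g x a' b := by
  rw [hg.ext_iff]
  intro c
  rw [ContinuousLinearMap.map_add₂, christoffel_spec hg, christoffel_spec hg, christoffel_spec hg,
    metricDeriv_add_left, metricDeriv_add_middle, metricDeriv_add_middle]
  ring

theorem christoffel_smul_left (hg : IsRiemannianForm g) (x : N) (t : ℝ)
    (a b : TangentSpace (𝓡 d) x) :
    christoffel g x (t • a) b = t • christoffel g x a b := by
  rw [hg.ext_iff]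
  intro c
  rw [ContinuousLinearMap.map_smul₂, christoffel_spec hg, christoffel_spec hg, smul_eq_mul,
    metricDeriv_smul_left, metricDeriv_smul_middle, metricDeriv_smul_middle]
  ring

theorem christoffel_add_right (hg : IsRiemannianForm g) (x : N) (a b b' : TangentSpace (𝓡 d) x) :
    christoffel g x a (b + b') = christoffel g x a b + christoffel g x a b' := by
  rw [christoffel_symm hg, christoffel_add_left hg, christoffel_symm hg x b,
    christoffel_symm hg x b']

theorem christoffel_smul_right (hg : IsRiemannianForm g) (x : N) (t : ℝ)
    (a b : TangentSpace (𝓡 d) x) :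
    christoffel g x a (t • b) = t • christoffel g x a b := by
  rw [christoffel_symm hg, christoffel_smul_left hg, christoffel_symm hg x b]

end TangentCoordinates

/-! ### Covariant derivatives along maps -/

section CovariantDerivative

variable {m d : ℕ}
  {M : Type*} [TopologicalSpace M] [ChartedSpace (Eu m) M]
  {N : Type*} [TopologicalSpace N] [ChartedSpace (Eu d) N] [IsManifold (𝓡 d) ∞ N]

/-- The vector field `V` along `f` is smooth at `p`. -/
def SmoothAlongAt (f : M → N) (V : ∀ q : M, TangentSpace (𝓡 d) (f q)) (p : M) : Prop :=
  ContMDiffAt (𝓡 m) (𝓡 d).tangent ∞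
    (fun q => (TotalSpace.mk' (Eu d) (f q) (V q) : TangentBundle (𝓡 d) N)) p

/-- The components of a vector field along `f` in the preferred coordinates at `f p`. -/
def compAlong (f : M → N) (V : ∀ q : M, TangentSpace (𝓡 d) (f q)) (p q : M) : Eu d :=
  (trivializationAt (Eu d) (TangentSpace (𝓡 d) : N → Type _) (f p) ⟨f q, V q⟩).2

variable {f : M → N} {V W : ∀ q : M, TangentSpace (𝓡 d) (f q)} {p : M}

theorem compAlong_self : compAlong f V p p = toModel (f p) (V p) := by
  rw [compAlong, trivializationAt_snd (mem_chart_source _ _), coord_self]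

theorem smoothAlongAt_iff : SmoothAlongAt (m := m) f V p ↔ ContMDiffAt (𝓡 m) (𝓡 d) ∞ f p ∧
    ContMDiffAt (𝓡 m) 𝓘(ℝ, Eu d) ∞ (compAlong f V p) p :=
  contMDiffAt_totalSpace

theorem SmoothAlongAt.base (h : SmoothAlongAt (m := m) f V p) : ContMDiffAt (𝓡 m) (𝓡 d) ∞ f p :=
  (smoothAlongAt_iff.1 h).1

theorem SmoothAlongAt.mdiff_base (h : SmoothAlongAt (m := m) f V p) :
    MDifferentiableAt (𝓡 m) (𝓡 d) f p := h.base.mdifferentiableAt (by simp)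

theorem SmoothAlongAt.mdiff (h : SmoothAlongAt (m := m) f V p) :
    MDifferentiableAt (𝓡 m) 𝓘(ℝ, Eu d) (compAlong f V p) p :=
  (smoothAlongAt_iff.1 h).2.mdifferentiableAt (by simp)

theorem eventually_mem_source (hf : ContinuousAt f p) :
    ∀ᶠ q in 𝓝 p, f q ∈ (chartAt (Eu d) (f p)).source :=
  hf ((chartAt (Eu d) (f p)).open_source.mem_nhds (mem_chart_source _ _))

theorem SmoothAlongAt.sub (hV : SmoothAlongAt (m := m) f V p) (hW : SmoothAlongAt (m := m) f W p) :
    SmoothAlongAt (m := m) f (fun q => V q - W q) p := by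
  refine smoothAlongAt_iff.2 ⟨hV.base, ?_⟩
  refine ((smoothAlongAt_iff.1 hV).2.sub (smoothAlongAt_iff.1 hW).2).congr_of_eventuallyEq ?_
  filter_upwards [eventually_mem_source (d := d) hV.base.continuousAt] with q hq
  simp only [compAlong, trivializationAt_snd hq, map_sub]

theorem SmoothAlongAt.smul {s : M → ℝ} (hs : ContMDiffAt (𝓡 m) 𝓘(ℝ, ℝ) ∞ s p)
    (hV : SmoothAlongAt (m := m) f V p) :
    SmoothAlongAt (m := m) f (fun q => s q • V q) p := by
  refine smoothAlongAt_iff.2 ⟨hV.base, ?_⟩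
  refine (hs.smul (smoothAlongAt_iff.1 hV).2).congr_of_eventuallyEq ?_
  filter_upwards [eventually_mem_source (d := d) hV.base.continuousAt] with q hq
  simp only [compAlong, trivializationAt_snd hq, map_smul, Pi.smul_apply']

theorem SmoothAlongAt.congr (hV : SmoothAlongAt (m := m) f V p) (h : ∀ᶠ q in 𝓝 p, W q = V q) :
    SmoothAlongAt (m := m) f W p :=
  ContMDiffAt.congr_of_eventuallyEq hV (by filter_upwards [h] with q hq; rw [hq])

theorem SmoothAlongAt.zero (hf : ContMDiffAt (𝓡 m) (𝓡 d) ∞ f p) :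
    SmoothAlongAt (m := m) (d := d) f (fun _ => 0) p := by
  refine smoothAlongAt_iff.2 ⟨hf, ?_⟩
  refine (contMDiffAt_const (c := (0 : Eu d))).congr_of_eventuallyEq ?_
  filter_upwards [eventually_mem_source (d := d) hf.continuousAt] with q hq
  simp only [compAlong, trivializationAt_snd hq, map_zero]

variable {g : FormField d N}

theorem covAlong_eq (u : TangentSpace (𝓡 m) p) : covAlong g f V p u =
    (toModel (f p)).symm (derivAt (compAlong f V p) p u) +
      christoffel g (f p) (mfderiv (𝓡 m) (𝓡 d) f p u) (V p) := rfl

theorem covAlong_sub (hg : IsRiemannianForm g) (hV : SmoothAlongAt (m := m) f V p)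
    (hW : SmoothAlongAt (m := m) f W p) (u : TangentSpace (𝓡 m) p) :
    covAlong g f (fun q => V q - W q) p u = covAlong g f V p u - covAlong g f W p u := by
  have h1 : compAlong f (fun q => V q - W q) p =ᶠ[𝓝 p]
      fun q => compAlong f V p q - compAlong f W p q := by
    filter_upwards [eventually_mem_source (d := d) hV.base.continuousAt] with q hq
    simp only [compAlong, trivializationAt_snd hq, map_sub]
  have h2 : V p - W p = V p + (-1 : ℝ) • W p := by rw [neg_one_smul, sub_eq_add_neg]
  rw [covAlong_eq, covAlong_eq, covAlong_eq, derivAt_congr h1, derivAt_sub hV.mdiff hW.mdiff, h2, map_sub,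
    christoffel_add_right hg, christoffel_smul_right hg, neg_one_smul]
  abel

theorem covAlong_add_left (hg : IsRiemannianForm g) (u u' : TangentSpace (𝓡 m) p) :
    covAlong g f V p (u + u') = covAlong g f V p u + covAlong g f V p u' := by
  rw [covAlong_eq, covAlong_eq, covAlong_eq, map_add, map_add, map_add, christoffel_add_left hg]
  abel

theorem covAlong_smul_left (hg : IsRiemannianForm g) (t : ℝ) (u : TangentSpace (𝓡 m) p) :
    covAlong g f V p (t • u) = t • covAlong g f V p u := by
  rw [covAlong_eq, covAlong_eq, map_smul, map_smul, map_smul, christoffel_smul_left hg, smul_add]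

/-- The Levi-Civita connection is metric. -/
theorem derivAt_metric (hg : IsRiemannianForm g) (hV : SmoothAlongAt (m := m) f V p)
    (hW : SmoothAlongAt (m := m) f W p) (u : TangentSpace (𝓡 m) p) :
    derivAt (fun q => g (f q) (V q) (W q)) p u =
      g (f p) (covAlong g f V p u) (W p) + g (f p) (V p) (covAlong g f W p u) := by
  have h1 : (fun q => g (f q) (V q) (W q)) =ᶠ[𝓝 p]
      fun q => metricCoeff g (f p) (f q) (compAlong f V p q) (compAlong f W p q) := by
    filter_upwards [eventually_mem_source (d := d) hV.base.continuousAt] with q hq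
    rw [compAlong, compAlong, trivializationAt_snd hq, trivializationAt_snd hq,
      metricCoeff_coord g hq]
  have hG : MDifferentiableAt (𝓡 d) 𝓘(ℝ, Eu d →L[ℝ] Eu d →L[ℝ] ℝ) (metricCoeff g (f p)) (f p) :=
    (hg.smooth (f p)).mdifferentiableAt (by simp)
  have hGf : MDifferentiableAt (𝓡 m) 𝓘(ℝ, Eu d →L[ℝ] Eu d →L[ℝ] ℝ)
      (fun q => metricCoeff g (f p) (f q)) p := hG.comp p hV.mdiff_base
  have h2 := christoffel_metric hg (f p) (mfderiv (𝓡 m) (𝓡 d) f p u) (V p) (W p)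
  have h3 : ∀ (e : Eu d) (w : TangentSpace (𝓡 d) (f p)),
      metricCoeff g (f p) (f p) e (toModel (f p) w) = g (f p) ((toModel (f p)).symm e) w := by
    intro e w
    rw [← metricCoeff_self, ContinuousLinearEquiv.apply_symm_apply]
  have h4 : ∀ (e : Eu d) (w : TangentSpace (𝓡 d) (f p)),
      metricCoeff g (f p) (f p) (toModel (f p) w) e = g (f p) w ((toModel (f p)).symm e) := by
    intro e w
    rw [← metricCoeff_self, ContinuousLinearEquiv.apply_symm_apply]
  rw [derivAt_congr h1, derivAt_clm_apply₂ hGf hV.mdiff hW.mdiff, derivAt_comp hG hV.mdiff_base,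
    covAlong_eq, covAlong_eq, compAlong_self, compAlong_self, ← metricDeriv, ← h2, h3, h4,
    ContinuousLinearMap.map_add₂, map_add]
  ring

/-- The covariant derivative along a composition. -/
theorem covAlong_comp {k : ℕ} {P : Type*} [TopologicalSpace P] [ChartedSpace (Eu k) P] {h : P → M}
    {a : P} (hh : MDifferentiableAt (𝓡 k) (𝓡 m) h a) (hV : SmoothAlongAt (m := m) f V (h a))
    (u : TangentSpace (𝓡 k) a) :
    covAlong g (fun b => f (h b)) (fun b => V (h b)) a u =
      covAlong g f V (h a) (mfderiv (𝓡 k) (𝓡 m) h a u) := by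
  have h1 : mfderiv (𝓡 k) (𝓡 d) (fun b => f (h b)) a u =
      mfderiv (𝓡 m) (𝓡 d) f (h a) (mfderiv (𝓡 k) (𝓡 m) h a u) :=
    congrArg (fun L => L u) (mfderiv_comp a hV.mdiff_base hh)
  rw [covAlong_eq, covAlong_eq, h1]
  congr 2
  exact derivAt_comp hV.mdiff hh u

end CovariantDerivative

/-! ### Symmetry of second derivatives, Lie brackets and torsion -/

section Torsion

variable {m d : ℕ}
  {M : Type*} [TopologicalSpace M] [ChartedSpace (Eu m) M] [IsManifold (𝓡 m) ∞ M]
  {N : Type*} [TopologicalSpace N] [ChartedSpace (Eu d) N] [IsManifold (𝓡 d) ∞ N]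

/-- In finite dimensions an operator is a fixed linear combination of its values on a basis.
Smoothness of metric coefficients and Gram matrices is reduced to scalar functions in this way. -/
theorem contMDiffAt_clm_of_apply {E F : Type*} [NormedAddCommGroup E] [NormedSpace ℝ E]
    [FiniteDimensional ℝ E] [NormedAddCommGroup F] [NormedSpace ℝ F] {h : M → E →L[ℝ] F} {p : M}
    (hh : ∀ e, ContMDiffAt (𝓡 m) 𝓘(ℝ, F) ∞ (fun q => h q e) p) :
    ContMDiffAt (𝓡 m) 𝓘(ℝ, E →L[ℝ] F) ∞ h p := by
  let b := Module.finBasis ℝ E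
  let c : ∀ i, F →L[ℝ] E →L[ℝ] F := fun i =>
    ContinuousLinearMap.smulRightL ℝ E F (LinearMap.toContinuousLinearMap (b.coord i))
  have h1 : h = fun q => ∑ i, c i (h q (b i)) := by
    funext q
    ext e
    conv_lhs => rw [← b.sum_repr e, map_sum]
    rw [sum_apply]
    refine Finset.sum_congr rfl fun i _ => ?_
    rw [map_smul]
    rfl
  rw [h1]
  refine contMDiffAt_finsetSum fun i _ => ?_
  exact (c i).contMDiff.contMDiffAt.comp p (hh (b i))

/-- The derivative of `f` in the preferred coordinates at `p` and `f p`. -/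
def tangentCoeff (f : M → N) (p q : M) : Eu m →L[ℝ] Eu d :=
  (coord (f p) (f q)).comp ((mfderiv (𝓡 m) (𝓡 d) f q).comp (coordSymm p q))

variable {f : M → N} {p : M}

theorem contMDiffAt_tangentCoeff (hf : ContMDiffAt (𝓡 m) (𝓡 d) ∞ f p) :
    ContMDiffAt (𝓡 m) 𝓘(ℝ, Eu m →L[ℝ] Eu d) ∞ (tangentCoeff (m := m) (d := d) f p) p :=
  hf.mfderiv_const (m := ∞) (by simp)

theorem tangentCoeff_coord {q : M} (hq : q ∈ (chartAt (Eu m) p).source)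
    (v : TangentSpace (𝓡 m) q) :
    tangentCoeff f p q (coord p q v) = coord (f p) (f q) (mfderiv (𝓡 m) (𝓡 d) f q v) := by
  show coord (f p) (f q) (mfderiv (𝓡 m) (𝓡 d) f q (coordSymm p q (coord p q v))) = _
  rw [coordSymm_coord hq]

/-- `tangentCoeff` is the Jacobian of the coordinate expression of `f`, on a neighbourhood and not
only at the centre, so its own derivative is a Hessian. -/
theorem hasFDerivAt_tangentCoeff (hf : ContMDiffAt (𝓡 m) (𝓡 d) ∞ f p) :
    ∀ᶠ a in 𝓝 (extChartAt (𝓡 m) p p), HasFDerivAt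
      (fun a => extChartAt (𝓡 d) (f p) (f ((extChartAt (𝓡 m) p).symm a)))
      (tangentCoeff f p ((extChartAt (𝓡 m) p).symm a)) a := by
  have h1 : ∀ᶠ q in 𝓝 p, ContMDiffAt (𝓡 m) (𝓡 d) 1 f q :=
    (contMDiffAt_iff_contMDiffAt_nhds (by simp)).1 (hf.of_le (m := 1) (by simp))
  have h2 : ∀ᶠ q in 𝓝 p, f q ∈ (chartAt (Eu d) (f p)).source :=
    eventually_mem_source (d := d) hf.continuousAt
  have h3 : Tendsto (extChartAt (𝓡 m) p).symm (𝓝 (extChartAt (𝓡 m) p p)) (𝓝 p) := by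
    have := continuousAt_extChartAt_symm (I := 𝓡 m) p
    rwa [ContinuousAt, extChartAt_to_inv] at this
  filter_upwards [h3.eventually h1, h3.eventually h2,
    extChartAt_target_mem_nhds (I := 𝓡 m) p] with a ha1 ha2 ha3
  set q := (extChartAt (𝓡 m) p).symm a with hq
  have hqs : q ∈ (chartAt (Eu m) p).source := by
    have := (extChartAt (𝓡 m) p).map_target ha3
    rwa [extChartAt_source] at this
  have haq : extChartAt (𝓡 m) p q = a := (extChartAt (𝓡 m) p).right_inv ha3
  have e1 : HasMFDerivAt (𝓡 d) 𝓘(ℝ, Eu d) (extChartAt (𝓡 d) (f p)) (f q)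
      (coord (f p) (f q)) := by
    have := (mdifferentiableAt_extChartAt (I := 𝓡 d) ha2).hasMFDerivAt
    rwa [← TangentBundle.continuousLinearMapAt_trivializationAt ha2] at this
  have e2 : HasMFDerivAt (𝓡 m) (𝓡 d) f q (mfderiv (𝓡 m) (𝓡 d) f q) :=
    (ha1.mdifferentiableAt (by simp)).hasMFDerivAt
  have e3 : HasMFDerivAt 𝓘(ℝ, Eu m) (𝓡 m) (extChartAt (𝓡 m) p).symm a (coordSymm p q) := by
    have := (mdifferentiableWithinAt_extChartAt_symm (I := 𝓡 m) ha3).hasMFDerivWithinAt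
    rw [ModelWithCorners.range_eq_univ, hasMFDerivWithinAt_univ] at this
    have h4 := TangentBundle.symmL_trivializationAt (I := 𝓡 m) hqs
    rw [haq, ModelWithCorners.range_eq_univ] at h4
    have h5 : coordSymm p q = mfderivWithin 𝓘(ℝ, Eu m) (𝓡 m) (extChartAt (𝓡 m) p).symm univ a := h4
    rw [h5]
    exact this
  have e4 := e1.comp a (e2.comp a e3)
  exact e4.hasFDerivAt

/-- Symmetry of the Hessian of the coordinate expression of `f`; together with the symmetry of the
Christoffel symbols it is the whole content of torsion-freeness along `f`. -/
theorem derivAt_tangentCoeff_symm (hf : ContMDiffAt (𝓡 m) (𝓡 d) ∞ f p)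
    (u v : TangentSpace (𝓡 m) p) :
    derivAt (tangentCoeff (m := m) (d := d) f p) p u (toModel p v) =
      derivAt (tangentCoeff (m := m) (d := d) f p) p v (toModel p u) := by
  have h1 := (contMDiffAt_tangentCoeff hf).mdifferentiableAt (by simp)
  have h2 := hasFDerivAt_chart h1
  have h3 := second_derivative_symmetric_of_eventually (hasFDerivAt_tangentCoeff hf) h2
    (toModel p u) (toModel p v)
  simpa using h3

/-- `X` is smooth at `p`. -/
abbrev SmoothVFAt (X : ∀ q : M, TangentSpace (𝓡 m) q) (p : M) : Prop :=
  SmoothAlongAt (m := m) (fun q : M => q) X p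

variable {X Y : ∀ q : M, TangentSpace (𝓡 m) q}

theorem compAlong_mfderiv (hf : ContinuousAt f p) :
    ∀ᶠ q in 𝓝 p, compAlong f (fun q => mfderiv (𝓡 m) (𝓡 d) f q (X q)) p q =
      tangentCoeff f p q (compAlong (fun q : M => q) X p q) := by
  filter_upwards [eventually_mem_source (d := d) hf,
    (chartAt (Eu m) p).open_source.mem_nhds (mem_chart_source _ _)] with q h1 h2
  rw [compAlong, trivializationAt_snd h1, compAlong, trivializationAt_snd h2,
    tangentCoeff_coord h2]

theorem SmoothVFAt.pushforward (hf : ContMDiffAt (𝓡 m) (𝓡 d) ∞ f p) (hX : SmoothVFAt X p) :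
    SmoothAlongAt (m := m) f (fun q => mfderiv (𝓡 m) (𝓡 d) f q (X q)) p := by
  refine smoothAlongAt_iff.2 ⟨hf, ?_⟩
  exact ((contMDiffAt_tangentCoeff hf).clm_apply (smoothAlongAt_iff.1 hX).2).congr_of_eventuallyEq
    (compAlong_mfderiv hf.continuousAt)

theorem tangentCoeff_self (v : Eu m) : tangentCoeff f p p v =
    toModel (f p) (mfderiv (𝓡 m) (𝓡 d) f p ((toModel p).symm v)) := by
  show coord (f p) (f p) (mfderiv (𝓡 m) (𝓡 d) f p (coordSymm p p v)) = _
  rw [coordSymm_self, coord_self]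

/-- The bracket is defined by pulling back to the chart, and the pulled-back fields are the
component functions; at the centre the chart contributes the identity. -/
theorem mlieBracket_eq (hX : SmoothVFAt X p) (hY : SmoothVFAt Y p) :
    VectorField.mlieBracket (𝓡 m) X Y p = (toModel p).symm
      (derivAt (compAlong (fun q : M => q) Y p) p (X p) -
        derivAt (compAlong (fun q : M => q) X p) p (Y p)) := by
  have key : ∀ V : ∀ q : M, TangentSpace (𝓡 m) q,
      (VectorField.mpullbackWithin 𝓘(ℝ, Eu m) (𝓡 m) (extChartAt (𝓡 m) p).symm V (range (𝓡 m)) :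
        Eu m → Eu m) =ᶠ[𝓝 (extChartAt (𝓡 m) p p)]
      fun a => compAlong (fun q : M => q) V p ((extChartAt (𝓡 m) p).symm a) := by
    intro V
    filter_upwards [extChartAt_target_mem_nhds (I := 𝓡 m) p] with a ha
    rw [VectorField.mpullbackWithin_apply]
    set q := (extChartAt (𝓡 m) p).symm a with hq
    have hqs : q ∈ (chartAt (Eu m) p).source := by
      have := (extChartAt (𝓡 m) p).map_target ha
      rwa [extChartAt_source] at this
    have haq : extChartAt (𝓡 m) p q = a := (extChartAt (𝓡 m) p).right_inv ha
    rw [compAlong, trivializationAt_snd hqs]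
    have h1 := isInvertible_mfderivWithin_extChartAt_symm (I := 𝓡 m) ha
    have h4 := TangentBundle.symmL_trivializationAt (I := 𝓡 m) hqs
    rw [haq] at h4
    have h5 : coordSymm p q = mfderivWithin 𝓘(ℝ, Eu m) (𝓡 m) (extChartAt (𝓡 m) p).symm (range (𝓡 m)) a := h4
    obtain ⟨e, he⟩ := h1
    have h6 : (mfderivWithin 𝓘(ℝ, Eu m) (𝓡 m) (extChartAt (𝓡 m) p).symm (range (𝓡 m)) a).inverse (V q) = e.symm (V q) := by
      rw [← he, ContinuousLinearMap.inverse_equiv]; rfl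
    refine h6.trans ?_
    refine (ContinuousLinearEquiv.symm_apply_eq e (y := (coord p q (V q) : Eu m))).2 ?_
    have h7 : e (coord p q (V q)) = coordSymm p q (coord p q (V q)) := by rw [h5]; exact congrArg (fun L => L (coord p q (V q))) he
    exact (h7.trans (coordSymm_coord hqs _)).symm
  let VX : Eu m → Eu m :=
    VectorField.mpullbackWithin 𝓘(ℝ, Eu m) (𝓡 m) (extChartAt (𝓡 m) p).symm X (range (𝓡 m))
  let VY : Eu m → Eu m :=
    VectorField.mpullbackWithin 𝓘(ℝ, Eu m) (𝓡 m) (extChartAt (𝓡 m) p).symm Y (range (𝓡 m))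
  have h2 : mfderiv (𝓡 m) 𝓘(ℝ, Eu m) (extChartAt (𝓡 m) p) p =
    ((toModel (d := m) p : TangentSpace (𝓡 m) p →L[ℝ] Eu m)) := mfderiv_extChartAt_self
  have h0 : ∀ L : TangentSpace (𝓡 m) p →L[ℝ] Eu m, L = (toModel (d := m) p : TangentSpace (𝓡 m) p →L[ℝ] Eu m) → ∀ w : Eu m,
      L.inverse w = (toModel p).symm w := by
    rintro L rfl w
    rw [ContinuousLinearMap.inverse_equiv]; rfl
  refine (h0 (mfderiv (𝓡 m) 𝓘(ℝ, Eu m) (extChartAt (𝓡 m) p) p) h2 (VectorField.lieBracketWithin ℝ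
    VX VY ((extChartAt (𝓡 m) p).symm ⁻¹' univ ∩ range (𝓡 m)) (extChartAt (𝓡 m) p p))).trans ?_
  rw [ModelWithCorners.range_eq_univ, preimage_univ,
    univ_inter, VectorField.lieBracketWithin_univ, VectorField.lieBracket_eq]
  have kX : VX =ᶠ[_] _ := key X
  have kY : VY =ᶠ[_] _ := key Y
  show (toModel p).symm _ = _
  congr 1
  have eX := hasFDerivAt_chart hX.mdiff
  have eY := hasFDerivAt_chart hY.mdiff
  have cX := compAlong_self (f := fun q : M => q) (V := X) (p := p)
  have cY := compAlong_self (f := fun q : M => q) (V := Y) (p := p)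
  beta_reduce
  rw [kX.fderiv_eq, kY.fderiv_eq, kX.self_of_nhds, kY.self_of_nhds, eX.fderiv, eY.fderiv]
  beta_reduce
  rw [extChartAt_to_inv, cX, cY]
  rfl

variable {g : FormField d N}

/-- The Levi-Civita connection is torsion-free. -/
theorem covAlong_mfderiv_sub (hg : IsRiemannianForm g) (hf : ContMDiffAt (𝓡 m) (𝓡 d) ∞ f p)
    (hX : SmoothVFAt X p) (hY : SmoothVFAt Y p) :
    covAlong g f (fun q => mfderiv (𝓡 m) (𝓡 d) f q (Y q)) p (X p) -
      covAlong g f (fun q => mfderiv (𝓡 m) (𝓡 d) f q (X q)) p (Y p) =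
      mfderiv (𝓡 m) (𝓡 d) f p (VectorField.mlieBracket (𝓡 m) X Y p) := by
  have hJ := (contMDiffAt_tangentCoeff hf).mdifferentiableAt (by simp)
  rw [covAlong_eq, covAlong_eq, derivAt_congr (compAlong_mfderiv hf.continuousAt),
    derivAt_congr (compAlong_mfderiv hf.continuousAt), derivAt_clm_apply hJ hX.mdiff,
    derivAt_clm_apply hJ hY.mdiff, christoffel_symm hg (f p) (mfderiv (𝓡 m) (𝓡 d) f p (Y p)),
    mlieBracket_eq hX hY, compAlong_self, compAlong_self, derivAt_tangentCoeff_symm hf (X p),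
    tangentCoeff_self, tangentCoeff_self, map_add, map_add,
    ContinuousLinearEquiv.symm_apply_apply, ContinuousLinearEquiv.symm_apply_apply, map_sub,
    map_sub]
  abel

end Torsion

/-! ### Leibniz rules and covariant derivatives of endomorphism fields -/

section Calculus

variable {m d : ℕ}
  {M : Type*} [TopologicalSpace M] [ChartedSpace (Eu m) M] [IsManifold (𝓡 m) ∞ M]
  {N : Type*} [TopologicalSpace N] [ChartedSpace (Eu d) N] [IsManifold (𝓡 d) ∞ N]
  {f : M → N} {V W : ∀ q : M, TangentSpace (𝓡 d) (f q)} {p : M} {g : FormField d N}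

theorem smoothAlongAt_coordSymm (hf : ContMDiffAt (𝓡 m) (𝓡 d) ∞ f p) (c : Eu d) :
    SmoothAlongAt (m := m) f (fun q => coordSymm (d := d) (f p) (f q) c) p := by
  refine smoothAlongAt_iff.2 ⟨hf, ?_⟩
  refine (contMDiffAt_const (c := c)).congr_of_eventuallyEq ?_
  filter_upwards [eventually_mem_source (d := d) hf.continuousAt] with q hq
  rw [compAlong, trivializationAt_snd hq, coord_coordSymm hq]

theorem IsRiemannianForm.of_smooth (symm : ∀ x u v, g x u v = g x v u)
    (pos : ∀ x u, u ≠ 0 → 0 < g x u u)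
    (smooth : ∀ x (X Y : ∀ y, TangentSpace (𝓡 d) y), SmoothVFAt X x → SmoothVFAt Y x →
      ContMDiffAt (𝓡 d) 𝓘(ℝ, ℝ) ∞ (fun y => g y (X y) (Y y)) x) : IsRiemannianForm g where
  symm := symm
  pos := pos
  smooth x := contMDiffAt_clm_of_apply fun a => contMDiffAt_clm_of_apply fun b =>
    smooth x _ _ (smoothAlongAt_coordSymm (f := fun y : N => y) contMDiffAt_id a)
      (smoothAlongAt_coordSymm (f := fun y : N => y) contMDiffAt_id b)

theorem contMDiffAt_metric (hg : IsRiemannianForm g) (hV : SmoothAlongAt (m := m) f V p)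
    (hW : SmoothAlongAt (m := m) f W p) :
    ContMDiffAt (𝓡 m) 𝓘(ℝ, ℝ) ∞ (fun q => g (f q) (V q) (W q)) p := by
  have h1 : (fun q => g (f q) (V q) (W q)) =ᶠ[𝓝 p]
      fun q => metricCoeff g (f p) (f q) (compAlong f V p q) (compAlong f W p q) := by
    filter_upwards [eventually_mem_source (d := d) hV.base.continuousAt] with q hq
    rw [compAlong, compAlong, trivializationAt_snd hq, trivializationAt_snd hq,
      metricCoeff_coord g hq]
  refine ContMDiffAt.congr_of_eventuallyEq ?_ h1
  exact (((hg.smooth (f p)).comp p hV.base).clm_apply (smoothAlongAt_iff.1 hV).2).clm_apply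
    (smoothAlongAt_iff.1 hW).2

theorem covAlong_add (hg : IsRiemannianForm g) (hV : SmoothAlongAt (m := m) f V p)
    (hW : SmoothAlongAt (m := m) f W p) (u : TangentSpace (𝓡 m) p) :
    covAlong g f (fun q => V q + W q) p u = covAlong g f V p u + covAlong g f W p u := by
  have h1 : compAlong f (fun q => V q + W q) p =ᶠ[𝓝 p]
      fun q => compAlong f V p q + compAlong f W p q := by
    filter_upwards [eventually_mem_source (d := d) hV.base.continuousAt] with q hq
    simp only [compAlong, trivializationAt_snd hq, map_add]
  rw [covAlong_eq, covAlong_eq, covAlong_eq, derivAt_congr h1, derivAt_add hV.mdiff hW.mdiff,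
    map_add, christoffel_add_right hg]
  abel

theorem covAlong_smul (hg : IsRiemannianForm g) {s : M → ℝ}
    (hs : ContMDiffAt (𝓡 m) 𝓘(ℝ, ℝ) ∞ s p) (hV : SmoothAlongAt (m := m) f V p)
    (u : TangentSpace (𝓡 m) p) :
    covAlong g f (fun q => s q • V q) p u = derivAt s p u • V p + s p • covAlong g f V p u := by
  let B : ℝ →L[ℝ] Eu d →L[ℝ] Eu d := ContinuousLinearMap.lsmul ℝ ℝ
  have h1 : compAlong f (fun q => s q • V q) p =ᶠ[𝓝 p]
      fun q => (fun _ : M => B) q (s q) (compAlong f V p q) := by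
    filter_upwards [eventually_mem_source (d := d) hV.base.continuousAt] with q hq
    simp only [compAlong, trivializationAt_snd hq, map_smul]
    rfl
  have hB : MDifferentiableAt (𝓡 m) 𝓘(ℝ, ℝ →L[ℝ] Eu d →L[ℝ] Eu d) (fun _ : M => B) p :=
    mdifferentiableAt_const
  have hs' : MDifferentiableAt (𝓡 m) 𝓘(ℝ, ℝ) s p := hs.mdifferentiableAt (by simp)
  have h2 := derivAt_clm_apply₂ hB hs' hV.mdiff u
  rw [derivAt_const, compAlong_self] at h2
  have h3 : derivAt (fun q => (fun _ : M => B) q (s q) (compAlong f V p q)) p u =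
      derivAt s p u • toModel (f p) (V p) + s p • derivAt (compAlong f V p) p u := by
    rw [h2]; simp [B]
  rw [covAlong_eq, covAlong_eq, derivAt_congr h1, h3, map_add, map_smul, map_smul,
    ContinuousLinearEquiv.symm_apply_apply, christoffel_smul_right hg, smul_add]
  abel

/-! ### Fields of endomorphisms -/

/-- A field of endomorphisms of the tangent spaces in the preferred coordinates at `x`. -/
def endCoeff (φ : ∀ x : N, TangentSpace (𝓡 d) x →L[ℝ] TangentSpace (𝓡 d) x) (x y : N) :
    Eu d →L[ℝ] Eu d :=
  (coord x y).comp ((φ y).comp (coordSymm x y))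

/-- The covariant derivative `(∇_u φ) v` of a field of endomorphisms. -/
def covEnd (g : FormField d N) (φ : ∀ x : N, TangentSpace (𝓡 d) x →L[ℝ] TangentSpace (𝓡 d) x)
    (x : N) (u v : TangentSpace (𝓡 d) x) : TangentSpace (𝓡 d) x :=
  (toModel x).symm (derivAt (endCoeff φ x) x u (toModel x v)) + christoffel g x u (φ x v) -
    φ x (christoffel g x u v)

variable {φ : ∀ x : N, TangentSpace (𝓡 d) x →L[ℝ] TangentSpace (𝓡 d) x}

theorem compAlong_end (hf : ContinuousAt f p) : ∀ᶠ q in 𝓝 p,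
    compAlong f (fun q => φ (f q) (V q)) p q = endCoeff φ (f p) (f q) (compAlong f V p q) := by
  filter_upwards [eventually_mem_source (d := d) hf] with q hq
  rw [compAlong, compAlong, trivializationAt_snd hq, trivializationAt_snd hq]
  show _ = coord (f p) (f q) (φ (f q) (coordSymm (f p) (f q) (coord (f p) (f q) (V q))))
  rw [coordSymm_coord hq]

theorem endCoeff_self (x : N) (a : Eu d) :
    endCoeff φ x x a = toModel x (φ x ((toModel x).symm a)) := by
  show coord x x (φ x (coordSymm x x a)) = _
  rw [coord_self, coordSymm_self]

theorem SmoothAlongAt.endApply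
    (hφ : ContMDiffAt (𝓡 d) 𝓘(ℝ, Eu d →L[ℝ] Eu d) ∞ (endCoeff φ (f p)) (f p))
    (hV : SmoothAlongAt (m := m) f V p) :
    SmoothAlongAt (m := m) f (fun q => φ (f q) (V q)) p := by
  refine smoothAlongAt_iff.2 ⟨hV.base, ?_⟩
  exact ((hφ.comp p hV.base).clm_apply (smoothAlongAt_iff.1 hV).2).congr_of_eventuallyEq
    (compAlong_end hV.base.continuousAt)

/-- This product rule identifies the coordinate expression `covEnd` with `∇φ`. It holds along an
arbitrary map, so it applies directly to fields of the ambient manifold along a submanifold. -/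
theorem covAlong_end (hφ : ContMDiffAt (𝓡 d) 𝓘(ℝ, Eu d →L[ℝ] Eu d) ∞ (endCoeff φ (f p)) (f p))
    (hV : SmoothAlongAt (m := m) f V p) (u : TangentSpace (𝓡 m) p) :
    covAlong g f (fun q => φ (f q) (V q)) p u = φ (f p) (covAlong g f V p u) +
      covEnd g φ (f p) (mfderiv (𝓡 m) (𝓡 d) f p u) (V p) := by
  have h1 := hφ.mdifferentiableAt (by simp)
  have h2 : MDifferentiableAt (𝓡 m) 𝓘(ℝ, Eu d →L[ℝ] Eu d) (fun q => endCoeff φ (f p) (f q)) p :=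
    h1.comp p hV.mdiff_base
  rw [covAlong_eq, covAlong_eq, derivAt_congr (compAlong_end hV.base.continuousAt),
    derivAt_clm_apply h2 hV.mdiff, derivAt_comp h1 hV.mdiff_base, covEnd, endCoeff_self,
    map_add, map_add, ContinuousLinearEquiv.symm_apply_apply, compAlong_self]
  abel

theorem covEnd_add_left (hg : IsRiemannianForm g) (x : N) (u u' v : TangentSpace (𝓡 d) x) :
    covEnd g φ x (u + u') v = covEnd g φ x u v + covEnd g φ x u' v := by
  unfold covEnd
  rw [map_add, add_apply, map_add, christoffel_add_left hg, christoffel_add_left hg, map_add]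
  abel

theorem covEnd_smul_left (hg : IsRiemannianForm g) (x : N) (t : ℝ) (u v : TangentSpace (𝓡 d) x) :
    covEnd g φ x (t • u) v = t • covEnd g φ x u v := by
  unfold covEnd
  rw [map_smul, smul_apply, map_smul, christoffel_smul_left hg, christoffel_smul_left hg,
    map_smul, smul_sub, smul_add]

theorem covEnd_add_right (hg : IsRiemannianForm g) (x : N) (u v v' : TangentSpace (𝓡 d) x) :
    covEnd g φ x u (v + v') = covEnd g φ x u v + covEnd g φ x u v' := by
  unfold covEnd
  rw [map_add, map_add, map_add, map_add, christoffel_add_right hg, christoffel_add_right hg,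
    map_add]
  abel

theorem covEnd_smul_right (hg : IsRiemannianForm g) (x : N) (t : ℝ) (u v : TangentSpace (𝓡 d) x) :
    covEnd g φ x u (t • v) = t • covEnd g φ x u v := by
  unfold covEnd
  rw [map_smul, map_smul, map_smul, map_smul, christoffel_smul_right hg,
    christoffel_smul_right hg, map_smul, smul_sub, smul_add]

end Calculus

/-! ### Constant vector fields on a vector space -/

section ModelSpace

variable {k : ℕ}

/-- A constant vector field. -/
def constVF (u : Eu k) : ∀ a : Eu k, TangentSpace (𝓡 k) a := fun _ => u

theorem compAlong_id_model (X : ∀ a : Eu k, TangentSpace (𝓡 k) a) (a b : Eu k) :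
    compAlong (fun a : Eu k => a) X a b = X b := by
  simp [compAlong]
  rfl

theorem smoothVF_constVF (u : Eu k) : IsSmoothVF (constVF u) := by
  intro a
  refine smoothAlongAt_iff.2 ⟨contMDiffAt_id, ?_⟩
  exact (contMDiffAt_const (c := u)).congr_of_eventuallyEq
    (Eventually.of_forall fun b => compAlong_id_model _ _ _)

theorem mlieBracket_constVF (u v a : Eu k) :
    VectorField.mlieBracket (𝓡 k) (constVF u) (constVF v) a = 0 := by
  have h : ∀ w : Eu k, compAlong (fun a : Eu k => a) (constVF w) a = fun _ => w :=
    fun w => funext fun b => compAlong_id_model _ _ _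
  rw [mlieBracket_eq (smoothVF_constVF u a) (smoothVF_constVF v a), h, h, derivAt_const,
    derivAt_const]
  simp

theorem derivAt_model {F : Type*} [NormedAddCommGroup F] [NormedSpace ℝ F] (h : Eu k → F)
    (a u : Eu k) : derivAt h a u = fderiv ℝ h a u := by
  rw [derivAt, mfderiv_eq_fderiv]; rfl

end ModelSpace

/-! ### Extension of local vector fields -/

section Extension

variable {m : ℕ} {M : Type*} [TopologicalSpace M] [T2Space M] [ChartedSpace (Eu m) M]
  [IsManifold (𝓡 m) ∞ M]

theorem exists_bump (p : M) {U : Set M} (hU : U ∈ 𝓝 p) : ∃ s : M → ℝ,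
    ContMDiff (𝓡 m) 𝓘(ℝ, ℝ) ∞ s ∧ (∀ᶠ q in 𝓝 p, s q = 1) ∧ tsupport s ⊆ U := by
  obtain ⟨s, -, hs⟩ := (SmoothBumpFunction.nhds_basis_tsupport (I := 𝓡 m) p).mem_iff.1 hU
  exact ⟨s, s.contMDiff, s.eventuallyEq_one, hs⟩

/-- A vector field that is smooth near the support of a function, multiplied by this function, is
smooth. -/
theorem isSmoothVF_smul {s : M → ℝ} (hs : ContMDiff (𝓡 m) 𝓘(ℝ, ℝ) ∞ s)
    {X : ∀ q : M, TangentSpace (𝓡 m) q} (hX : ∀ q ∈ tsupport s, SmoothVFAt X q) :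
    IsSmoothVF (fun q => s q • X q) := by
  intro q
  by_cases hq : q ∈ tsupport s
  · exact SmoothAlongAt.smul (hs q) (hX q hq)
  · refine SmoothAlongAt.congr (SmoothAlongAt.zero (f := fun q : M => q) contMDiffAt_id) ?_
    filter_upwards [(isClosed_tsupport s).isOpen_compl.mem_nhds hq] with y hy
    rw [image_eq_zero_of_notMem_tsupport hy, zero_smul]

theorem exists_isSmoothVF_eventuallyEq {X : ∀ q : M, TangentSpace (𝓡 m) q} {p : M}
    (hX : ∀ᶠ q in 𝓝 p, SmoothVFAt X q) :
    ∃ (s : M → ℝ), IsSmoothVF (fun q => s q • X q) ∧ ∀ᶠ q in 𝓝 p, s q = 1 := by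
  obtain ⟨s, h1, h2, h3⟩ := exists_bump (m := m) p hX
  exact ⟨s, isSmoothVF_smul h1 fun q hq => h3 hq, h2⟩

/-- Every tangent vector is a value of a smooth vector field. -/
theorem exists_isSmoothVF (p : M) (v : TangentSpace (𝓡 m) p) :
    ∃ X : ∀ q : M, TangentSpace (𝓡 m) q, IsSmoothVF X ∧ X p = v := by
  have h1 : ∀ᶠ q in 𝓝 p, SmoothVFAt (fun y : M => coordSymm p y (toModel p v)) q := by
    filter_upwards [(chartAt (Eu m) p).open_source.mem_nhds (mem_chart_source _ _)] with q hq
    have h2 : ContMDiffOn (𝓡 m) (𝓡 m).tangent ∞ (fun y : M => (TotalSpace.mk' (Eu m) y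
        (coordSymm p y (toModel p v)) : TangentBundle (𝓡 m) M)) (chartAt (Eu m) p).source := by
      refine ((trivializationAt (Eu m) (TangentSpace (𝓡 m) : M → Type _)
        p).contMDiffOn_section_baseSet_iff (IB := 𝓡 m)).2 ?_
      refine (contMDiffOn_const (c := toModel p v)).congr fun y hy => ?_
      rw [trivializationAt_snd hy, coord_coordSymm hy]
    exact h2.contMDiffAt ((chartAt (Eu m) p).open_source.mem_nhds hq)
  obtain ⟨s, h2, h3⟩ := exists_isSmoothVF_eventuallyEq h1
  refine ⟨_, h2, ?_⟩
  show s p • coordSymm p p (toModel p v) = v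
  rw [h3.self_of_nhds, one_smul, coordSymm_self, ContinuousLinearEquiv.symm_apply_apply]

end Extension

/-! ### Smoothness of tangential projections and the induced metric -/

section Projection

variable {m d : ℕ}
  {M : Type*} [TopologicalSpace M] [ChartedSpace (Eu m) M] [IsManifold (𝓡 m) ∞ M]
  {N : Type*} [TopologicalSpace N] [ChartedSpace (Eu d) N] [IsManifold (𝓡 d) ∞ N]
  {f : M → N} {V W : ∀ q : M, TangentSpace (𝓡 d) (f q)} {p : M} {g : FormField d N}

theorem contMDiffAt_inverse_apply {E F : Type*} [NormedAddCommGroup E] [NormedSpace ℝ E]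
    [CompleteSpace E] [NormedAddCommGroup F] [NormedSpace ℝ F] {A : M → E →L[ℝ] F} {l : M → F}
    (hA : ContMDiffAt (𝓡 m) 𝓘(ℝ, E →L[ℝ] F) ∞ A p) (hl : ContMDiffAt (𝓡 m) 𝓘(ℝ, F) ∞ l p)
    (hAp : (A p).IsInvertible) :
    ContMDiffAt (𝓡 m) 𝓘(ℝ, E) ∞ (fun q => (A q).inverse (l q)) p := by
  obtain ⟨e, he⟩ := hAp
  have h1 : ContDiffAt ℝ ∞ (ContinuousLinearMap.inverse : (E →L[ℝ] F) → F →L[ℝ] E) (A p) := by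
    rw [← he]; exact contDiffAt_map_inverse e
  exact (h1.contMDiffAt.comp p hA).clm_apply hl

/-- The projection solves a linear system whose Gram matrix and right hand side are smooth, and
inversion of operators is smooth. -/
theorem contMDiffAt_pullProj {E : Type*} [NormedAddCommGroup E] [NormedSpace ℝ E]
    [FiniteDimensional ℝ E] (hg : IsRiemannianForm g) {L : ∀ q, E →L[ℝ] TangentSpace (𝓡 d) (f q)}
    (hL : ∀ e, SmoothAlongAt (m := m) f (fun q => L q e) p) (hinj : Function.Injective (L p))
    (hV : SmoothAlongAt (m := m) f V p) :
    ContMDiffAt (𝓡 m) 𝓘(ℝ, E) ∞ (fun q => pullProj (g (f q)) (L q) (V q)) p := by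
  have : CompleteSpace E := FiniteDimensional.complete ℝ E
  refine contMDiffAt_inverse_apply (A := fun q => pullForm (g (f q)) (L q))
    (l := fun q => (g (f q) (V q)).comp (L q)) ?_ ?_
    (pullForm_isInvertible (hg.pos (f p)) hinj)
  · exact contMDiffAt_clm_of_apply fun a => contMDiffAt_clm_of_apply fun b =>
      contMDiffAt_metric hg (hL a) (hL b)
  · exact contMDiffAt_clm_of_apply fun a => contMDiffAt_metric hg hV (hL a)

theorem coordSymm_injective {x y : N} (hy : y ∈ (chartAt (Eu d) x).source) :
    Function.Injective (coordSymm (d := d) x y) := fun a b h => by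
  rw [← coord_coordSymm hy a, h, coord_coordSymm hy]

/-- Precomposing with `coordSymm` replaces the varying domain `T_q M` by the fixed space `Eu m`, as
`contMDiffAt_pullProj` requires. -/
theorem tanPart_eq (hg : IsRiemannianForm g) {q : M} (hq : q ∈ (chartAt (Eu m) p).source)
    (hinj : Function.Injective (mfderiv (𝓡 m) (𝓡 d) f q)) (v : TangentSpace (𝓡 d) (f q)) :
    tanPart (m := m) g f q v = coordSymm p q (pullProj (g (f q))
      ((mfderiv (𝓡 m) (𝓡 d) f q).comp (coordSymm p q)) v) := by
  refine pullProj_eq (hg.pos (f q)) hinj fun u => ?_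
  have hi : Function.Injective ((mfderiv (𝓡 m) (𝓡 d) f q).comp (coordSymm p q)) :=
    hinj.comp (coordSymm_injective hq)
  have h := pullProj_spec (hg.pos (f q)) hi v (coord p q u)
  simp only [ContinuousLinearMap.comp_apply, coordSymm_coord hq] at h
  exact h

theorem SmoothAlongAt.tanPart (hg : IsRiemannianForm g)
    (hinj : ∀ q, Function.Injective (mfderiv (𝓡 m) (𝓡 d) f q))
    (hV : SmoothAlongAt (m := m) f V p) :
    SmoothVFAt (fun q => tanPart (m := m) g f q (V q)) p := by
  refine smoothAlongAt_iff.2 ⟨contMDiffAt_id, ?_⟩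
  have h1 : ContMDiffAt (𝓡 m) 𝓘(ℝ, Eu m) ∞ (fun q => pullProj (g (f q))
      ((mfderiv (𝓡 m) (𝓡 d) f q).comp (coordSymm p q)) (V q)) p := by
    refine contMDiffAt_pullProj hg (fun e => ?_) ?_ hV
    · exact SmoothVFAt.pushforward hV.base
        (smoothAlongAt_coordSymm (f := fun y : M => y) contMDiffAt_id e)
    · exact (hinj p).comp (coordSymm_injective (mem_chart_source (Eu m) p))
  refine h1.congr_of_eventuallyEq ?_
  filter_upwards [(chartAt (Eu m) p).open_source.mem_nhds (mem_chart_source _ _)] with q hq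
  rw [compAlong, trivializationAt_snd hq, tanPart_eq hg hq (hinj q), coord_coordSymm hq]

theorem tanPart_spec (hg : IsRiemannianForm g)
    (hinj : Function.Injective (mfderiv (𝓡 m) (𝓡 d) f p)) (v : TangentSpace (𝓡 d) (f p))
    (u : TangentSpace (𝓡 m) p) :
    g (f p) (mfderiv (𝓡 m) (𝓡 d) f p (tanPart (m := m) g f p v)) (mfderiv (𝓡 m) (𝓡 d) f p u) =
      g (f p) v (mfderiv (𝓡 m) (𝓡 d) f p u) :=
  pullProj_spec (hg.pos (f p)) hinj v u

theorem norPart_spec (hg : IsRiemannianForm g)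
    (hinj : Function.Injective (mfderiv (𝓡 m) (𝓡 d) f p)) (v : TangentSpace (𝓡 d) (f p))
    (u : TangentSpace (𝓡 m) p) :
    g (f p) (norPart (m := m) g f p v) (mfderiv (𝓡 m) (𝓡 d) f p u) = 0 := by
  rw [norPart, ContinuousLinearMap.map_sub₂, tanPart_spec hg hinj, sub_self]

theorem tanPart_mfderiv (hg : IsRiemannianForm g)
    (hinj : Function.Injective (mfderiv (𝓡 m) (𝓡 d) f p)) (u : TangentSpace (𝓡 m) p) :
    tanPart g f p (mfderiv (𝓡 m) (𝓡 d) f p u) = u :=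
  pullProj_eq (hg.pos (f p)) hinj fun _ => rfl

theorem isRiemannianForm_inducedMetric (hg : IsRiemannianForm g)
    (hf : IsSubmanifoldMap (m := m) (d := d) f) :
    IsRiemannianForm (inducedMetric (m := m) g f) := by
  refine .of_smooth (fun x u v => hg.symm _ _ _) (fun x u hu => hg.pos _ _ fun h => hu ?_)
    fun x X Y hX hY => ?_
  · exact hf.2 x (h.trans (map_zero _).symm)
  · exact contMDiffAt_metric (f := f) hg (SmoothVFAt.pushforward (hf.1 x) hX)
      (SmoothVFAt.pushforward (hf.1 x) hY)

end Projection

/-! ### Orthogonal complements, frames and sections of distributions -/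

section Distributions

variable {m : ℕ} {M : Type*} [TopologicalSpace M] [ChartedSpace (Eu m) M]
  [IsManifold (𝓡 m) ∞ M] {g : FormField m M} {D : SubspaceField m M}

theorem isCompl_orthoCompl (hg : IsRiemannianForm g) (p : M) :
    IsCompl (D p) (orthoCompl g D p) := by
  rw [isCompl_iff, disjoint_iff, codisjoint_iff]
  constructor
  · rw [eq_bot_iff]
    rintro v ⟨h1, h2⟩
    by_contra hne
    exact (hg.pos p v hne).ne' (h2 v h1)
  · rw [eq_top_iff]
    intro v _
    have hi : Function.Injective (D p).subtypeL := Subtype.val_injective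
    set w := pullProj (g p) (D p).subtypeL v with hw
    refine Submodule.mem_sup.2 ⟨w, w.2, v - w, fun u hu => ?_, by abel⟩
    have h := pullProj_spec (hg.pos p) hi v ⟨u, hu⟩
    rw [map_sub, hg.symm p u, hg.symm p u, sub_eq_zero]
    exact h.symm

theorem orthoCompl_orthoCompl (hg : IsRiemannianForm g) (D : SubspaceField m M) :
    orthoCompl g (orthoCompl g D) = D := by
  funext p
  refine le_antisymm (fun v hv => ?_) fun v hv u hu => ?_
  · obtain ⟨x, hx, z, hz, rfl⟩ := Submodule.mem_sup.1
      ((isCompl_orthoCompl (D := D) hg p).sup_eq_top ▸ Submodule.mem_top : v ∈ _ ⊔ _)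
    have h1 := hv z hz
    rw [map_add, hg.symm p z x, hz x hx, zero_add] at h1
    have h2 : z = 0 := by
      by_contra hne
      exact (hg.pos p z hne).ne' h1
    rwa [h2, add_zero]
  · rw [hg.symm]; exact hu v hv

theorem exists_add_of_orthoCompl (hg : IsRiemannianForm g) (D : SubspaceField m M) (p : M)
    (v : TangentSpace (𝓡 m) p) : ∃ x ∈ D p, ∃ z ∈ orthoCompl g D p, x + z = v :=
  Submodule.mem_sup.1 ((isCompl_orthoCompl (D := D) hg p).sup_eq_top ▸ Submodule.mem_top)

/-- The vector with given components with respect to a family of vector fields. -/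
def frameMap {k : ℕ} (X : Fin k → ∀ q : M, TangentSpace (𝓡 m) q) (q : M) :
    Eu k →L[ℝ] TangentSpace (𝓡 m) q :=
  ∑ i, (EuclideanSpace.proj i : Eu k →L[ℝ] ℝ).smulRight (X i q)

theorem frameMap_apply {k : ℕ} (X : Fin k → ∀ q : M, TangentSpace (𝓡 m) q) (q : M) (a : Eu k) :
    frameMap X q a = ∑ i, a i • X i q := by
  simp [frameMap]

theorem frameMap_injective {k : ℕ} {X : Fin k → ∀ q : M, TangentSpace (𝓡 m) q} {q : M}
    (h : LinearIndependent ℝ fun i => X i q) : Function.Injective (frameMap X q) := by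
  rw [injective_iff_map_eq_zero]
  intro a ha
  rw [frameMap_apply] at ha
  ext i
  exact Fintype.linearIndependent_iff.1 h _ ha i

theorem range_frameMap {k : ℕ} (X : Fin k → ∀ q : M, TangentSpace (𝓡 m) q) (q : M)
    (v : TangentSpace (𝓡 m) q) :
    v ∈ Submodule.span ℝ (range fun i => X i q) ↔ ∃ a, frameMap X q a = v := by
  rw [Submodule.mem_span_range_iff_exists_fun]
  constructor
  · rintro ⟨c, rfl⟩
    exact ⟨WithLp.toLp 2 c, by rw [frameMap_apply]⟩
  · rintro ⟨a, rfl⟩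
    exact ⟨a, (frameMap_apply X q a).symm⟩

theorem smoothVFAt_frameMap {k : ℕ} {X : Fin k → ∀ q : M, TangentSpace (𝓡 m) q} {p : M}
    (hX : ∀ i, SmoothVFAt (X i) p) {a : M → Eu k} (ha : ContMDiffAt (𝓡 m) 𝓘(ℝ, Eu k) ∞ a p) :
    SmoothVFAt (fun q => frameMap X q (a q)) p := by
  have h1 : SmoothVFAt (fun q => ∑ i, a q i • X i q) p := by
    refine ContMDiffAt.sum_section (t := fun i q => a q i • X i q) fun i _ => ?_
    exact SmoothAlongAt.smul
      ((EuclideanSpace.proj i : Eu k →L[ℝ] ℝ).contMDiff.contMDiffAt.comp p ha) (hX i)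
  exact h1.congr (Eventually.of_forall fun q => frameMap_apply X q (a q))

/-- A distribution has smooth frames near every point. -/
theorem IsDistribution.exists_frame (hD : IsDistribution D) (p : M) :
    ∃ (k : ℕ) (U : Set M) (X : Fin k → ∀ q : M, TangentSpace (𝓡 m) q), IsOpen U ∧ p ∈ U ∧
      (∀ i, ∀ q ∈ U, SmoothVFAt (X i) q) ∧ ∀ q ∈ U, Function.Injective (frameMap X q) ∧
        ∀ v, v ∈ D q ↔ ∃ a, frameMap X q a = v := by
  obtain ⟨k, U, X, hU, hp, hX, h⟩ := hD p
  refine ⟨k, U, X, hU, hp, fun i q hq => (hX i).contMDiffAt (hU.mem_nhds hq), fun q hq =>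
    ⟨frameMap_injective (h q hq).1, fun v => ?_⟩⟩
  rw [← (h q hq).2, range_frameMap]

variable [T2Space M]

/-- Every vector of a distribution is the value of a section. -/
theorem IsDistribution.exists_section (hD : IsDistribution D) {p : M} {v : TangentSpace (𝓡 m) p}
    (hv : v ∈ D p) : ∃ X, IsSectionOf D X ∧ X p = v := by
  obtain ⟨k, U, X, hU, hp, hX, h⟩ := hD.exists_frame p
  obtain ⟨a, rfl⟩ := ((h p hp).2 v).1 hv
  obtain ⟨s, h1, h2, h3⟩ := exists_bump (m := m) p (hU.mem_nhds hp)
  refine ⟨fun q => s q • frameMap X q a, ⟨isSmoothVF_smul h1 fun q hq =>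
    smoothVFAt_frameMap (fun i => hX i q (h3 hq)) contMDiffAt_const, fun q => ?_⟩, ?_⟩
  · show s q • frameMap X q a ∈ D q
    by_cases hq : q ∈ U
    · exact (D q).smul_mem _ (((h q hq).2 _).2 ⟨a, rfl⟩)
    · rw [image_eq_zero_of_notMem_tsupport fun h' => hq (h3 h'), zero_smul]
      exact (D q).zero_mem
  · show s p • frameMap X p a = _
    rw [h2.self_of_nhds, one_smul]

/-- The orthogonal complement of a distribution is a distribution. -/
theorem IsDistribution.orthoCompl (hD : IsDistribution D) (hg : IsRiemannianForm g) :
    IsDistribution (orthoCompl g D) := by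
  intro p
  obtain ⟨k, U, X, hU, hp, hX, h⟩ := hD.exists_frame p
  let b := Module.finBasis ℝ (SemiSlant.orthoCompl g D p)
  have hext : ∀ i, ∃ Y : ∀ q : M, TangentSpace (𝓡 m) q, IsSmoothVF Y ∧ Y p = b i :=
    fun i => exists_isSmoothVF p _
  choose Y hY hYp using hext
  -- Extensions of a basis at `p`, made orthogonal to `D` by subtracting their projections; at `p`
  -- itself nothing is subtracted.
  let Z : Fin (Module.finrank ℝ (SemiSlant.orthoCompl g D p)) → ∀ q : M, TangentSpace (𝓡 m) q :=
    fun i q => Y i q - frameMap X q (pullProj (g q) (frameMap X q) (Y i q))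
  have hZ : ∀ i, ∀ q ∈ U, SmoothVFAt (Z i) q := fun i q hq =>
    SmoothAlongAt.sub (hY i q) (smoothVFAt_frameMap (fun i => hX i q hq)
      (contMDiffAt_pullProj (f := fun y : M => y) hg (fun e => smoothVFAt_frameMap
        (fun i => hX i q hq) contMDiffAt_const) (h q hq).1 (hY i q)))
  have hZD : ∀ i, ∀ q ∈ U, Z i q ∈ SemiSlant.orthoCompl g D q := by
    intro i q hq u hu
    obtain ⟨a, rfl⟩ := ((h q hq).2 u).1 hu
    rw [map_sub, hg.symm q _ (Y i q), hg.symm q (frameMap X q a), pullProj_spec (hg.pos q)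
      (h q hq).1, sub_self]
  have hZp : ∀ i, Z i p = b i := by
    intro i
    have h0 : pullProj (g p) (frameMap X p) (Y i p) = 0 := by
      refine pullProj_eq (hg.pos p) (h p hp).1 fun u => ?_
      rw [map_zero, map_zero, hYp, hg.symm]
      exact ((b i).2 _ (((h p hp).2 _).2 ⟨u, rfl⟩)).symm
    show Y i p - _ = _
    rw [h0, map_zero, sub_zero, hYp]
  have hlin : LinearIndependent ℝ fun i => Z i p := by
    have h1 := b.linearIndependent.map' (SemiSlant.orthoCompl g D p).subtype
      (Submodule.ker_subtype _)
    have h2 : (fun i => Z i p) = (SemiSlant.orthoCompl g D p).subtype ∘ b := funext hZp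
    rw [h2]
    exact h1
  have hev : ∀ᶠ q in 𝓝 p, LinearIndependent ℝ fun i => Z i q := by
    have h1 : ContinuousAt (fun q i => compAlong (fun y : M => y) (Z i) p q) p :=
      continuousAt_pi.2 fun i => (smoothAlongAt_iff.1 (hZ i p hp)).2.continuousAt
    have h2 : LinearIndependent ℝ fun i => compAlong (fun y : M => y) (Z i) p p := by
      have h3 := hlin.map' (toModel p).toLinearEquiv.toLinearMap (LinearEquiv.ker _)
      have h4 : (fun i => compAlong (fun y : M => y) (Z i) p p) =
          (toModel p).toLinearEquiv.toLinearMap ∘ fun i => Z i p :=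
        funext fun i => compAlong_self
      rw [h4]
      exact h3
    filter_upwards [h1.eventually (isOpen_setOfPred_linearIndependent.mem_nhds h2),
      (chartAt (Eu m) p).open_source.mem_nhds (mem_chart_source _ _)] with q hq1 hq2
    have h4 : (fun i => compAlong (fun y : M => y) (Z i) p q) =
        (coord p q).toLinearMap ∘ fun i => Z i q := by
      funext i
      exact trivializationAt_snd hq2 _
    have h5 : LinearIndependent ℝ fun i => compAlong (fun y : M => y) (Z i) p q := hq1
    rw [h4] at h5
    exact h5.of_comp _
  obtain ⟨O, hO1, hO2, hO3⟩ := eventually_nhds_iff.1 hev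
  refine ⟨_, U ∩ O, Z, hU.inter hO2, ⟨hp, hO3⟩, fun i q hq =>
    ContMDiffAt.contMDiffWithinAt (hZ i q hq.1), fun q hq => ⟨hO1 q hq.2, ?_⟩⟩
  refine Submodule.eq_of_le_of_finrank_eq (Submodule.span_le.2 ?_) ?_
  · rintro _ ⟨i, rfl⟩
    exact hZD i q hq.1
  -- The rank of `D` is constant on `U`, so that of the complement is too, and independent fields in
  -- the complement span it by counting.
  · have hk : ∀ q ∈ U, Module.finrank ℝ (D q) = k := by
      intro q hq
      have h1 : D q = LinearMap.range (frameMap X q).toLinearMap := by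
        ext v
        rw [(h q hq).2]; rfl
      rw [h1, LinearMap.finrank_range_of_inj (h q hq).1, finrank_euclideanSpace_fin]
    have hm : ∀ q : M, Module.finrank ℝ (TangentSpace (𝓡 m) q) = m := fun q =>
      finrank_euclideanSpace_fin (𝕜 := ℝ) (n := m)
    have h1 := Submodule.finrank_add_eq_of_isCompl (isCompl_orthoCompl (D := D) hg p)
    have h2 := Submodule.finrank_add_eq_of_isCompl (isCompl_orthoCompl (D := D) hg q)
    rw [hm, hk _ hp] at h1
    rw [hm, hk _ hq.1] at h2
    rw [finrank_span_eq_card (hO1 q hq.2), Fintype.card_fin]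
    omega

end Distributions

/-! ### The Levi-Civita connection and inverse charts -/

section LeviCivita

variable {d : ℕ} {N : Type*} [TopologicalSpace N] [ChartedSpace (Eu d) N] [IsManifold (𝓡 d) ∞ N]
  {g : FormField d N} {X Y Z : ∀ y : N, TangentSpace (𝓡 d) y} {x : N}

theorem mfderiv_id_apply (u : TangentSpace (𝓡 d) x) :
    mfderiv (𝓡 d) (𝓡 d) (fun y : N => y) x u = u :=
  congrArg (fun L : TangentSpace (𝓡 d) x →L[ℝ] TangentSpace (𝓡 d) x => L u) mfderiv_id

theorem leviCivita_sub (hg : IsRiemannianForm g) (hX : SmoothVFAt X x) (hY : SmoothVFAt Y x) :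
    leviCivita g Y x (X x) - leviCivita g X x (Y x) = VectorField.mlieBracket (𝓡 d) X Y x := by
  have h := covAlong_mfderiv_sub (f := fun y : N => y) hg contMDiffAt_id hX hY
  have h1 : ∀ W : ∀ y : N, TangentSpace (𝓡 d) y,
      (fun q => mfderiv (𝓡 d) (𝓡 d) (fun y : N => y) q (W q)) = W :=
    fun W => funext fun q => mfderiv_id_apply _
  rw [h1, h1, mfderiv_id_apply] at h
  exact h

theorem dirDeriv_metric (hg : IsRiemannianForm g) (hY : SmoothVFAt Y x) (hZ : SmoothVFAt Z x) :
    dirDeriv X (fun y => g y (Y y) (Z y)) x =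
      g x (leviCivita g Y x (X x)) (Z x) + g x (Y x) (leviCivita g Z x (X x)) :=
  derivAt_metric (f := fun y : N => y) hg hY hZ (X x)

theorem leviCivita_end {φ : ∀ x : N, TangentSpace (𝓡 d) x →L[ℝ] TangentSpace (𝓡 d) x}
    (hφ : ContMDiffAt (𝓡 d) 𝓘(ℝ, Eu d →L[ℝ] Eu d) ∞ (endCoeff φ x) x) (hY : SmoothVFAt Y x)
    (u : TangentSpace (𝓡 d) x) :
    leviCivita g (fun y => φ y (Y y)) x u = φ x (leviCivita g Y x u) + covEnd g φ x u (Y x) := by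
  have h := covAlong_end (f := fun y : N => y) (g := g) hφ hY u
  rw [mfderiv_id_apply] at h
  exact h

theorem hasMFDerivAt_extChartAt_symm {a : Eu d} (ha : a ∈ (extChartAt (𝓡 d) x).target) :
    HasMFDerivAt 𝓘(ℝ, Eu d) (𝓡 d) (extChartAt (𝓡 d) x).symm a
      (coordSymm x ((extChartAt (𝓡 d) x).symm a)) := by
  have hqs : (extChartAt (𝓡 d) x).symm a ∈ (chartAt (Eu d) x).source := by
    have := (extChartAt (𝓡 d) x).map_target ha
    rwa [extChartAt_source] at this
  have h3 := (mdifferentiableWithinAt_extChartAt_symm (I := 𝓡 d) ha).hasMFDerivWithinAt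
  rw [ModelWithCorners.range_eq_univ, hasMFDerivWithinAt_univ] at h3
  have h4 := TangentBundle.symmL_trivializationAt (I := 𝓡 d) hqs
  rw [(extChartAt (𝓡 d) x).right_inv ha, ModelWithCorners.range_eq_univ] at h4
  have h5 : coordSymm x ((extChartAt (𝓡 d) x).symm a) =
    mfderivWithin 𝓘(ℝ, Eu d) (𝓡 d) (extChartAt (𝓡 d) x).symm univ a := h4
  rw [h5]
  exact h3

theorem mfderiv_extChartAt_symm {a : Eu d} (ha : a ∈ (extChartAt (𝓡 d) x).target) (u : Eu d) :
    mfderiv (𝓡 d) (𝓡 d) (extChartAt (𝓡 d) x).symm a u =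
      coordSymm x ((extChartAt (𝓡 d) x).symm a) u :=
  congrArg (fun L : Eu d →L[ℝ] TangentSpace (𝓡 d) ((extChartAt (𝓡 d) x).symm a) => L u)
    (hasMFDerivAt_extChartAt_symm ha).mfderiv

theorem contMDiffAt_extChartAt_symm {a : Eu d} (ha : a ∈ (extChartAt (𝓡 d) x).target) :
    ContMDiffAt (𝓡 d) (𝓡 d) ∞ (extChartAt (𝓡 d) x).symm a :=
  (contMDiffOn_extChartAt_symm x).contMDiffAt ((isOpen_extChartAt_target x).mem_nhds ha)

theorem SmoothAlongAt.comp {m k : ℕ} {M : Type*} [TopologicalSpace M] [ChartedSpace (Eu m) M]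
    {P : Type*} [TopologicalSpace P] [ChartedSpace (Eu k) P] {f : M → N} {h : P → M}
    {V : ∀ q : M, TangentSpace (𝓡 d) (f q)} {a : P} (hV : SmoothAlongAt (m := m) f V (h a))
    (hh : ContMDiffAt (𝓡 k) (𝓡 m) ∞ h a) :
    SmoothAlongAt (m := k) (fun b => f (h b)) (fun b => V (h b)) a :=
  ContMDiffAt.comp a hV hh

end LeviCivita

/-! ### The tensors `∇φ` and `∇ξ` and their algebraic relations -/

namespace AlmostContactMetric

variable {n : ℕ} {N : Type*} [TopologicalSpace N] [ChartedSpace (Eu (2 * n + 1)) N]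
  [IsManifold (𝓡 (2 * n + 1)) ∞ N] (S : AlmostContactMetric n N)

theorem isRiemannianForm_g : IsRiemannianForm S.g := by
  refine .of_smooth S.metric.symm S.metric.pos fun x X Y hX hY => ?_
  have h : ContMDiffAt (𝓡 (2 * n + 1)) ((𝓡 (2 * n + 1)).prod 𝓘(ℝ)) ∞
      (fun y => TotalSpace.mk' ℝ (E := Bundle.Trivial N ℝ) y (S.metric.inner y (X y) (Y y))) x :=
    ContMDiffAt.clm_bundle_apply₂ (F₁ := Eu (2 * n + 1)) (F₂ := Eu (2 * n + 1))
      S.metric.contMDiff.contMDiffAt hX hY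
  simp only [contMDiffAt_totalSpace] at h
  exact h.2

theorem contMDiffAt_endCoeff (x : N) : ContMDiffAt (𝓡 (2 * n + 1))
    𝓘(ℝ, Eu (2 * n + 1) →L[ℝ] Eu (2 * n + 1)) ∞ (endCoeff S.φ x) x :=
  (contMDiffAt_hom_bundle _).1 (S.smooth_φ x) |>.2

/-- The almost contact metric structure on a tangent space. -/
def point (x : N) : ContactPoint (TangentSpace (𝓡 (2 * n + 1)) x) where
  g := LinearMap.mk₂ ℝ (fun u v => S.g x u v) (fun _ _ _ => ContinuousLinearMap.map_add₂ _ _ _ _)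
    (fun _ _ _ => ContinuousLinearMap.map_smul₂ _ _ _ _) (fun _ _ _ => map_add _ _ _)
    (fun _ _ _ => map_smul _ _ _)
  φ := S.φ x
  ξ := S.ξ x
  η := S.η x
  symm := S.metric.symm x
  pos := S.metric.pos x
  φ_φ := S.φ_φ x
  η_ξ := S.η_ξ x
  compat := S.compat x

variable {S}

theorem g_ξ (x : N) (u : TangentSpace (𝓡 (2 * n + 1)) x) : S.g x u (S.ξ x) = S.η x u :=
  (S.point x).g_ξ u

theorem φ_ξ (x : N) : S.φ x (S.ξ x) = 0 := (S.point x).φ_ξ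

theorem φ_skew (x : N) (u v : TangentSpace (𝓡 (2 * n + 1)) x) :
    S.g x (S.φ x u) v = - S.g x u (S.φ x v) := (S.point x).φ_skew u v

variable (S)

/-- The covariant derivative of `φ`. -/
def P (x : N) (u v : TangentSpace (𝓡 (2 * n + 1)) x) : TangentSpace (𝓡 (2 * n + 1)) x :=
  covEnd S.g S.φ x u v

/-- The covariant derivative of `ξ`. -/
def α (x : N) (u : TangentSpace (𝓡 (2 * n + 1)) x) : TangentSpace (𝓡 (2 * n + 1)) x :=
  leviCivita S.g S.ξ x u

variable {S} {X Y Z : ∀ y : N, TangentSpace (𝓡 (2 * n + 1)) y} {x : N}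

theorem leviCivita_φVF (hY : SmoothVFAt Y x) (u : TangentSpace (𝓡 (2 * n + 1)) x) :
    leviCivita S.g (S.φVF Y) x u = S.φ x (leviCivita S.g Y x u) + S.P x u (Y x) :=
  leviCivita_end (S.contMDiffAt_endCoeff x) hY u

theorem smoothVFAt_φVF (hY : SmoothVFAt Y x) : SmoothVFAt (S.φVF Y) x :=
  SmoothAlongAt.endApply (f := fun y : N => y) (S.contMDiffAt_endCoeff x) hY

theorem leviCivita_zero (u : TangentSpace (𝓡 (2 * n + 1)) x) :
    leviCivita S.g (fun _ => 0) x u = 0 := by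
  have h0 : SmoothVFAt (fun y : N => (0 : TangentSpace (𝓡 (2 * n + 1)) y)) x :=
    SmoothAlongAt.zero (f := fun y : N => y) contMDiffAt_id
  have h := covAlong_add (f := fun y : N => y) S.isRiemannianForm_g h0 h0 u
  simp only [add_zero] at h
  exact left_eq_add.1 h

/-- Derivative of `φξ = 0`. -/
theorem P_ξ (u : TangentSpace (𝓡 (2 * n + 1)) x) : S.P x u (S.ξ x) + S.φ x (S.α x u) = 0 := by
  have h := leviCivita_φVF (S := S) (S.smooth_ξ x) u
  have h0 : S.φVF S.ξ = fun _ => 0 := funext fun y => φ_ξ y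
  rw [h0, leviCivita_zero] at h
  exact (add_comm _ _).trans h.symm

/-- Derivative of `g(ξ, ξ) = 1`. -/
theorem η_α (u : TangentSpace (𝓡 (2 * n + 1)) x) : S.η x (S.α x u) = 0 := by
  obtain h := derivAt_metric (f := fun y : N => y) S.isRiemannianForm_g (S.smooth_ξ x)
    (S.smooth_ξ x) u
  have h1 : (fun y => S.g y (S.ξ y) (S.ξ y)) = fun _ => 1 :=
    funext fun y => (g_ξ y _).trans (S.η_ξ y)
  rw [h1, derivAt_const, S.isRiemannianForm_g.symm x (S.ξ x), g_ξ] at h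
  have h2 : (0 : ℝ) = S.η x (S.α x u) + S.η x (S.α x u) := h
  linarith

variable [T2Space N]

/-- Derivative of the skew-symmetry of `φ`, tested on fields extending the two vectors; the terms
that differentiate the fields cancel by skew-symmetry itself. -/
theorem P_skew (u v w : TangentSpace (𝓡 (2 * n + 1)) x) :
    S.g x (S.P x u v) w = - S.g x v (S.P x u w) := by
  obtain ⟨V, hV, rfl⟩ := exists_isSmoothVF x v
  obtain ⟨W, hW, rfl⟩ := exists_isSmoothVF x w
  have hg := S.isRiemannianForm_g
  have h1 := derivAt_metric (f := fun y : N => y) hg (smoothVFAt_φVF (S := S) (hV x)) (hW x) u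
  have h2 := derivAt_metric (f := fun y : N => y) hg (hV x) (smoothVFAt_φVF (S := S) (hW x)) u
  have h3 : (fun y => S.g y (S.φVF V y) (W y)) = fun y => - S.g y (V y) (S.φVF W y) :=
    funext fun y => φ_skew y _ _
  have h4 : derivAt (fun y => - S.g y (V y) (S.φVF W y)) x u =
      - derivAt (fun y => S.g y (V y) (S.φVF W y)) x u := by
    have hd : MDifferentiableAt (𝓡 (2 * n + 1)) 𝓘(ℝ, ℝ) (fun y => S.g y (V y) (S.φVF W y)) x :=
      (contMDiffAt_metric (f := fun y : N => y) hg (hV x)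
        (smoothVFAt_φVF (S := S) (hW x))).mdifferentiableAt (by simp)
    have h5 := derivAt_sub (mdifferentiableAt_const (c := (0 : ℝ))) hd u
    simpa [derivAt_const] using h5
  rw [h3, h4, h2] at h1
  have e1 : covAlong S.g (fun y : N => y) (S.φVF V) x u = _ := leviCivita_φVF (S := S) (hV x) u
  have e2 : covAlong S.g (fun y : N => y) (S.φVF W) x u = _ := leviCivita_φVF (S := S) (hW x) u
  rw [e1, e2, ContinuousLinearMap.map_add₂, map_add] at h1
  have e3 := φ_skew (S := S) x (leviCivita S.g V x u) (W x)
  have e4 := φ_skew (S := S) x (V x) (leviCivita S.g W x u)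
  have h1' : -(S.g x (leviCivita S.g V x u) (S.φ x (W x)) + (S.g x (V x) (S.φ x (leviCivita S.g W x u))
    + S.g x (V x) (S.P x u (W x)))) = S.g x (S.φ x (leviCivita S.g V x u)) (W x) +
    S.g x (S.P x u (V x)) (W x) + S.g x (S.φ x (V x)) (leviCivita S.g W x u) := h1
  linarith

/-- Derivative of `φ²V = -V + η(V)ξ`, with `η` written as `g(·, ξ)` so that `∇η` is expressed by
`∇ξ`. -/
theorem P_φ (u v : TangentSpace (𝓡 (2 * n + 1)) x) :
    S.P x u (S.φ x v) + S.φ x (S.P x u v) =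
      S.g x (S.α x u) v • S.ξ x + S.η x v • S.α x u := by
  obtain ⟨V, hV, rfl⟩ := exists_isSmoothVF x v
  have hg := S.isRiemannianForm_g
  have h1 := leviCivita_φVF (S := S) (smoothVFAt_φVF (S := S) (hV x)) u
  rw [leviCivita_φVF (hV x)] at h1
  have hη : ContMDiffAt (𝓡 (2 * n + 1)) 𝓘(ℝ, ℝ) ∞ (fun y => S.g y (V y) (S.ξ y)) x :=
    contMDiffAt_metric (f := fun y : N => y) hg (hV x) (S.smooth_ξ x)
  have hs : SmoothVFAt (fun y => S.g y (V y) (S.ξ y) • S.ξ y) x :=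
    SmoothAlongAt.smul (f := fun y : N => y) hη (S.smooth_ξ x)
  have h2 : S.φVF (S.φVF V) = fun y => S.g y (V y) (S.ξ y) • S.ξ y - V y := by
    funext y
    rw [g_ξ]
    show S.φ y (S.φ y (V y)) = _
    rw [S.φ_φ]
    abel
  have h3 : leviCivita S.g (S.φVF (S.φVF V)) x u =
      derivAt (fun y => S.g y (V y) (S.ξ y)) x u • S.ξ x + S.η x (V x) • S.α x u -
        leviCivita S.g V x u := by
    rw [h2, ← g_ξ]
    exact (covAlong_sub (f := fun y : N => y) hg hs (hV x) u).trans
      (congrArg (fun t => t - leviCivita S.g V x u)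
        (covAlong_smul (f := fun y : N => y) hg hη (S.smooth_ξ x) u))
  have h4 : derivAt (fun y => S.g y (V y) (S.ξ y)) x u =
    S.η x (leviCivita S.g V x u) + S.g x (S.α x u) (V x) := by
    rw [derivAt_metric (f := fun y : N => y) hg (hV x) (S.smooth_ξ x) u, g_ξ,
      hg.symm x (V x)]
    rfl
  rw [h3, h4, map_add, S.φ_φ, add_smul] at h1
  have h5 : S.P x u (S.φVF V x) = S.P x u (S.φ x (V x)) := rfl
  rw [h5] at h1
  have h6 := sub_eq_zero.2 h1
  rw [← sub_eq_zero, ← neg_eq_zero, ← h6]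
  abel

/-- The covariant derivatives of `φ` and `ξ` at a point. -/
def jet (S : AlmostContactMetric n N) (x : N) : ContactJet (TangentSpace (𝓡 (2 * n + 1)) x) where
  toContactPoint := S.point x
  P := LinearMap.mk₂ ℝ (S.P x) (fun u u' v => covEnd_add_left S.isRiemannianForm_g x u u' v)
    (fun c u v => covEnd_smul_left S.isRiemannianForm_g x c u v)
    (fun u v v' => covEnd_add_right S.isRiemannianForm_g x u v v')
    (fun c u v => covEnd_smul_right S.isRiemannianForm_g x c u v)
  α :=
    { toFun := S.α x
      map_add' := covAlong_add_left (f := fun y : N => y) S.isRiemannianForm_g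
      map_smul' := covAlong_smul_left (f := fun y : N => y) S.isRiemannianForm_g }
  P_skew := P_skew
  P_ξ := P_ξ
  η_α := η_α
  P_φ := P_φ

end AlmostContactMetric

/-! ### Exterior derivatives, normality and `∇φ` in the three classes -/

namespace AlmostContactMetric

variable {n : ℕ} {N : Type*} [TopologicalSpace N] [ChartedSpace (Eu (2 * n + 1)) N]
  [IsManifold (𝓡 (2 * n + 1)) ∞ N] {S : AlmostContactMetric n N}
  {X Y Z : ∀ y : N, TangentSpace (𝓡 (2 * n + 1)) y} {x : N}

theorem two_mul_dη (hX : SmoothVFAt X x) (hY : SmoothVFAt Y x) :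
    2 * S.dη X Y x = S.g x (S.α x (X x)) (Y x) - S.g x (S.α x (Y x)) (X x) := by
  have hg := S.isRiemannianForm_g
  have h1 : ∀ W : ∀ y : N, TangentSpace (𝓡 (2 * n + 1)) y,
      (fun y => S.η y (W y)) = fun y => S.g y (W y) (S.ξ y) := fun W => funext fun y => (g_ξ y _).symm
  unfold dη
  rw [h1, h1, dirDeriv_metric hg hY (S.smooth_ξ x), dirDeriv_metric hg hX (S.smooth_ξ x),
    ← leviCivita_sub hg hX hY, map_sub, g_ξ, g_ξ, hg.symm x (Y x), hg.symm x (X x)]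
  simp only [α]
  ring

/-- Brackets are replaced by covariant derivatives, after which every term that differentiates a
vector field cancels. As `φ` acts on the second slot of `Φ`, the arguments come out in the cyclic
order `X, Z, Y`. -/
theorem three_mul_dΦ (hX : SmoothVFAt X x) (hY : SmoothVFAt Y x) (hZ : SmoothVFAt Z x) :
    3 * S.dΦ X Y Z x = S.g x (S.P x (X x) (Z x)) (Y x) + S.g x (S.P x (Z x) (Y x)) (X x) +
      S.g x (S.P x (Y x) (X x)) (Z x) := by
  have hg := S.isRiemannianForm_g
  have h1 : ∀ U V W : ∀ y : N, TangentSpace (𝓡 (2 * n + 1)) y, SmoothVFAt V x → SmoothVFAt W x →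
      dirDeriv U (S.Φ V W) x = S.g x (leviCivita S.g V x (U x)) (S.φ x (W x)) -
        S.g x (leviCivita S.g W x (U x)) (S.φ x (V x)) + S.g x (S.P x (U x) (W x)) (V x) := by
    intro U V W hV hW
    have h2 := dirDeriv_metric (X := U) hg hV (smoothVFAt_φVF (S := S) hW)
    have h3 : dirDeriv U (S.Φ V W) x = _ := h2
    rw [h3, leviCivita_φVF hW, map_add, hg.symm x (V x) (S.P x (U x) (W x)),
      hg.symm x (V x) (S.φ x _), φ_skew]
    show S.g x (leviCivita S.g V x (U x)) (S.φ x (W x)) + _ = _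
    ring
  have h4 : ∀ U V W : ∀ y : N, TangentSpace (𝓡 (2 * n + 1)) y, SmoothVFAt U x → SmoothVFAt V x →
      S.Φ (VectorField.mlieBracket (𝓡 (2 * n + 1)) U V) W x =
        S.g x (leviCivita S.g V x (U x)) (S.φ x (W x)) -
          S.g x (leviCivita S.g U x (V x)) (S.φ x (W x)) := by
    intro U V W hU hV
    unfold Φ
    rw [← leviCivita_sub hg hU hV, ContinuousLinearMap.map_sub₂]
  unfold dΦ
  rw [h1 X Y Z hY hZ, h1 Y Z X hZ hX, h1 Z X Y hX hY, h4 X Y Z hX hY, h4 Y Z X hY hZ,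
    h4 Z X Y hZ hX]
  ring

/-- With each bracket written as a difference of covariant derivatives, the Leibniz rule for `φ`
leaves only `∇φ`: all terms containing `∇X` or `∇Y` cancel. -/
theorem nijenhuis_eq (hX : SmoothVFAt X x) (hY : SmoothVFAt Y x) :
    S.nijenhuis X Y x = S.P x (S.φ x (X x)) (Y x) - S.P x (S.φ x (Y x)) (X x) +
      S.φ x (S.P x (Y x) (X x)) - S.φ x (S.P x (X x) (Y x)) := by
  have hg := S.isRiemannianForm_g
  have hφX := smoothVFAt_φVF (S := S) hX
  have hφY := smoothVFAt_φVF (S := S) hY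
  unfold nijenhuis
  rw [← leviCivita_sub hg hX hY, ← leviCivita_sub hg hφX hφY, ← leviCivita_sub hg hφX hY,
    ← leviCivita_sub hg hX hφY, leviCivita_φVF hX, leviCivita_φVF hX, leviCivita_φVF hY,
    leviCivita_φVF hY]
  simp only [map_add, map_sub]
  show _ + (S.φ x (leviCivita S.g Y x (S.φ x (X x))) + S.P x (S.φ x (X x)) (Y x) -
    (S.φ x (leviCivita S.g X x (S.φ x (Y x))) + S.P x (S.φ x (Y x)) (X x))) -
    (S.φ x (leviCivita S.g Y x (S.φ x (X x))) - _) -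
    (_ - S.φ x (leviCivita S.g X x (S.φ x (Y x)))) = _
  abel

variable [T2Space N]

theorem isNormal_P (hS : S.IsNormal) (x : N) (u v : TangentSpace (𝓡 (2 * n + 1)) x) :
    S.P x (S.φ x u) v - S.P x (S.φ x v) u + S.φ x (S.P x v u) - S.φ x (S.P x u v) +
      (S.g x (S.α x u) v - S.g x (S.α x v) u) • S.ξ x = 0 := by
  obtain ⟨X, hX, rfl⟩ := exists_isSmoothVF x u
  obtain ⟨Y, hY, rfl⟩ := exists_isSmoothVF x v
  have h := hS X Y hX hY x
  rwa [nijenhuis_eq (hX x) (hY x), two_mul_dη (hX x) (hY x)] at h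

theorem IsCosymplectic.P_eq_zero (hS : S.IsCosymplectic) (x : N)
    (u v : TangentSpace (𝓡 (2 * n + 1)) x) : S.P x u v = 0 := by
  refine (S.jet x).cosymplectic_P (fun u v w => ?_) (isNormal_P hS.2 x) (fun u v => ?_) u v
  · obtain ⟨X, hX, rfl⟩ := exists_isSmoothVF x u
    obtain ⟨Y, hY, rfl⟩ := exists_isSmoothVF x v
    obtain ⟨Z, hZ, rfl⟩ := exists_isSmoothVF x w
    -- The last two arguments are exchanged to match the cyclic order in `three_mul_dΦ`.
    have h := three_mul_dΦ (S := S) (hX x) (hZ x) (hY x)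
    rw [hS.1.2 X Z Y hX hZ hY, mul_zero] at h
    exact h.symm
  · obtain ⟨X, hX, rfl⟩ := exists_isSmoothVF x u
    obtain ⟨Y, hY, rfl⟩ := exists_isSmoothVF x v
    have h := two_mul_dη (S := S) (hX x) (hY x)
    rw [hS.1.1 X Y hX hY, mul_zero] at h
    exact h.symm

theorem IsContactMetric.g_α (hS : S.IsContactMetric) (x : N)
    (u v : TangentSpace (𝓡 (2 * n + 1)) x) :
    S.g x (S.α x u) v - S.g x (S.α x v) u = 2 * S.g x u (S.φ x v) := by
  obtain ⟨X, hX, rfl⟩ := exists_isSmoothVF x u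
  obtain ⟨Y, hY, rfl⟩ := exists_isSmoothVF x v
  have h := two_mul_dη (S := S) (hX x) (hY x)
  rw [← hS X Y hX hY] at h
  exact h.symm

/-- The fundamental form of a contact metric manifold is exact, hence closed. -/
theorem IsContactMetric.cyclic (hS : S.IsContactMetric) (x : N)
    (u v w : TangentSpace (𝓡 (2 * n + 1)) x) :
    S.g x (S.P x u v) w + S.g x (S.P x v w) u + S.g x (S.P x w u) v = 0 := by
  have hg := S.isRiemannianForm_g
  let ψ : Eu (2 * n + 1) → N := (extChartAt (𝓡 (2 * n + 1)) x).symm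
  let a₀ : Eu (2 * n + 1) := extChartAt (𝓡 (2 * n + 1)) x x
  have ha₀ : ψ a₀ = x := extChartAt_to_inv x
  have hT : ∀ᶠ a in 𝓝 a₀, a ∈ (extChartAt (𝓡 (2 * n + 1)) x).target :=
    extChartAt_target_mem_nhds (I := 𝓡 (2 * n + 1)) x
  have hψ : ∀ᶠ a in 𝓝 a₀, ContMDiffAt (𝓡 (2 * n + 1)) (𝓡 (2 * n + 1)) ∞ ψ a :=
    hT.mono fun a ha => contMDiffAt_extChartAt_symm ha
  -- Coordinate fields of a chart commute, so no bracket terms enter and `d(dη) = 0` becomes the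
  -- symmetry of second derivatives of functions.
  let E : Eu (2 * n + 1) → ∀ a, TangentSpace (𝓡 (2 * n + 1)) (ψ a) :=
    fun c a => mfderiv (𝓡 (2 * n + 1)) (𝓡 (2 * n + 1)) ψ a (constVF c a)
  have hE : ∀ c, ∀ a, ContMDiffAt (𝓡 (2 * n + 1)) (𝓡 (2 * n + 1)) ∞ ψ a →
      SmoothAlongAt (m := 2 * n + 1) ψ (E c) a :=
    fun c a ha => SmoothVFAt.pushforward ha (smoothVF_constVF c a)
  have hsymm : ∀ b c a, ContMDiffAt (𝓡 (2 * n + 1)) (𝓡 (2 * n + 1)) ∞ ψ a →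
      covAlong S.g ψ (E c) a (constVF b a) = covAlong S.g ψ (E b) a (constVF c a) := by
    intro b c a ha
    have h := covAlong_mfderiv_sub hg ha (smoothVF_constVF b a) (smoothVF_constVF c a)
    rw [mlieBracket_constVF, map_zero, sub_eq_zero] at h
    exact h
  -- The components of `η` in the chart; the contact condition then reads `Φ_bc = ½(∂_b η_c - ∂_c
  -- η_b)`.
  let H : Eu (2 * n + 1) → Eu (2 * n + 1) → ℝ := fun c a => S.g (ψ a) (S.ξ (ψ a)) (E c a)
  have hξ : ∀ a, ContMDiffAt (𝓡 (2 * n + 1)) (𝓡 (2 * n + 1)) ∞ ψ a →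
      SmoothAlongAt (m := 2 * n + 1) ψ (fun a => S.ξ (ψ a)) a :=
    fun a ha => SmoothAlongAt.comp (f := fun y : N => y) (S.smooth_ξ (ψ a)) ha
  have hH : ∀ c a, ContMDiffAt (𝓡 (2 * n + 1)) (𝓡 (2 * n + 1)) ∞ ψ a → ContDiffAt ℝ ∞ (H c) a :=
    fun c a ha => (contMDiffAt_metric hg (hξ a ha) (hE c a ha)).contDiffAt
  have hΦ : ∀ b c, (fun a => S.g (ψ a) (E b a) (S.φ (ψ a) (E c a))) =ᶠ[𝓝 a₀]
      fun a => (1 / 2 : ℝ) * (fderiv ℝ (H c) a b - fderiv ℝ (H b) a c) := by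
    intro b c
    filter_upwards [hψ] with a ha
    have h1 : ∀ b c, fderiv ℝ (H c) a b = S.g (ψ a) (S.α (ψ a) (E b a)) (E c a) +
        S.g (ψ a) (S.ξ (ψ a)) (covAlong S.g ψ (E c) a (constVF b a)) := by
      intro b c
      have h2 := derivAt_metric hg (hξ a ha) (hE c a ha) (constVF b a)
      have h3 : covAlong S.g ψ (fun a => S.ξ (ψ a)) a (constVF b a) = S.α (ψ a) (E b a) :=
        covAlong_comp (f := fun y : N => y) (ha.mdifferentiableAt (by simp))
          (S.smooth_ξ (ψ a)) (constVF b a)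
      rw [h3] at h2
      exact (derivAt_model (H c) a b).symm.trans h2
    have h4 := hS.g_α (ψ a) (E b a) (E c a)
    rw [h1, h1, hsymm b c a ha]
    linarith
  have hψ₀ := hψ.self_of_nhds
  have hφE : ∀ c, SmoothAlongAt (m := 2 * n + 1) ψ (fun a => S.φ (ψ a) (E c a)) a₀ :=
    fun c => SmoothAlongAt.endApply (S.contMDiffAt_endCoeff (ψ a₀)) (hE c a₀ hψ₀)
  have hD : ∀ e b c, (1 / 2 : ℝ) * (fderiv ℝ (fderiv ℝ (H c)) a₀ e b -
      fderiv ℝ (fderiv ℝ (H b)) a₀ e c) =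
      S.g (ψ a₀) (covAlong S.g ψ (E b) a₀ (constVF e a₀)) (S.φ (ψ a₀) (E c a₀)) -
      S.g (ψ a₀) (covAlong S.g ψ (E c) a₀ (constVF e a₀)) (S.φ (ψ a₀) (E b a₀)) +
      S.g (ψ a₀) (S.P (ψ a₀) (E e a₀) (E c a₀)) (E b a₀) := by
    intro e b c
    have h1 := derivAt_metric hg (hE b a₀ hψ₀) (hφE c) (constVF e a₀)
    rw [covAlong_end (S.contMDiffAt_endCoeff (ψ a₀)) (hE c a₀ hψ₀), map_add,
      hg.symm (ψ a₀) (E b a₀), hg.symm (ψ a₀) (E b a₀), φ_skew] at h1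
    have h2 : ∀ c, HasFDerivAt (fderiv ℝ (H c)) (fderiv ℝ (fderiv ℝ (H c)) a₀) a₀ := fun c =>
      (((hH c a₀ hψ₀).fderiv_right (m := ∞) (by simp)).differentiableAt (by simp)).hasFDerivAt
    have h3 := (((h2 c).clm_apply (hasFDerivAt_const b a₀)).sub
      ((h2 b).clm_apply (hasFDerivAt_const c a₀))).const_mul (1 / 2 : ℝ)
    have h4 := derivAt_model (fun a => S.g (ψ a) (E b a) (S.φ (ψ a) (E c a))) a₀ e
    rw [(hΦ b c).fderiv_eq] at h4
    have h5 := congrArg (fun L => L e) h3.fderiv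
    have h6 := h4.symm.trans h1
    have h7 : (1 / 2 : ℝ) * (fderiv ℝ (fderiv ℝ (H c)) a₀ e b -
      fderiv ℝ (fderiv ℝ (H b)) a₀ e c) =
      fderiv ℝ (fun a => (1 / 2 : ℝ) * (fderiv ℝ (H c) a b - fderiv ℝ (H b) a c)) a₀ e := by
      refine Eq.trans ?_ h5.symm
      simp
    rw [h7, h6]
    simp only [P, E]
    ring
  have hsym2 : ∀ c e b, fderiv ℝ (fderiv ℝ (H c)) a₀ e b = fderiv ℝ (fderiv ℝ (H c)) a₀ b e :=
    fun c e b => ((hH c a₀ hψ₀).isSymmSndFDerivAt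
      (by rw [minSmoothness_of_isRCLikeNormedField]; exact ENat.LEInfty.out)) e b
  -- In the cyclic sum of `hD` the left sides cancel by equality of mixed partial derivatives, the
  -- connection terms by torsion-freeness.
  have key : ∀ e b c, S.g (ψ a₀) (S.P (ψ a₀) (E e a₀) (E c a₀)) (E b a₀) +
      S.g (ψ a₀) (S.P (ψ a₀) (E c a₀) (E b a₀)) (E e a₀) +
      S.g (ψ a₀) (S.P (ψ a₀) (E b a₀) (E e a₀)) (E c a₀) = 0 := by
    intro e b c
    have h1 := hD e b c
    have h2 := hD b c e
    have h3 := hD c e b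
    rw [hsymm b c a₀ hψ₀, hsymm b e a₀ hψ₀, hsym2 c b e, hsym2 e b c] at h2
    rw [hsymm c e a₀ hψ₀, hsym2 b c e] at h3
    linarith
  have hsurj : ∀ z : TangentSpace (𝓡 (2 * n + 1)) (ψ a₀), ∃ c, E c a₀ = z := by
    intro z
    have hs : ψ a₀ ∈ (chartAt (Eu (2 * n + 1)) x).source := by
      rw [ha₀]; exact mem_chart_source _ _
    exact ⟨coord x (ψ a₀) z, (mfderiv_extChartAt_symm hT.self_of_nhds _).trans
      (coordSymm_coord hs z)⟩
  have key2 : ∀ u v w : TangentSpace (𝓡 (2 * n + 1)) (ψ a₀), S.g (ψ a₀) (S.P (ψ a₀) u v) w +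
      S.g (ψ a₀) (S.P (ψ a₀) v w) u + S.g (ψ a₀) (S.P (ψ a₀) w u) v = 0 := by
    intro u v w
    obtain ⟨e, rfl⟩ := hsurj u
    obtain ⟨c, rfl⟩ := hsurj v
    obtain ⟨b, rfl⟩ := hsurj w
    exact key e b c
  rw [ha₀] at key2
  exact key2 u v w

theorem IsSasakian.P_eq (hS : S.IsSasakian) (x : N) (u v : TangentSpace (𝓡 (2 * n + 1)) x) :
    S.P x u v = S.g x u v • S.ξ x - S.η x v • u :=
  (S.jet x).sasakian_P (hS.1.cyclic x) (isNormal_P hS.2 x) (hS.1.g_α x) u v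

/-- Both sides are tensorial, so the defining identity for global fields can be evaluated on
extensions of the two vectors. -/
theorem IsKenmotsu.P_eq (hS : S.IsKenmotsu) (x : N) (u v : TangentSpace (𝓡 (2 * n + 1)) x) :
    S.P x u v = S.g x (S.φ x u) v • S.ξ x - S.η x v • S.φ x u := by
  obtain ⟨X, hX, rfl⟩ := exists_isSmoothVF x u
  obtain ⟨Y, hY, rfl⟩ := exists_isSmoothVF x v
  rw [← hS X Y hX hY x, leviCivita_φVF (hY x), add_sub_cancel_left]

theorem α_eq (u : TangentSpace (𝓡 (2 * n + 1)) x) : S.α x u = S.φ x (S.P x u (S.ξ x)) :=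
  (S.jet x).α_eq u

end AlmostContactMetric

/-! ### Second fundamental form of a distribution and its integrability -/

section Foliation

variable {m : ℕ} {M : Type*} [TopologicalSpace M] [ChartedSpace (Eu m) M]
  [IsManifold (𝓡 m) ∞ M] {g : FormField m M} {D : SubspaceField m M}

/-- The second fundamental form of the distribution `D` vanishes. -/
def IsTotallyGeodesic (g : FormField m M) (D : SubspaceField m M) : Prop :=
  ∀ X Y Z, IsSectionOf D X → IsSectionOf D Y → IsSectionOf (orthoCompl g D) Z →
    ∀ p, g p (leviCivita g Z p (X p)) (Y p) = 0

section AlongMap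

variable {k : ℕ} {P : Type*} [TopologicalSpace P] [ChartedSpace (Eu k) P] {h : P → M} {a : P}
  {V : ∀ b : P, TangentSpace (𝓡 m) (h b)}

/-- Differentiate `g(V, Z) = 0`. The right side depends only on the values of `V` and `u`, so the
component of `∇V` normal to `D` is tensorial. -/
theorem g_covAlong_orthogonal (hg : IsRiemannianForm g) {Z : ∀ q : M, TangentSpace (𝓡 m) q}
    (hZ : IsSectionOf (orthoCompl g D) Z) (hV : SmoothAlongAt (m := k) h V a)
    (hVD : ∀ᶠ b in 𝓝 a, V b ∈ D (h b)) (u : TangentSpace (𝓡 k) a) :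
    g (h a) (covAlong g h V a u) (Z (h a)) =
      - g (h a) (leviCivita g Z (h a) (mfderiv (𝓡 k) (𝓡 m) h a u)) (V a) := by
  have hZh : SmoothAlongAt (m := k) h (fun b => Z (h b)) a :=
    SmoothAlongAt.comp (f := fun y : M => y) (hZ.1 (h a)) hV.base
  have h1 := derivAt_metric hg hV hZh u
  have h2 : (fun b => g (h b) (V b) (Z (h b))) =ᶠ[𝓝 a] fun _ => 0 := by
    filter_upwards [hVD] with b hb using hZ.2 (h b) _ hb
  have h3 : covAlong g h (fun b => Z (h b)) a u =
      leviCivita g Z (h a) (mfderiv (𝓡 k) (𝓡 m) h a u) :=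
    covAlong_comp (f := fun y : M => y) hV.mdiff_base (hZ.1 (h a)) u
  rw [derivAt_congr h2, derivAt_const, h3, hg.symm (h a) (V a)] at h1
  have h4 : (0 : ℝ) = _ := h1
  linarith

variable [T2Space M]

/-- By tensoriality, the vectors can be replaced by values of global sections, to which the
hypothesis applies. The map `h` is arbitrary, which covers integral patches, charts and product
coordinates at once. -/
theorem IsTotallyGeodesic.covAlong_mem (hT : IsTotallyGeodesic g D) (hg : IsRiemannianForm g)
    (hD : IsDistribution D) (hV : SmoothAlongAt (m := k) h V a)
    (hVD : ∀ᶠ b in 𝓝 a, V b ∈ D (h b)) {u : TangentSpace (𝓡 k) a}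
    (hu : mfderiv (𝓡 k) (𝓡 m) h a u ∈ D (h a)) : covAlong g h V a u ∈ D (h a) := by
  rw [← orthoCompl_orthoCompl hg D]
  intro z hz
  obtain ⟨Z, hZ, rfl⟩ := (hD.orthoCompl hg).exists_section hz
  obtain ⟨X, hX, hXu⟩ := hD.exists_section hu
  obtain ⟨Y, hY, hYV⟩ := hD.exists_section hVD.self_of_nhds
  rw [hg.symm, g_covAlong_orthogonal hg hZ hV hVD, ← hXu, ← hYV, hT X Y Z hX hY hZ, neg_zero]

end AlongMap

variable [T2Space M]

/-- A distribution with an integral manifold through every point whose integral manifolds are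
totally geodesic has vanishing second fundamental form. -/
theorem DefinesTotallyGeodesicFoliation.isTotallyGeodesic (hg : IsRiemannianForm g)
    (h : DefinesTotallyGeodesicFoliation g D) : IsTotallyGeodesic g D := by
  intro X Y Z hX hY hZ p
  obtain ⟨k, Ω, ψ, hψ, a, ha, rfl⟩ := h.1 p
  have hs : ContMDiffAt (𝓡 k) (𝓡 m) ∞ ψ a := hψ.2.1.contMDiffAt (hψ.1.mem_nhds ha)
  obtain ⟨hinj, hmem⟩ := hψ.2.2 a ha
  obtain ⟨u, hu⟩ := (hmem _).1 (hX.2 (ψ a))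
  obtain ⟨w, hw⟩ := (hmem _).1 (hY.2 (ψ a))
  have h1 := h.2 k Ω ψ hψ (constVF w) (smoothVF_constVF w) a ha u
  set c := covAlong g ψ (fun q => mfderiv (𝓡 k) (𝓡 m) ψ q (constVF w q)) a u with hc
  have h2 : c = mfderiv (𝓡 k) (𝓡 m) ψ a (tanPart (m := k) g ψ a c) := sub_eq_zero.1 h1
  have h3 := g_covAlong_orthogonal (D := D) hg hZ
    (SmoothVFAt.pushforward hs (smoothVF_constVF w a)) (by
      filter_upwards [hψ.1.mem_nhds ha] with b hb
      exact ((hψ.2.2 b hb).2 _).2 ⟨_, rfl⟩) u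
  rw [← hc, h2, hZ.2 (ψ a) _ ((hmem _).2 ⟨_, rfl⟩), hu] at h3
  have h4 : mfderiv (𝓡 k) (𝓡 m) ψ a (constVF w a) = Y (ψ a) := hw
  rw [h4] at h3
  linarith

theorem IsTotallyGeodesic.secondFF_eq_zero (hT : IsTotallyGeodesic g D) (hg : IsRiemannianForm g)
    (hD : IsDistribution D) {k : ℕ} {Ω : Set (Eu k)} {ψ : Eu k → M}
    (hψ : IsIntegralPatch D Ω ψ) {Y : ∀ a : Eu k, TangentSpace (𝓡 k) a} (hY : IsSmoothVF Y)
    {a : Eu k} (ha : a ∈ Ω) (u : TangentSpace (𝓡 k) a) : secondFF g ψ Y a u = 0 := by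
  have hs : ContMDiffAt (𝓡 k) (𝓡 m) ∞ ψ a := hψ.2.1.contMDiffAt (hψ.1.mem_nhds ha)
  obtain ⟨hinj, hmem⟩ := hψ.2.2 a ha
  have h1 := hT.covAlong_mem hg hD (SmoothVFAt.pushforward hs (hY a)) (by
      filter_upwards [hψ.1.mem_nhds ha] with b hb
      exact ((hψ.2.2 b hb).2 _).2 ⟨_, rfl⟩) ((hmem _).2 ⟨u, rfl⟩)
  obtain ⟨w, hw⟩ := (hmem _).1 h1
  unfold secondFF norPart
  rw [← hw, tanPart_mfderiv hg hinj, sub_self]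

/-- Local first integrals of a distribution with vanishing second fundamental form. -/
theorem IsTotallyGeodesic.exists_first_integral (hT : IsTotallyGeodesic g D)
    (hg : IsRiemannianForm g) (hD : IsDistribution D) (p : M) :
    ∃ (l : ℕ) (O : Set (Eu m)) (y : Eu m → Eu l), Module.finrank ℝ (D p) + l = m ∧ IsOpen O ∧
      extChartAt (𝓡 m) p p ∈ O ∧ O ⊆ (extChartAt (𝓡 m) p).target ∧ ContDiffOn ℝ ∞ y O ∧
      ∀ a ∈ O, Function.Surjective (fderiv ℝ y a) ∧ ∀ v, fderiv ℝ y a v = 0 ↔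
        coordSymm p ((extChartAt (𝓡 m) p).symm a) v ∈ D ((extChartAt (𝓡 m) p).symm a) := by
  obtain ⟨k, U, X, hU, hp, hX, hXD⟩ := hD p
  let ψ : Eu m → M := (extChartAt (𝓡 m) p).symm
  have hψp : ψ (extChartAt (𝓡 m) p p) = p := extChartAt_to_inv p
  let O : Set (Eu m) := (extChartAt (𝓡 m) p).target ∩ ψ ⁻¹' U
  have hO : IsOpen O :=
    (continuousOn_extChartAt_symm p).isOpen_inter_preimage (isOpen_extChartAt_target p) hU
  have hsrc : ∀ a ∈ O, ψ a ∈ (chartAt (Eu m) p).source := fun a ha => by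
    have := (extChartAt (𝓡 m) p).map_target ha.1
    rwa [extChartAt_source] at this
  have hψs : ∀ a ∈ O, ContMDiffAt (𝓡 m) (𝓡 m) ∞ ψ a := fun a ha =>
    contMDiffAt_extChartAt_symm ha.1
  -- The distribution read in the chart, where the vector-space version of Frobenius' theorem
  -- applies.
  let D' : Eu m → Submodule ℝ (Eu m) := fun a =>
    (D (ψ a)).comap (coordSymm p (ψ a)).toLinearMap
  let X' : Fin k → Eu m → Eu m := fun i a => coord p (ψ a) (X i (ψ a))
  have hX' : ∀ i, ContDiffOn ℝ ∞ (X' i) O := by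
    intro i a ha
    have h1 := ((trivializationAt (Eu m) (TangentSpace (𝓡 m) : M → Type _)
      p).contMDiffOn_section_iff (IB := 𝓡 m) (hU.inter (chartAt (Eu m) p).open_source)
      inter_subset_right).1 ((hX i).mono inter_subset_left)
    have h2 := h1.contMDiffAt ((hU.inter (chartAt (Eu m) p).open_source).mem_nhds
      ⟨ha.2, hsrc a ha⟩)
    have h3 : ContMDiffAt (𝓡 m) 𝓘(ℝ, Eu m) ∞ (X' i) a := by
      refine ContMDiffAt.congr_of_eventuallyEq (h2.comp a (hψs a ha)) ?_
      filter_upwards [hO.mem_nhds ha] with b hb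
      exact (trivializationAt_snd (hsrc b hb) _).symm
    exact h3.contDiffAt.contDiffWithinAt
  have hfr : ∀ a ∈ O, LinearIndependent ℝ (fun i => X' i a) ∧
      Submodule.span ℝ (range fun i => X' i a) = D' a := by
    intro a ha
    have h0 : (fun i => X' i a) = (coord p (ψ a)).toLinearMap ∘ fun i => X i (ψ a) := rfl
    have hs := hsrc a ha
    rw [h0]
    refine ⟨(hXD _ ha.2).1.map' _ (LinearMap.ker_eq_bot.2 (coord_injective hs)), ?_⟩
    rw [range_comp, ← Submodule.map_span, (hXD _ ha.2).2]
    ext v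
    constructor
    · rintro ⟨w, hw, rfl⟩
      show coordSymm p (ψ a) (coord p (ψ a) w) ∈ D (ψ a)
      rw [coordSymm_coord hs]
      exact hw
    · intro hv
      exact ⟨coordSymm p (ψ a) v, hv, coord_coordSymm hs v⟩
  have hinv : ∀ a ∈ O, ∀ Y Z : Eu m → Eu m, ContDiffAt ℝ ∞ Y a → ContDiffAt ℝ ∞ Z a →
      (∀ᶠ b in 𝓝 a, Y b ∈ D' b) → (∀ᶠ b in 𝓝 a, Z b ∈ D' b) →
      fderiv ℝ Z a (Y a) - fderiv ℝ Y a (Z a) ∈ D' a := by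
    intro a ha Y Z hY hZ hYD hZD
    let VF : (Eu m → Eu m) → ∀ b : Eu m, TangentSpace (𝓡 m) b := fun W b => W b
    have hVF : ∀ W : Eu m → Eu m, ContDiffAt ℝ ∞ W a → SmoothVFAt (VF W) a := by
      intro W hW
      refine smoothAlongAt_iff.2 ⟨contMDiffAt_id, ?_⟩
      exact hW.contMDiffAt.congr_of_eventuallyEq
        (Eventually.of_forall fun b => compAlong_id_model _ _ _)
    have hcomp : ∀ W : Eu m → Eu m, compAlong (fun b : Eu m => b) (VF W) a = W := fun W =>
      funext fun b => compAlong_id_model _ _ _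
    have hbr : VectorField.mlieBracket (𝓡 m) (VF Y) (VF Z) a =
        VF (fun _ => fderiv ℝ Z a (Y a) - fderiv ℝ Y a (Z a)) a := by
      rw [mlieBracket_eq (hVF Y hY) (hVF Z hZ), hcomp, hcomp]
      show (toModel a).symm (derivAt Z a (Y a) - derivAt Y a (Z a)) = _
      rw [derivAt_model, derivAt_model]
      rfl
    have hd : ∀ b ∈ O, ∀ w : Eu m, mfderiv (𝓡 m) (𝓡 m) ψ b w = coordSymm p (ψ b) w :=
      fun b hb w => mfderiv_extChartAt_symm hb.1 w
    have hmem : ∀ W : Eu m → Eu m, (∀ᶠ b in 𝓝 a, W b ∈ D' b) →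
        ∀ᶠ b in 𝓝 a, mfderiv (𝓡 m) (𝓡 m) ψ b (VF W b) ∈ D (ψ b) := by
      intro W hW
      filter_upwards [hW, hO.mem_nhds ha] with b hb hbO
      rw [hd b hbO]
      exact hb
    -- Involutivity: the bracket is `∇_Y Z - ∇_Z Y`, and both terms lie in `D`.
    have h1 := covAlong_mfderiv_sub hg (hψs a ha) (hVF Y hY) (hVF Z hZ)
    have h2 := hT.covAlong_mem hg hD (SmoothVFAt.pushforward (hψs a ha) (hVF Z hZ)) (hmem Z hZD)
      (hmem Y hYD).self_of_nhds
    have h3 := hT.covAlong_mem hg hD (SmoothVFAt.pushforward (hψs a ha) (hVF Y hY)) (hmem Y hYD)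
      (hmem Z hZD).self_of_nhds
    have h4 := (D (ψ a)).sub_mem h2 h3
    rw [h1, hbr] at h4
    have h5 := hd a ha (fderiv ℝ Z a (Y a) - fderiv ℝ Y a (Z a))
    show coordSymm p (ψ a) _ ∈ D (ψ a)
    rw [← h5]
    exact h4
  have ha₀ : extChartAt (𝓡 m) p p ∈ O :=
    ⟨mem_extChartAt_target p, by show ψ _ ∈ U; rw [hψp]; exact hp⟩
  obtain ⟨l, O', y, hkl, hO', haO', hO'O, hy, hyD⟩ :=
    SemiSlant.exists_first_integral hO ha₀ D' X' hX' hfr hinv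
  refine ⟨l, O', y, ?_, hO', haO', fun a ha => (hO'O ha).1, hy, hyD⟩
  have hk : Module.finrank ℝ (D p) = k := by
    rw [← (hXD p hp).2, finrank_span_eq_card (hXD p hp).1, Fintype.card_fin]
  rw [hk, hkl, finrank_euclideanSpace_fin]

end Foliation

/-! ### Charts adapted to a foliation -/

section AdaptedChart

variable {m : ℕ} {M : Type*} [TopologicalSpace M] [ChartedSpace (Eu m) M]
  [IsManifold (𝓡 m) ∞ M] {g : FormField m M} {D : SubspaceField m M}

/-- Inverse function theorem for functions on a coordinate neighbourhood. -/
theorem exists_parametrization {F : Type} [NormedAddCommGroup F] [NormedSpace ℝ F]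
    [FiniteDimensional ℝ F] {p : M} {O : Set (Eu m)} (hO : IsOpen O)
    (hOt : O ⊆ (extChartAt (𝓡 m) p).target) (ha₀ : extChartAt (𝓡 m) p p ∈ O)
    {h : Eu m → F} (hh : ContDiffOn ℝ ∞ h O) (h' : Eu m ≃L[ℝ] F)
    (hh' : HasFDerivAt h (h' : Eu m →L[ℝ] F) (extChartAt (𝓡 m) p p)) :
    ∃ Ψ : OpenPartialHomeomorph F M, p ∈ Ψ.target ∧
      ContMDiffOn 𝓘(ℝ, F) (𝓡 m) ∞ Ψ Ψ.source ∧ ContMDiffOn (𝓡 m) 𝓘(ℝ, F) ∞ Ψ.symm Ψ.target ∧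
      ∀ x ∈ Ψ.source, Function.Injective (mfderiv 𝓘(ℝ, F) (𝓡 m) Ψ x) ∧
        (∀ v, ∃ w : F, mfderiv 𝓘(ℝ, F) (𝓡 m) Ψ x w = v) ∧
        ∃ a ∈ O, (extChartAt (𝓡 m) p).symm a = Ψ x ∧ ∀ w : F, ∃ v : Eu m,
          fderiv ℝ h a v = w ∧
          coordSymm p ((extChartAt (𝓡 m) p).symm a) v =
            (mfderiv 𝓘(ℝ, F) (𝓡 m) Ψ x w : TangentSpace (𝓡 m) (Ψ x)) := by
  obtain ⟨e, hae, heO, heh, hes, hei⟩ := exists_smooth_openPartialHomeomorph hO hh ha₀ h' hh'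
  let ψ : Eu m → M := (extChartAt (𝓡 m) p).symm
  let c := chartAt (Eu m) p
  have hψc : ∀ a, c.symm a = ψ a := fun a => rfl
  have hct : O ⊆ c.target := fun a ha => by
    have := hOt ha
    rwa [extChartAt_target, ModelWithCorners.range_eq_univ, inter_univ] at this
  -- The functions `h` become the coordinates: `Ψ` inverts `h` and then applies the inverse chart.
  let Ψ : OpenPartialHomeomorph F M := e.symm.trans c.symm
  have hΨ : ∀ x, Ψ x = ψ (e.symm x) := fun x => rfl
  have hsrc : ∀ x ∈ Ψ.source, x ∈ e.target := fun x hx => by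
    rw [OpenPartialHomeomorph.trans_source] at hx
    exact hx.1
  have hO' : ∀ x ∈ Ψ.source, e.symm x ∈ O := fun x hx => heO (e.map_target (hsrc x hx))
  have hder : ∀ x ∈ Ψ.source, ∃ A : Eu m ≃L[ℝ] F, fderiv ℝ h (e.symm x) = A ∧
      HasMFDerivAt 𝓘(ℝ, F) (𝓡 m) Ψ x
        ((coordSymm p (ψ (e.symm x))).comp (A.symm : F →L[ℝ] Eu m)) := by
    intro x hx
    obtain ⟨A, hA⟩ := hei _ (e.map_target (hsrc x hx))
    refine ⟨A, hA.symm, ?_⟩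
    have h1 : HasFDerivAt h (A : Eu m →L[ℝ] F) (e.symm x) := by
      rw [hA]
      exact ((hh.contDiffAt (hO.mem_nhds (hO' x hx))).differentiableAt (by simp)).hasFDerivAt
    have h2 : HasFDerivAt e (A : Eu m →L[ℝ] F) (e.symm x) :=
      h1.congr_of_eventuallyEq (Eventually.of_forall heh)
    have h3 := e.hasFDerivAt_symm (hsrc x hx) h2
    exact (hasMFDerivAt_extChartAt_symm (hOt (hO' x hx))).comp x h3.hasMFDerivAt
  refine ⟨Ψ, ?_, ?_, ?_, fun x hx => ?_⟩
  · rw [OpenPartialHomeomorph.trans_target]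
    refine ⟨mem_chart_source (Eu m) p, ?_⟩
    exact hae
  · intro x hx
    exact ((contMDiffAt_extChartAt_symm (hOt (hO' x hx))).comp x
      ((hes.contDiffAt (e.open_target.mem_nhds (hsrc x hx))).contMDiffAt)).contMDiffWithinAt
  · intro q hq
    rw [OpenPartialHomeomorph.trans_target] at hq
    have h1 : c q ∈ e.source := hq.2
    have h2 : ContMDiffAt (𝓡 m) 𝓘(ℝ, Eu m) ∞ c q := contMDiffAt_extChartAt' (I := 𝓡 m) hq.1
    have h3 : ContDiffAt ℝ ∞ h (c q) := hh.contDiffAt (hO.mem_nhds (heO h1))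
    refine ContMDiffAt.contMDiffWithinAt ?_
    refine (h3.contMDiffAt.comp q h2).congr_of_eventuallyEq (Eventually.of_forall fun y => ?_)
    exact heh (c y)
  · obtain ⟨A, hA, hd⟩ := hder x hx
    have hs : ψ (e.symm x) ∈ (chartAt (Eu m) p).source := by
      have := (extChartAt (𝓡 m) p).map_target (hOt (hO' x hx))
      rwa [extChartAt_source] at this
    have hm : ∀ w : F, (mfderiv 𝓘(ℝ, F) (𝓡 m) Ψ x w : TangentSpace (𝓡 m) (Ψ x)) =
        coordSymm p (ψ (e.symm x)) (A.symm w) := fun w =>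
      congrArg (fun L : F →L[ℝ] TangentSpace (𝓡 m) (Ψ x) => L w) hd.mfderiv
    refine ⟨fun w w' hw => ?_, fun v => ⟨A (coord p (ψ (e.symm x)) v), ?_⟩, e.symm x, hO' x hx, rfl,
      fun w => ⟨A.symm w, ?_, (hm w).symm⟩⟩
    · have h1 := ((hm w).symm.trans hw).trans (hm w')
      exact A.symm.injective (coordSymm_injective hs h1)
    · rw [hm, ContinuousLinearEquiv.symm_apply_apply]
      exact coordSymm_coord hs v
    · rw [hA]
      exact A.apply_symm_apply w

/-- Coordinates in which the integral manifolds of `D` are coordinate planes. -/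
theorem isIntegralPatch_slice {F G : Type} [NormedAddCommGroup F] [NormedSpace ℝ F]
    [NormedAddCommGroup G] [NormedSpace ℝ G] {Ψ : OpenPartialHomeomorph F M} {k : ℕ}
    (hΨ : ContMDiffOn 𝓘(ℝ, F) (𝓡 m) ∞ Ψ Ψ.source)
    (hinj : ∀ x ∈ Ψ.source, Function.Injective (mfderiv 𝓘(ℝ, F) (𝓡 m) Ψ x))
    (hsurj : ∀ x ∈ Ψ.source, ∀ v, ∃ w : F, mfderiv 𝓘(ℝ, F) (𝓡 m) Ψ x w = v)
    (pr : F →L[ℝ] G) (hD : ∀ x ∈ Ψ.source, ∀ w : F,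
      (mfderiv 𝓘(ℝ, F) (𝓡 m) Ψ x w : TangentSpace (𝓡 m) (Ψ x)) ∈ D (Ψ x) ↔ pr w = 0)
    {i : Eu k → F} (i' : Eu k →L[ℝ] F) (hi : ∀ s, HasFDerivAt i i' s) (hic : ContDiff ℝ ∞ i)
    (hi' : Function.Injective i') (hpr : ∀ w, pr w = 0 ↔ ∃ s, i' s = w)
    {Ω : Set (Eu k)} (hΩ : IsOpen Ω) (hΩs : ∀ s ∈ Ω, i s ∈ Ψ.source) :
    IsIntegralPatch D Ω (fun s => Ψ (i s)) ∧ ∀ s ∈ Ω, ∀ u : Eu k,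
      mfderiv (𝓡 k) (𝓡 m) (fun s => Ψ (i s)) s u = mfderiv 𝓘(ℝ, F) (𝓡 m) Ψ (i s) (i' u) := by
  have hd : ∀ s ∈ Ω, ∀ u : Eu k, mfderiv (𝓡 k) (𝓡 m) (fun s => Ψ (i s)) s u =
      mfderiv 𝓘(ℝ, F) (𝓡 m) Ψ (i s) (i' u) := by
    intro s hs u
    have h1 := ((hΨ.contMDiffAt (Ψ.open_source.mem_nhds (hΩs s hs))).mdifferentiableAt
      (by simp)).hasMFDerivAt
    have h2 := h1.comp s (hi s).hasMFDerivAt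
    exact congrArg (fun L : Eu k →L[ℝ] TangentSpace (𝓡 m) (Ψ (i s)) => L u) h2.mfderiv
  refine ⟨⟨hΩ, fun s hs => ?_, fun s hs => ⟨fun u u' h => ?_, fun v => ?_⟩⟩, hd⟩
  · exact ((hΨ.contMDiffAt (Ψ.open_source.mem_nhds (hΩs s hs))).comp s
      hic.contMDiff.contMDiffAt).contMDiffWithinAt
  · have h1 := (hd s hs u).symm.trans (h.trans (hd s hs u'))
    exact hi' (hinj _ (hΩs s hs) h1)
  · constructor
    · intro hv
      obtain ⟨w, rfl⟩ := hsurj _ (hΩs s hs) v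
      obtain ⟨u, rfl⟩ := (hpr w).1 ((hD _ (hΩs s hs) w).1 hv)
      exact ⟨u, hd s hs u⟩
    · rintro ⟨u, rfl⟩
      have h1 : (mfderiv 𝓘(ℝ, F) (𝓡 m) Ψ (i s) (i' u) : TangentSpace (𝓡 m) (Ψ (i s))) ∈
        D (Ψ (i s)) := (hD _ (hΩs s hs) _).2 ((hpr _).2 ⟨u, rfl⟩)
      rw [← hd s hs u] at h1
      exact h1

/-- A projection onto the kernel of `L` supplies the missing coordinates. -/
theorem exists_equiv_prod_of_surjective {V : Type*} [NormedAddCommGroup V] [NormedSpace ℝ V]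
    [FiniteDimensional ℝ V] {k l : ℕ} (L : V →L[ℝ] Eu l) (hL : Function.Surjective L)
    (hk : k + l = Module.finrank ℝ V) :
    ∃ (A : V →L[ℝ] Eu k) (e : V ≃L[ℝ] Eu k × Eu l), (e : V →L[ℝ] Eu k × Eu l) = A.prod L := by
  obtain ⟨K, hK⟩ := Submodule.exists_isCompl (LinearMap.ker L.toLinearMap)
  have h1 : Module.finrank ℝ (LinearMap.ker L.toLinearMap) = k := by
    have h2 := LinearMap.finrank_range_add_finrank_ker L.toLinearMap
    rw [LinearMap.range_eq_top.2 hL, finrank_top, finrank_euclideanSpace_fin] at h2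
    omega
  have e₁ : LinearMap.ker L.toLinearMap ≃ₗ[ℝ] Eu k :=
    LinearEquiv.ofFinrankEq _ _ (by rw [h1, finrank_euclideanSpace_fin])
  let A : V →ₗ[ℝ] Eu k := e₁.toLinearMap ∘ₗ Submodule.projectionOnto _ K hK
  have hA : Function.Surjective A :=
    e₁.surjective.comp (LinearMap.range_eq_top.1 (Submodule.range_projectionOnto hK))
  have hAK : LinearMap.ker A = K := by
    rw [LinearEquiv.ker_comp, Submodule.ker_projectionOnto]
  let e := LinearMap.equivProdOfSurjectiveOfIsCompl A L.toLinearMap (LinearMap.range_eq_top.2 hA)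
    (LinearMap.range_eq_top.2 hL) (by rw [hAK]; exact hK.symm)
  exact ⟨LinearMap.toContinuousLinearMap A, e.toContinuousLinearEquiv, by ext <;> rfl⟩

variable [T2Space M]

/-- The leaf through `p` is a level set of the first integral; completing the first integral to
coordinates parametrizes that level set by a coordinate plane. -/
theorem IsTotallyGeodesic.exists_patch (hT : IsTotallyGeodesic g D) (hg : IsRiemannianForm g)
    (hD : IsDistribution D) (p : M) : ∃ (k : ℕ) (Ω : Set (Eu k)) (ψ : Eu k → M),
      IsIntegralPatch D Ω ψ ∧ ∃ a ∈ Ω, ψ a = p := by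
  obtain ⟨l, O, y, hkl, hO, ha₀, hOt, hy, hyD⟩ := hT.exists_first_integral hg hD p
  generalize Module.finrank ℝ (D p) = k at hkl
  let a₀ : Eu m := extChartAt (𝓡 m) p p
  obtain ⟨A, e, he⟩ := exists_equiv_prod_of_surjective (k := k) (fderiv ℝ y a₀) (hyD a₀ ha₀).1
    (by rw [hkl, finrank_euclideanSpace_fin])
  have hyd : ∀ a ∈ O, HasFDerivAt y (fderiv ℝ y a) a := fun a ha =>
    ((hy.contDiffAt (hO.mem_nhds ha)).differentiableAt (by simp)).hasFDerivAt
  have hhd : ∀ a ∈ O, HasFDerivAt (fun a => (A a, y a)) (A.prod (fderiv ℝ y a)) a := fun a ha =>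
    A.hasFDerivAt.prodMk (hyd a ha)
  obtain ⟨Ψ, hp, hΨ, -, hx⟩ := exists_parametrization hO hOt ha₀
    (A.contDiff.contDiffOn.prodMk hy) e (by rw [he]; exact hhd a₀ ha₀)
  obtain ⟨x₀, hx₀, rfl⟩ : ∃ x₀ ∈ Ψ.source, Ψ x₀ = p :=
    ⟨Ψ.symm p, Ψ.map_target hp, Ψ.right_inv hp⟩
  let i : Eu k → Eu k × Eu l := fun s => (s, x₀.2)
  have hic : ContDiff ℝ ∞ i := contDiff_id.prodMk contDiff_const
  have hi : ∀ s, HasFDerivAt i (ContinuousLinearMap.inl ℝ (Eu k) (Eu l)) s := fun s =>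
    (hasFDerivAt_id s).prodMk (hasFDerivAt_const _ s)
  have key := isIntegralPatch_slice (D := D) hΨ (fun x h => (hx x h).1) (fun x h => (hx x h).2.1)
    (ContinuousLinearMap.snd ℝ (Eu k) (Eu l)) (fun x h w => ?_) (i := i)
    (ContinuousLinearMap.inl ℝ (Eu k) (Eu l)) hi hic (fun a b h => congrArg Prod.fst h)
    (fun w => ⟨fun h => ⟨w.1, Prod.ext rfl h.symm⟩, fun ⟨s, h⟩ => by rw [← h]; rfl⟩)
    (Ψ.open_source.preimage hic.continuous) (fun s hs => hs)
  · exact ⟨k, _, _, key.1, x₀.1, hx₀, rfl⟩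
  · obtain ⟨a, ha, hae, hw⟩ := (hx x h).2.2
    obtain ⟨v, hv1, hv2⟩ := hw w
    rw [(hhd a ha).fderiv] at hv1
    rw [← hv2, ← hae, ← (hyD a ha).2 v, ← hv1]
    rfl

/-- A distribution defines a totally geodesic foliation if and only if its second fundamental form
vanishes. -/
theorem definesTotallyGeodesicFoliation_iff (hg : IsRiemannianForm g) (hD : IsDistribution D) :
    DefinesTotallyGeodesicFoliation g D ↔ IsTotallyGeodesic g D :=
  ⟨fun h => h.isTotallyGeodesic hg, fun h => ⟨h.exists_patch hg hD,
    fun _ _ _ hψ _ hY _ ha u => h.secondFF_eq_zero hg hD hψ hY ha u⟩⟩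

end AdaptedChart

/-! ### Local Riemannian products -/

section Product

variable {m : ℕ} {M : Type*} [TopologicalSpace M] [ChartedSpace (Eu m) M]
  [IsManifold (𝓡 m) ∞ M] {g : FormField m M} {D : SubspaceField m M}

/-- The coordinate vector fields along a parametrization. -/
def coordField {k : ℕ} (h : Eu k → M) (u b : Eu k) : TangentSpace (𝓡 m) (h b) :=
  mfderiv (𝓡 k) (𝓡 m) h b (constVF u b)

section

variable {k : ℕ} {h : Eu k → M} {c : Eu k}

theorem smoothAlongAt_coordField (hh : ContMDiffAt (𝓡 k) (𝓡 m) ∞ h c) (u : Eu k) :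
    SmoothAlongAt (m := k) h (coordField (m := m) h u) c :=
  SmoothVFAt.pushforward hh (smoothVF_constVF u c)

theorem covAlong_coordField_symm (hg : IsRiemannianForm g) (hh : ContMDiffAt (𝓡 k) (𝓡 m) ∞ h c)
    (u v : Eu k) : covAlong g h (coordField (m := m) h v) c (constVF u c) =
      covAlong g h (coordField (m := m) h u) c (constVF v c) := by
  have h1 := covAlong_mfderiv_sub hg hh (smoothVF_constVF u c) (smoothVF_constVF v c)
  rw [mlieBracket_constVF, map_zero, sub_eq_zero] at h1
  exact h1

theorem g_covAlong_of_orthogonal (hg : IsRiemannianForm g) (hh : ContMDiffAt (𝓡 k) (𝓡 m) ∞ h c)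
    {u v w : Eu k}
    (hvw : ∀ᶠ b in 𝓝 c, g (h b) (coordField (m := m) h v b) (coordField (m := m) h w b) = 0) :
    g (h c) (covAlong g h (coordField (m := m) h v) c (constVF u c)) (coordField (m := m) h w c) =
      - g (h c) (covAlong g h (coordField (m := m) h w) c (constVF u c))
        (coordField (m := m) h v c) := by
  have h1 := derivAt_metric hg (smoothAlongAt_coordField hh v) (smoothAlongAt_coordField hh w)
    (constVF u c)
  have h2 : (fun b => g (h b) (coordField (m := m) h v b) (coordField (m := m) h w b)) =ᶠ[𝓝 c]
    fun _ => 0 := hvw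
  rw [derivAt_congr h2, derivAt_const, hg.symm (h c) (coordField h v c)] at h1
  have h3 : (0 : ℝ) = _ := h1
  linarith

/-- A special case of the Koszul formula. -/
theorem g_covAlong_eq_zero (hg : IsRiemannianForm g) (hh : ContMDiffAt (𝓡 k) (𝓡 m) ∞ h c)
    {u v w : Eu k}
    (huw : ∀ᶠ b in 𝓝 c, g (h b) (coordField (m := m) h u b) (coordField (m := m) h w b) = 0)
    (hvw : ∀ᶠ b in 𝓝 c, g (h b) (coordField (m := m) h v b) (coordField (m := m) h w b) = 0)
    (huv : fderiv ℝ (fun b => g (h b) (coordField (m := m) h u b) (coordField (m := m) h v b))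
      c w = 0) :
    g (h c) (covAlong g h (coordField (m := m) h v) c (constVF u c))
      (coordField (m := m) h w c) = 0 := by
  have h1 := derivAt_metric hg (smoothAlongAt_coordField hh u) (smoothAlongAt_coordField hh v)
    (constVF w c)
  have h2 : (0 : ℝ) = _ := huv.symm.trans ((derivAt_model _ c w).symm.trans h1)
  have h3 := g_covAlong_of_orthogonal (u := u) hg hh hvw
  have h4 := g_covAlong_of_orthogonal (u := v) hg hh huw
  rw [covAlong_coordField_symm hg hh w u, covAlong_coordField_symm hg hh w v,
    hg.symm (h c) (coordField h u c)] at h2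
  rw [covAlong_coordField_symm hg hh v u] at h4
  linarith

variable [T2Space M]

/-- Coordinate fields commute, so `∂_w g(∂_u, ∂_v)` is `g(∇_u ∂_w, ∂_v) + g(∂_u, ∇_v ∂_w)`. Both
terms are normal components of derivatives of sections of `D` along `D`, hence zero. The `D`-block
of the metric is therefore constant in the transverse directions. -/
theorem IsTotallyGeodesic.fderiv_eq_zero (hT : IsTotallyGeodesic g D) (hg : IsRiemannianForm g)
    (hD : IsDistribution D) (hh : ContMDiffAt (𝓡 k) (𝓡 m) ∞ h c) {u v w : Eu k}
    (hu : ∀ᶠ b in 𝓝 c, coordField (m := m) h u b ∈ D (h b))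
    (hv : ∀ᶠ b in 𝓝 c, coordField (m := m) h v b ∈ D (h b))
    (hw : ∀ᶠ b in 𝓝 c, coordField (m := m) h w b ∈ orthoCompl g D (h b)) :
    fderiv ℝ (fun b => g (h b) (coordField (m := m) h u b) (coordField (m := m) h v b)) c w = 0 := by
  have h1 := derivAt_metric hg (smoothAlongAt_coordField hh u) (smoothAlongAt_coordField hh v)
    (constVF w c)
  have hor : ∀ v : Eu k, (∀ᶠ b in 𝓝 c, coordField (m := m) h v b ∈ D (h b)) →
      ∀ᶠ b in 𝓝 c, g (h b) (coordField (m := m) h v b) (coordField (m := m) h w b) = 0 :=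
    fun v hv => by filter_upwards [hv, hw] with b h1 h2 using h2 _ h1
  have hz : ∀ u v : Eu k, (∀ᶠ b in 𝓝 c, coordField (m := m) h u b ∈ D (h b)) →
      (∀ᶠ b in 𝓝 c, coordField (m := m) h v b ∈ D (h b)) →
      g (h c) (covAlong g h (coordField (m := m) h w) c (constVF u c))
        (coordField (m := m) h v c) = 0 := by
    intro u v hu hv
    have h2 := g_covAlong_of_orthogonal (u := u) hg hh (hor v hv)
    rw [hw.self_of_nhds _ (hT.covAlong_mem hg hD (smoothAlongAt_coordField hh v) hv
      hu.self_of_nhds)] at h2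
    linarith
  rw [covAlong_coordField_symm hg hh w u, covAlong_coordField_symm hg hh w v, hz u v hu hv,
    hg.symm (h c) (coordField h u c), hz v u hv hu, add_zero] at h1
  exact (derivAt_model _ c w).symm.trans h1

/-- The converse of `IsTotallyGeodesic.fderiv_eq_zero`: if the `D`-block does not vary transversally
and the blocks are orthogonal, the Koszul formula kills the second fundamental form. -/
theorem g_leviCivita_eq_zero (hg : IsRiemannianForm g)
    (hh : ContMDiffAt (𝓡 k) (𝓡 m) ∞ h c) {u v w : Eu k}
    (hu : ∀ᶠ b in 𝓝 c, coordField (m := m) h u b ∈ D (h b))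
    (hv : ∀ᶠ b in 𝓝 c, coordField (m := m) h v b ∈ D (h b))
    (hw : ∀ᶠ b in 𝓝 c, coordField (m := m) h w b ∈ orthoCompl g D (h b))
    (huv : fderiv ℝ (fun b => g (h b) (coordField (m := m) h u b) (coordField (m := m) h v b))
      c w = 0) {X Y Z : ∀ q : M, TangentSpace (𝓡 m) q} (hZ : IsSectionOf (orthoCompl g D) Z)
    (hX : coordField h u c = X (h c)) (hY : coordField h v c = Y (h c))
    (hZw : coordField h w c = Z (h c)) :
    g (h c) (leviCivita g Z (h c) (X (h c))) (Y (h c)) = 0 := by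
  have h1 := g_covAlong_orthogonal (D := D) hg hZ (smoothAlongAt_coordField hh v) hv (constVF u c)
  have h2 := g_covAlong_eq_zero (u := u) (v := v) (w := w) hg hh
    (by filter_upwards [hu, hw] with b h1 h2 using h2 _ h1)
    (by filter_upwards [hv, hw] with b h1 h2 using h2 _ h1) huv
  rw [← hX, ← hY]
  rw [hZw, h1] at h2
  exact neg_eq_zero.1 h2

end

theorem eq_of_fderiv_eq_zero {k l : ℕ} {G : Eu k → ℝ} {Ω : Set (Eu k)} {B : Set (Eu l)}
    (hB : IsOpen B) (hBc : IsPreconnected B) {j : Eu l → Eu k} (j' : Eu l →L[ℝ] Eu k)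
    (hj : ∀ b, HasFDerivAt j j' b) (hjΩ : ∀ b ∈ B, j b ∈ Ω)
    (hG : ∀ c ∈ Ω, DifferentiableAt ℝ G c) (hG0 : ∀ c ∈ Ω, ∀ w, fderiv ℝ G c (j' w) = 0)
    {b b' : Eu l} (hb : b ∈ B) (hb' : b' ∈ B) : G (j b) = G (j b') := by
  have h1 : ∀ b ∈ B, HasFDerivAt (fun b => G (j b)) ((fderiv ℝ G (j b)).comp j') b :=
    fun b hb => (hG _ (hjΩ b hb)).hasFDerivAt.comp b (hj b)
  refine hB.is_const_of_fderiv_eq_zero (𝕜 := ℝ) (f := fun b => G (j b)) hBc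
    (fun b hb => (h1 b hb).differentiableAt.differentiableWithinAt) (fun b hb => ?_) hb hb'
  rw [(h1 b hb).fderiv]
  ext w
  exact hG0 _ (hjΩ b hb) w

end Product

section Product

variable {m : ℕ} {M : Type*} [TopologicalSpace M] [ChartedSpace (Eu m) M]
  [IsManifold (𝓡 m) ∞ M] {g : FormField m M} {D : SubspaceField m M}

theorem fderiv_eq_zero_of_line {k : ℕ} {G : Eu k → ℝ} {c w : Eu k} {t₀ : ℝ}
    (hG : DifferentiableAt ℝ G c) (h : ∀ᶠ t in 𝓝 (0 : ℝ), G (c + t • w) = t₀) :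
    fderiv ℝ G c w = 0 := by
  have h1 : HasDerivAt (fun t : ℝ => G (c + t • w)) (fderiv ℝ G c w) 0 :=
    hG.hasFDerivAt.hasLineDerivAt w
  have h2 : HasDerivAt (fun t : ℝ => G (c + t • w)) 0 0 :=
    (hasDerivAt_const (0 : ℝ) t₀).congr_of_eventuallyEq h
  exact h1.unique h2

theorem coordField_comp {F : Type*} [NormedAddCommGroup F] [NormedSpace ℝ F] {k : ℕ}
    {Ψ : OpenPartialHomeomorph F M} (hΨ : ContMDiffOn 𝓘(ℝ, F) (𝓡 m) ∞ Ψ Ψ.source)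
    (κ : Eu k ≃L[ℝ] F) {c : Eu k} (hc : κ c ∈ Ψ.source) :
    ContMDiffAt (𝓡 k) (𝓡 m) ∞ (fun b => Ψ (κ b)) c ∧
      ∀ u, coordField (m := m) (fun b => Ψ (κ b)) u c =
        (mfderiv 𝓘(ℝ, F) (𝓡 m) Ψ (κ c) (κ u) : TangentSpace (𝓡 m) (Ψ (κ c))) := by
  have h1 := hΨ.contMDiffAt (Ψ.open_source.mem_nhds hc)
  have h2 : HasFDerivAt κ (κ : Eu k →L[ℝ] F) c := κ.hasFDerivAt
  refine ⟨h1.comp c κ.contDiff.contMDiff.contMDiffAt, fun u => ?_⟩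
  have h3 := ((h1.mdifferentiableAt (by simp)).hasMFDerivAt).comp c h2.hasMFDerivAt
  exact congrArg (fun L : Eu k →L[ℝ] TangentSpace (𝓡 m) (Ψ (κ c)) => L u) h3.mfderiv

theorem mfderiv_slice {F : Type*} [NormedAddCommGroup F] [NormedSpace ℝ F] {k : ℕ}
    {Ψ : OpenPartialHomeomorph F M} (hΨ : ContMDiffOn 𝓘(ℝ, F) (𝓡 m) ∞ Ψ Ψ.source)
    {i : Eu k → F} {i' : Eu k →L[ℝ] F} {s : Eu k} (hi : HasFDerivAt i i' s)
    (hs : i s ∈ Ψ.source) (u : Eu k) :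
    (mfderiv (𝓡 k) (𝓡 m) (fun s => Ψ (i s)) s u : TangentSpace (𝓡 m) (Ψ (i s))) =
      mfderiv 𝓘(ℝ, F) (𝓡 m) Ψ (i s) (i' u) := by
  have h1 := hΨ.contMDiffAt (Ψ.open_source.mem_nhds hs)
  have h3 := ((h1.mdifferentiableAt (by simp)).hasMFDerivAt).comp s hi.hasMFDerivAt
  exact congrArg (fun L : Eu k →L[ℝ] TangentSpace (𝓡 m) (Ψ (i s)) => L u) h3.mfderiv

variable [T2Space M]

/-- In product coordinates each block of the metric is independent of the variables of the other
factor, and the Koszul formula applies to both distributions symmetrically. -/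
theorem IsLocallyRiemannianProduct.isTotallyGeodesic (hg : IsRiemannianForm g)
    (h : IsLocallyRiemannianProduct g D (orthoCompl g D)) :
    IsTotallyGeodesic g D ∧ IsTotallyGeodesic g (orthoCompl g D) := by
  have main : ∀ p : M, ∃ (k₁ k₂ k : ℕ) (h : Eu k → M) (c : Eu k) (i : Eu k₁ → Eu k)
      (j : Eu k₂ → Eu k), h c = p ∧ ContMDiffAt (𝓡 k) (𝓡 m) ∞ h c ∧
      (∀ u, ∀ᶠ b in 𝓝 c, coordField (m := m) h (i u) b ∈ D (h b)) ∧
      (∀ w, ∀ᶠ b in 𝓝 c, coordField (m := m) h (j w) b ∈ orthoCompl g D (h b)) ∧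
      (∀ x ∈ D (h c), ∃ u, coordField h (i u) c = x) ∧
      (∀ x ∈ orthoCompl g D (h c), ∃ w, coordField h (j w) c = x) ∧
      (∀ u v w, fderiv ℝ (fun b => g (h b) (coordField (m := m) h (i u) b)
        (coordField (m := m) h (i v) b)) c (j w) = 0) ∧
      (∀ u v w, fderiv ℝ (fun b => g (h b) (coordField (m := m) h (j u) b)
        (coordField (m := m) h (j v) b)) c (i w) = 0) := by
    intro p
    obtain ⟨k₁, k₂, U₁, U₂, Ψ, hsrc, hΨ, -, hP₁, hP₂, a₀, ha₀, b₀, hb₀, hp, hiso⟩ := h p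
    -- The covariant calculus is set up for manifolds modelled on a single `Eu k`, so the product of
    -- the two factors is identified with one.
    let κ : Eu (k₁ + k₂) ≃L[ℝ] Eu k₁ × Eu k₂ := ContinuousLinearEquiv.ofFinrankEq (by simp)
    let c := κ.symm (a₀, b₀)
    have hκc : κ c = (a₀, b₀) := κ.apply_symm_apply _
    have hc : κ c ∈ Ψ.source := by rw [hκc, hsrc]; exact ⟨ha₀, hb₀⟩
    have hnear : ∀ᶠ b in 𝓝 c, κ b ∈ Ψ.source :=
      κ.continuous.continuousAt (Ψ.open_source.mem_nhds hc)
    have hd₁ : ∀ b, κ b ∈ Ψ.source → ∀ u : Eu k₁,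
        coordField (m := m) (fun b => Ψ (κ b)) (κ.symm (u, 0)) b =
        (mfderiv (𝓡 k₁) (𝓡 m) (fun a => Ψ (a, (κ b).2)) (κ b).1 u :
          TangentSpace (𝓡 m) (Ψ (κ b))) := by
      intro b hb u
      rw [(coordField_comp hΨ κ hb).2, ContinuousLinearEquiv.apply_symm_apply]
      exact (mfderiv_slice hΨ (i := fun a => (a, (κ b).2))
        (i' := ContinuousLinearMap.inl ℝ (Eu k₁) (Eu k₂))
        ((hasFDerivAt_id _).prodMk (hasFDerivAt_const _ _)) hb u).symm
    have hd₂ : ∀ b, κ b ∈ Ψ.source → ∀ u : Eu k₂,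
        coordField (m := m) (fun b => Ψ (κ b)) (κ.symm (0, u)) b =
        (mfderiv (𝓡 k₂) (𝓡 m) (fun a => Ψ ((κ b).1, a)) (κ b).2 u :
          TangentSpace (𝓡 m) (Ψ (κ b))) := by
      intro b hb u
      rw [(coordField_comp hΨ κ hb).2, ContinuousLinearEquiv.apply_symm_apply]
      exact (mfderiv_slice hΨ (i := fun a => ((κ b).1, a))
        (i' := ContinuousLinearMap.inr ℝ (Eu k₁) (Eu k₂))
        ((hasFDerivAt_const _ _).prodMk (hasFDerivAt_id _)) hb u).symm
    have hmem : ∀ b, κ b ∈ Ψ.source → (κ b).1 ∈ U₁ ∧ (κ b).2 ∈ U₂ := fun b hb => by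
      rw [hsrc] at hb; exact hb
    have hline : ∀ w : Eu (k₁ + k₂), ∀ᶠ t in 𝓝 (0 : ℝ), κ (c + t • w) ∈ Ψ.source := by
      intro w
      have h1 : ContinuousAt (fun t : ℝ => c + t • w) 0 := by fun_prop
      have h2 : Tendsto (fun t : ℝ => c + t • w) (𝓝 0) (𝓝 c) := by
        have h3 : c + (0 : ℝ) • w = c := by rw [zero_smul, add_zero]
        rw [ContinuousAt, h3] at h1
        exact h1
      exact h2.eventually hnear
    have hdiff : ∀ u v : Eu (k₁ + k₂), DifferentiableAt ℝ (fun b => g (Ψ (κ b))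
        (coordField (m := m) (fun b => Ψ (κ b)) u b)
        (coordField (m := m) (fun b => Ψ (κ b)) v b)) c := fun u v =>
      ((contMDiffAt_metric hg (smoothAlongAt_coordField (coordField_comp hΨ κ hc).1 u)
        (smoothAlongAt_coordField (coordField_comp hΨ κ hc).1 v)).contDiffAt).differentiableAt
        (by simp)
    refine ⟨k₁, k₂, k₁ + k₂, fun b => Ψ (κ b), c, fun u => κ.symm (u, 0), fun w => κ.symm (0, w),
      ?_, (coordField_comp hΨ κ hc).1, fun u => ?_, fun w => ?_, fun x hx => ?_, fun x hx => ?_,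
      fun u v w => ?_, fun u v w => ?_⟩
    · show Ψ (κ c) = p
      rw [hκc, hp]
    · filter_upwards [hnear] with b hb
      rw [hd₁ b hb]
      exact (((hP₁ _ (hmem b hb).2).2.2 _ (hmem b hb).1).2 _).2 ⟨u, rfl⟩
    · filter_upwards [hnear] with b hb
      rw [hd₂ b hb]
      exact (((hP₂ _ (hmem b hb).1).2.2 _ (hmem b hb).2).2 _).2 ⟨w, rfl⟩
    · obtain ⟨u, hu⟩ := (((hP₁ _ (hmem c hc).2).2.2 _ (hmem c hc).1).2 x).1 hx
      exact ⟨u, (hd₁ c hc u).trans hu⟩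
    · obtain ⟨u, hu⟩ := (((hP₂ _ (hmem c hc).1).2.2 _ (hmem c hc).2).2 x).1 hx
      exact ⟨u, (hd₂ c hc u).trans hu⟩
    -- Moving in a direction of the second factor keeps the first component equal to `a₀`, so the
    -- `D`-block stays equal to the metric of the slice at `a₀`.
    · refine fderiv_eq_zero_of_line (hdiff _ _)
        (t₀ := inducedMetric (m := k₁) g (fun a' => Ψ (a', b₀)) a₀ u v) ?_
      filter_upwards [hline (κ.symm (0, w))] with t ht
      have h1 : (κ (c + t • κ.symm (0, w))).1 = a₀ := by
        rw [map_add, map_smul, hκc, ContinuousLinearEquiv.apply_symm_apply]; simp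
      have h2 := hiso _ (hmem _ ht).1 _ (hmem _ ht).2 u v 0 0
      rw [(coordField_comp hΨ κ ht).2, (coordField_comp hΨ κ ht).2,
        ContinuousLinearEquiv.apply_symm_apply, ContinuousLinearEquiv.apply_symm_apply]
      have h3 : inducedMetric (m := k₂) g (fun b' => Ψ (a₀, b'))
          (κ (c + t • κ.symm (0, w))).2 0 0 = 0 := map_zero _
      refine h2.trans ((congrArg (fun s : ℝ => _ + s) h3).trans ((add_zero _).trans ?_))
      rw [h1]
    · refine fderiv_eq_zero_of_line (hdiff _ _)
        (t₀ := inducedMetric (m := k₂) g (fun b' => Ψ (a₀, b')) b₀ u v) ?_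
      filter_upwards [hline (κ.symm (w, 0))] with t ht
      have h1 : (κ (c + t • κ.symm (w, 0))).2 = b₀ := by
        rw [map_add, map_smul, hκc, ContinuousLinearEquiv.apply_symm_apply]; simp
      have h2 := hiso _ (hmem _ ht).1 _ (hmem _ ht).2 0 0 u v
      rw [(coordField_comp hΨ κ ht).2, (coordField_comp hΨ κ ht).2,
        ContinuousLinearEquiv.apply_symm_apply, ContinuousLinearEquiv.apply_symm_apply]
      have h3 : inducedMetric (m := k₁) g (fun a' => Ψ (a', b₀))
          (κ (c + t • κ.symm (w, 0))).1 0 0 = 0 := map_zero _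
      refine h2.trans ((congrArg (fun s : ℝ => s + _) h3).trans ((zero_add _).trans ?_))
      rw [h1]
  constructor
  · intro X Y Z hX hY hZ p
    obtain ⟨k₁, k₂, k, h, c, i, j, rfl, hh, hi, hj, hix, hjx, hG, -⟩ := main p
    obtain ⟨u, hu⟩ := hix _ (hX.2 _)
    obtain ⟨v, hv⟩ := hix _ (hY.2 _)
    obtain ⟨w, hw⟩ := hjx _ (hZ.2 _)
    exact g_leviCivita_eq_zero hg hh (hi u) (hi v) (hj w) (hG u v w) hZ hu hv hw
  · intro X Y Z hX hY hZ p
    obtain ⟨k₁, k₂, k, h, c, i, j, rfl, hh, hi, hj, hix, hjx, -, hG⟩ := main p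
    have hZD : Z (h c) ∈ D (h c) := by
      have := hZ.2 (h c)
      rwa [orthoCompl_orthoCompl hg] at this
    obtain ⟨u, hu⟩ := hjx _ (hX.2 _)
    obtain ⟨v, hv⟩ := hjx _ (hY.2 _)
    obtain ⟨w, hw⟩ := hix _ hZD
    refine g_leviCivita_eq_zero hg hh (hj u) (hj v) ?_ (hG u v w) hZ hu hv hw
    rw [orthoCompl_orthoCompl hg]
    exact hi w

theorem IsRiemannianForm.add_apply_add_of_orthogonal (hg : IsRiemannianForm g) {p : M}
    {a b a' b' : TangentSpace (𝓡 m) p} (h : g p a b' = 0) (h' : g p a' b = 0) :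
    g p (a + b) (a' + b') = g p a a' + g p b b' := by
  rw [ContinuousLinearMap.map_add₂, map_add, map_add, h, hg.symm p b a', h', add_zero, zero_add]

set_option maxHeartbeats 1000000 in
theorem isLocallyRiemannianProduct_of_isTotallyGeodesic (hg : IsRiemannianForm g)
    (hD : IsDistribution D) (hT₁ : IsTotallyGeodesic g D)
    (hT₂ : IsTotallyGeodesic g (orthoCompl g D)) :
    IsLocallyRiemannianProduct g D (orthoCompl g D) := by
  intro p
  have hD' := hD.orthoCompl hg
  obtain ⟨k₂, O₁, y₁, hk₁, hO₁, ha₁, hOt₁, hy₁, hyD₁⟩ := hT₁.exists_first_integral hg hD p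
  obtain ⟨k₁, O₂, y₂, hk₂, hO₂, ha₂, hOt₂, hy₂, hyD₂⟩ := hT₂.exists_first_integral hg hD' p
  let a : Eu m := extChartAt (𝓡 m) p p
  have hdim := Submodule.finrank_add_eq_of_isCompl (isCompl_orthoCompl (D := D) hg p)
  have hm : Module.finrank ℝ (TangentSpace (𝓡 m) p) = m := finrank_euclideanSpace_fin
  have hd₁ : ∀ a ∈ O₁, HasFDerivAt y₁ (fderiv ℝ y₁ a) a := fun a ha =>
    ((hy₁.contDiffAt (hO₁.mem_nhds ha)).differentiableAt (by simp)).hasFDerivAt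
  have hd₂ : ∀ a ∈ O₂, HasFDerivAt y₂ (fderiv ℝ y₂ a) a := fun a ha =>
    ((hy₂.contDiffAt (hO₂.mem_nhds ha)).differentiableAt (by simp)).hasFDerivAt
  have hd : ∀ a ∈ O₁ ∩ O₂, HasFDerivAt (fun a => (y₂ a, y₁ a))
      ((fderiv ℝ y₂ a).prod (fderiv ℝ y₁ a)) a := fun a ha => (hd₂ a ha.2).prodMk (hd₁ a ha.1)
  -- First integrals of one distribution are coordinates along the other. Jointly they are
  -- independent because the two kernels meet in zero and the dimensions add up to `m`.
  obtain ⟨e, he⟩ : ∃ e : Eu m ≃L[ℝ] Eu k₁ × Eu k₂, (e : Eu m →L[ℝ] Eu k₁ × Eu k₂) =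
      (fderiv ℝ y₂ a).prod (fderiv ℝ y₁ a) := by
    let L : Eu m →ₗ[ℝ] Eu k₁ × Eu k₂ := ((fderiv ℝ y₂ a).prod (fderiv ℝ y₁ a)).toLinearMap
    have hL : Function.Injective L := by
      rw [injective_iff_map_eq_zero]
      intro v hv
      have h1 := ((hyD₁ a ha₁).2 v).1 (congrArg Prod.snd hv)
      have h2 := ((hyD₂ a ha₂).2 v).1 (congrArg Prod.fst hv)
      have h3 := (isCompl_orthoCompl (D := D) hg _).disjoint.le_bot ⟨h1, h2⟩
      have h4 : (extChartAt (𝓡 m) p).symm a ∈ (chartAt (Eu m) p).source := by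
        have := (extChartAt (𝓡 m) p).map_target (hOt₁ ha₁)
        rwa [extChartAt_source] at this
      exact coordSymm_injective h4 (((Submodule.mem_bot ℝ).1 h3).trans (map_zero _).symm)
    refine ⟨(LinearEquiv.ofInjectiveOfFinrankEq L hL ?_).toContinuousLinearEquiv, by ext <;> rfl⟩
    rw [Module.finrank_prod, finrank_euclideanSpace_fin, finrank_euclideanSpace_fin,
      finrank_euclideanSpace_fin]
    omega
  obtain ⟨Ψ, hpt, hΨ, hΨs, hx⟩ := exists_parametrization (hO₁.inter hO₂)
    (inter_subset_left.trans hOt₁) ⟨ha₁, ha₂⟩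
    ((hy₂.mono inter_subset_right).prodMk (hy₁.mono inter_subset_left)) e
    (by rw [he]; exact hd a ⟨ha₁, ha₂⟩)
  have hmem₁ : ∀ x ∈ Ψ.source, ∀ w : Eu k₁ × Eu k₂,
      (mfderiv 𝓘(ℝ, Eu k₁ × Eu k₂) (𝓡 m) Ψ x w : TangentSpace (𝓡 m) (Ψ x)) ∈ D (Ψ x) ↔
        ContinuousLinearMap.snd ℝ (Eu k₁) (Eu k₂) w = 0 := by
    intro x hxs w
    obtain ⟨b, hb, hbx, hw⟩ := (hx x hxs).2.2
    obtain ⟨v, hv1, hv2⟩ := hw w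
    rw [(hd b hb).fderiv] at hv1
    rw [← hv2, ← hbx, ← (hyD₁ b hb.1).2 v, ← hv1]
    rfl
  have hmem₂ : ∀ x ∈ Ψ.source, ∀ w : Eu k₁ × Eu k₂,
      (mfderiv 𝓘(ℝ, Eu k₁ × Eu k₂) (𝓡 m) Ψ x w : TangentSpace (𝓡 m) (Ψ x)) ∈
        orthoCompl g D (Ψ x) ↔ ContinuousLinearMap.fst ℝ (Eu k₁) (Eu k₂) w = 0 := by
    intro x hxs w
    obtain ⟨b, hb, hbx, hw⟩ := (hx x hxs).2.2
    obtain ⟨v, hv1, hv2⟩ := hw w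
    rw [(hd b hb).fderiv] at hv1
    rw [← hv2, ← hbx, ← (hyD₂ b hb.2).2 v, ← hv1]
    rfl
  obtain ⟨x₀, hx₀, rfl⟩ : ∃ x₀ ∈ Ψ.source, Ψ x₀ = p :=
    ⟨Ψ.symm p, Ψ.map_target hpt, Ψ.right_inv hpt⟩
  -- In the maximum norm a ball is a product of balls. The factors are connected, which is needed to
  -- pass from zero derivative to constancy.
  obtain ⟨r, hr, hrs⟩ := Metric.isOpen_iff.1 Ψ.open_source x₀ hx₀
  let Ψ' := Ψ.restrOpen (Metric.ball x₀ r) Metric.isOpen_ball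
  have hs' : Ψ'.source = Metric.ball x₀.1 r ×ˢ Metric.ball x₀.2 r := by
    rw [ball_prod_same, OpenPartialHomeomorph.restrOpen_source, inter_eq_right.2 hrs]
  have hsub : Ψ'.source ⊆ Ψ.source := by
    rw [OpenPartialHomeomorph.restrOpen_source]
    exact inter_subset_left
  have hslice₁ : ∀ b ∈ Metric.ball x₀.2 r, _ := fun b hb =>
    isIntegralPatch_slice (D := D) hΨ (fun x h => (hx x h).1) (fun x h => (hx x h).2.1)
      (ContinuousLinearMap.snd ℝ (Eu k₁) (Eu k₂)) hmem₁ (i := fun s : Eu k₁ => (s, b))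
      (ContinuousLinearMap.inl ℝ (Eu k₁) (Eu k₂))
      (fun s => (hasFDerivAt_id s).prodMk (hasFDerivAt_const _ s))
      (contDiff_id.prodMk contDiff_const) (fun a b h => congrArg Prod.fst h)
      (fun w => ⟨fun h => ⟨w.1, Prod.ext rfl h.symm⟩, fun ⟨s, h⟩ => by rw [← h]; rfl⟩)
      (Metric.isOpen_ball (x := x₀.1) (ε := r)) (fun s hs => hsub (hs' ▸ ⟨hs, hb⟩))
  have hslice₂ : ∀ b ∈ Metric.ball x₀.1 r, _ := fun b hb =>
    isIntegralPatch_slice (D := orthoCompl g D) hΨ (fun x h => (hx x h).1)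
      (fun x h => (hx x h).2.1)
      (ContinuousLinearMap.fst ℝ (Eu k₁) (Eu k₂)) hmem₂ (i := fun s : Eu k₂ => (b, s))
      (ContinuousLinearMap.inr ℝ (Eu k₁) (Eu k₂))
      (fun s => (hasFDerivAt_const _ s).prodMk (hasFDerivAt_id s))
      (contDiff_const.prodMk contDiff_id) (fun a b h => congrArg Prod.snd h)
      (fun w => ⟨fun h => ⟨w.2, Prod.ext h.symm rfl⟩, fun ⟨s, h⟩ => by rw [← h]; rfl⟩)
      (Metric.isOpen_ball (x := x₀.2) (ε := r)) (fun s hs => hsub (hs' ▸ ⟨hb, hs⟩))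
  refine ⟨k₁, k₂, Metric.ball x₀.1 r, Metric.ball x₀.2 r, Ψ', hs', hΨ.mono hsub, ?_,
    fun b hb => (hslice₁ b hb).1, fun b hb => (hslice₂ b hb).1, x₀.1, Metric.mem_ball_self hr,
    x₀.2, Metric.mem_ball_self hr, rfl, fun a₁ ha₁ b₁ hb₁ u v u' v' => ?_⟩
  · exact hΨs.mono fun q hq => hq.1
  let κ : Eu (k₁ + k₂) ≃L[ℝ] Eu k₁ × Eu k₂ := ContinuousLinearEquiv.ofFinrankEq (by simp)
  let Ω : Set (Eu (k₁ + k₂)) := κ ⁻¹' Ψ.source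
  have hΩ : IsOpen Ω := Ψ.open_source.preimage κ.continuous
  let G : Eu k₁ × Eu k₂ → Eu k₁ × Eu k₂ → Eu (k₁ + k₂) → ℝ := fun w w' b => g (Ψ (κ b))
    (coordField (m := m) (fun b => Ψ (κ b)) (κ.symm w) b)
    (coordField (m := m) (fun b => Ψ (κ b)) (κ.symm w') b)
  have hGdiff : ∀ w w', ∀ c ∈ Ω, DifferentiableAt ℝ (G w w') c := fun w w' c hc =>
    ((contMDiffAt_metric hg (smoothAlongAt_coordField (coordField_comp hΨ κ hc).1 _)
      (smoothAlongAt_coordField (coordField_comp hΨ κ hc).1 _)).contDiffAt).differentiableAt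
      (by simp)
  have hG : ∀ w w' : Eu k₁ × Eu k₂, ∀ x ∈ Ψ.source, G w w' (κ.symm x) =
      g (Ψ x) (mfderiv 𝓘(ℝ, Eu k₁ × Eu k₂) (𝓡 m) Ψ x w : TangentSpace (𝓡 m) (Ψ x))
        (mfderiv 𝓘(ℝ, Eu k₁ × Eu k₂) (𝓡 m) Ψ x w') := by
    intro w w' x hxs
    obtain ⟨c, rfl⟩ := κ.surjective x
    rw [ContinuousLinearEquiv.symm_apply_apply]
    show g (Ψ (κ c)) (coordField (m := m) (fun b => Ψ (κ b)) (κ.symm w) c)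
      (coordField (m := m) (fun b => Ψ (κ b)) (κ.symm w') c) = _
    rw [(coordField_comp hΨ κ hxs).2, (coordField_comp hΨ κ hxs).2,
      ContinuousLinearEquiv.apply_symm_apply, ContinuousLinearEquiv.apply_symm_apply]
  have hcf₁ : ∀ c ∈ Ω, ∀ u : Eu k₁, ∀ᶠ b in 𝓝 c,
      coordField (m := m) (fun b => Ψ (κ b)) (κ.symm (u, 0)) b ∈ D (Ψ (κ b)) := by
    intro c hc u
    filter_upwards [hΩ.mem_nhds hc] with b hb
    rw [(coordField_comp hΨ κ hb).2, ContinuousLinearEquiv.apply_symm_apply]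
    exact (hmem₁ _ hb _).2 rfl
  have hcf₂ : ∀ c ∈ Ω, ∀ u : Eu k₂, ∀ᶠ b in 𝓝 c,
      coordField (m := m) (fun b => Ψ (κ b)) (κ.symm (0, u)) b ∈ orthoCompl g D (Ψ (κ b)) := by
    intro c hc u
    filter_upwards [hΩ.mem_nhds hc] with b hb
    rw [(coordField_comp hΨ κ hb).2, ContinuousLinearEquiv.apply_symm_apply]
    exact (hmem₂ _ hb _).2 rfl
  have hsrc : ∀ a ∈ Metric.ball x₀.1 r, ∀ b ∈ Metric.ball x₀.2 r, (a, b) ∈ Ψ.source :=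
    fun a ha b hb => hsub (hs' ▸ ⟨ha, hb⟩)
  -- The first block of the metric is transported along the second factor to the slice through `p`;
  -- `hc₂` does the same with the roles exchanged.
  have hc₁ : ∀ u v : Eu k₁, G (u, 0) (v, 0) (κ.symm (a₁, b₁)) =
      G (u, 0) (v, 0) (κ.symm (a₁, x₀.2)) := fun u v =>
    eq_of_fderiv_eq_zero (Ω := Ω) Metric.isOpen_ball (convex_ball x₀.2 r).isPreconnected
      (j := fun b => κ.symm (a₁, b))
      ((κ.symm : Eu k₁ × Eu k₂ →L[ℝ] Eu (k₁ + k₂)).comp (ContinuousLinearMap.inr ℝ _ _))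
      (fun b => κ.symm.hasFDerivAt.comp b ((hasFDerivAt_const _ b).prodMk (hasFDerivAt_id b)))
      (fun b hb => by
        show κ (κ.symm (a₁, b)) ∈ Ψ.source
        rw [ContinuousLinearEquiv.apply_symm_apply]
        exact hsrc _ ha₁ _ hb) (hGdiff _ _)
      (fun c hc w => hT₁.fderiv_eq_zero hg hD (coordField_comp hΨ κ hc).1 (hcf₁ c hc u)
        (hcf₁ c hc v) (hcf₂ c hc w)) hb₁ (Metric.mem_ball_self hr)
  have hc₂ : ∀ u v : Eu k₂, G (0, u) (0, v) (κ.symm (a₁, b₁)) =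
      G (0, u) (0, v) (κ.symm (x₀.1, b₁)) := fun u v =>
    eq_of_fderiv_eq_zero (Ω := Ω) Metric.isOpen_ball (convex_ball x₀.1 r).isPreconnected
      (j := fun b => κ.symm (b, b₁))
      ((κ.symm : Eu k₁ × Eu k₂ →L[ℝ] Eu (k₁ + k₂)).comp (ContinuousLinearMap.inl ℝ _ _))
      (fun b => κ.symm.hasFDerivAt.comp b ((hasFDerivAt_id b).prodMk (hasFDerivAt_const _ b)))
      (fun b hb => by
        show κ (κ.symm (b, b₁)) ∈ Ψ.source
        rw [ContinuousLinearEquiv.apply_symm_apply]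
        exact hsrc _ hb _ hb₁) (hGdiff _ _)
      (fun c hc w => hT₂.fderiv_eq_zero hg hD' (coordField_comp hΨ κ hc).1 (hcf₂ c hc u)
        (hcf₂ c hc v) (by rw [orthoCompl_orthoCompl hg]; exact hcf₁ c hc w)) ha₁
        (Metric.mem_ball_self hr)
  have hx₁ := hsrc a₁ ha₁ b₁ hb₁
  have hi₁ : inducedMetric (m := k₁) g (fun a' => Ψ (a', x₀.2)) a₁ u v =
      G (u, 0) (v, 0) (κ.symm (a₁, x₀.2)) := by
    rw [hG _ _ _ (hsrc a₁ ha₁ x₀.2 (Metric.mem_ball_self hr))]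
    have h1 := (hslice₁ x₀.2 (Metric.mem_ball_self hr)).2 a₁ ha₁
    exact congrArg₂ (fun s t => g (Ψ (a₁, x₀.2)) s t) (h1 u) (h1 v)
  have hi₂ : inducedMetric (m := k₂) g (fun b' => Ψ (x₀.1, b')) b₁ u' v' =
      G (0, u') (0, v') (κ.symm (x₀.1, b₁)) := by
    rw [hG _ _ _ (hsrc x₀.1 (Metric.mem_ball_self hr) b₁ hb₁)]
    have h1 := (hslice₂ x₀.1 (Metric.mem_ball_self hr)).2 b₁ hb₁
    exact congrArg₂ (fun s t => g (Ψ (x₀.1, b₁)) s t) (h1 u') (h1 v')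
  have hsplit : ∀ (u : Eu k₁) (u' : Eu k₂),
      (mfderiv 𝓘(ℝ, Eu k₁ × Eu k₂) (𝓡 m) Ψ (a₁, b₁) (u, u') : TangentSpace (𝓡 m) (Ψ (a₁, b₁))) =
      mfderiv 𝓘(ℝ, Eu k₁ × Eu k₂) (𝓡 m) Ψ (a₁, b₁) (u, 0) +
      mfderiv 𝓘(ℝ, Eu k₁ × Eu k₂) (𝓡 m) Ψ (a₁, b₁) (0, u') := by
    intro u u'
    have h1 : ((u, u') : Eu k₁ × Eu k₂) = (u, 0) + (0, u') := by simp
    exact (congrArg (mfderiv 𝓘(ℝ, Eu k₁ × Eu k₂) (𝓡 m) Ψ (a₁, b₁)) h1).trans (map_add _ _ _)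
  have hor : ∀ (u : Eu k₁) (u' : Eu k₂), g (Ψ (a₁, b₁))
      (mfderiv 𝓘(ℝ, Eu k₁ × Eu k₂) (𝓡 m) Ψ (a₁, b₁) (u, 0) : TangentSpace (𝓡 m) (Ψ (a₁, b₁)))
      (mfderiv 𝓘(ℝ, Eu k₁ × Eu k₂) (𝓡 m) Ψ (a₁, b₁) (0, u')) = 0 := fun u u' =>
    (hmem₂ _ hx₁ (0, u')).2 rfl _ ((hmem₁ _ hx₁ (u, 0)).2 rfl)
  show g (Ψ (a₁, b₁))
      (mfderiv 𝓘(ℝ, Eu k₁ × Eu k₂) (𝓡 m) Ψ (a₁, b₁) (u, u') : TangentSpace (𝓡 m) (Ψ (a₁, b₁)))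
      (mfderiv 𝓘(ℝ, Eu k₁ × Eu k₂) (𝓡 m) Ψ (a₁, b₁) (v, v')) =
    inducedMetric (m := k₁) g (fun a' => Ψ (a', x₀.2)) a₁ u v +
    inducedMetric (m := k₂) g (fun b' => Ψ (x₀.1, b')) b₁ u' v'
  rw [hi₁, hi₂, ← hc₁, ← hc₂, hG _ _ _ hx₁, hG _ _ _ hx₁, hsplit u u', hsplit v v']
  exact hg.add_apply_add_of_orthogonal (hor u v') (hor v u')

theorem isLocallyRiemannianProduct_iff (hg : IsRiemannianForm g) (hD : IsDistribution D) :
    IsLocallyRiemannianProduct g D (orthoCompl g D) ↔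
      IsTotallyGeodesic g D ∧ IsTotallyGeodesic g (orthoCompl g D) :=
  ⟨fun h => h.isTotallyGeodesic hg,
    fun h => isLocallyRiemannianProduct_of_isTotallyGeodesic hg hD h.1 h.2⟩

end Product

/-! ### The Gauss formula -/

section Gauss

variable {m d : ℕ}
  {M : Type*} [TopologicalSpace M] [ChartedSpace (Eu m) M] [IsManifold (𝓡 m) ∞ M]
  {N : Type*} [TopologicalSpace N] [ChartedSpace (Eu d) N] [IsManifold (𝓡 d) ∞ N]
  {f : M → N} {p : M} {g : FormField d N}

/-- A trilinear quantity which is symmetric in the first and skew in the last two arguments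
vanishes. -/
theorem eq_zero_of_symm_of_skew {V : Type*} (B : V → V → V → ℝ)
    (h₁ : ∀ x y z, B x y z = B y x z) (h₂ : ∀ x y z, B x y z = -B x z y) (x y z : V) :
    B x y z = 0 := by
  linarith [h₁ x y z, h₂ y x z, h₁ y z x, h₂ z y x, h₁ z x y, h₂ x z y]

variable [T2Space M]

/-- The Gauss formula: the tangential part of the ambient connection is the Levi-Civita connection
of the induced metric. -/
theorem g_covAlong_mfderiv (hg : IsRiemannianForm g) (hf : IsSubmanifoldMap (m := m) (d := d) f)
    {Y : ∀ q : M, TangentSpace (𝓡 m) q} (hY : IsSmoothVF Y) (u w : TangentSpace (𝓡 m) p) :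
    g (f p) (covAlong g f (fun q => mfderiv (𝓡 m) (𝓡 d) f q (Y q)) p u)
        (mfderiv (𝓡 m) (𝓡 d) f p w) =
      inducedMetric (m := m) g f p (leviCivita (inducedMetric (m := m) g f) Y p u) w := by
  have hgM := isRiemannianForm_inducedMetric hg hf
  obtain ⟨U, hU, rfl⟩ := exists_isSmoothVF p u
  obtain ⟨W, hW, rfl⟩ := exists_isSmoothVF p w
  let V := {X : ∀ q : M, TangentSpace (𝓡 m) q // IsSmoothVF X}
  -- The difference of two connections that are both torsion-free and metric: symmetric in the first
  -- two arguments, skew in the last two, hence zero.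
  let B : V → V → V → ℝ := fun X Y Z =>
    g (f p) (covAlong g f (fun q => mfderiv (𝓡 m) (𝓡 d) f q (Y.1 q)) p (X.1 p))
        (mfderiv (𝓡 m) (𝓡 d) f p (Z.1 p)) -
      inducedMetric (m := m) g f p (leviCivita (inducedMetric (m := m) g f) Y.1 p (X.1 p)) (Z.1 p)
  refine sub_eq_zero.1 (eq_zero_of_symm_of_skew B (fun X Y Z => ?_) (fun X Y Z => ?_)
    ⟨U, hU⟩ ⟨Y, hY⟩ ⟨W, hW⟩)
  · have h1 := congrArg (fun v => g (f p) v (mfderiv (𝓡 m) (𝓡 d) f p (Z.1 p)))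
      (covAlong_mfderiv_sub hg (hf.1 p) (X.2 p) (Y.2 p))
    have h2 := congrArg (fun v => inducedMetric (m := m) g f p v (Z.1 p))
      (leviCivita_sub hgM (X.2 p) (Y.2 p))
    beta_reduce at h1 h2
    rw [ContinuousLinearMap.map_sub₂] at h1 h2
    have h3 : g (f p) (mfderiv (𝓡 m) (𝓡 d) f p (VectorField.mlieBracket (𝓡 m) X.1 Y.1 p))
      (mfderiv (𝓡 m) (𝓡 d) f p (Z.1 p)) = inducedMetric (m := m) g f p
        (VectorField.mlieBracket (𝓡 m) X.1 Y.1 p) (Z.1 p) := rfl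
    show _ - _ = _ - _
    linarith
  · have h1 := derivAt_metric hg (SmoothVFAt.pushforward (hf.1 p) (Y.2 p))
      (SmoothVFAt.pushforward (hf.1 p) (Z.2 p)) (X.1 p)
    have h2 := derivAt_metric (f := fun q : M => q) hgM (Y.2 p) (Z.2 p) (X.1 p)
    have h3 : derivAt (fun q => g (f q) (mfderiv (𝓡 m) (𝓡 d) f q (Y.1 q))
        (mfderiv (𝓡 m) (𝓡 d) f q (Z.1 q))) p (X.1 p) =
      derivAt (fun q => inducedMetric (m := m) g f q (Y.1 q) (Z.1 q)) p (X.1 p) := rfl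
    have h4 := hg.symm (f p) (mfderiv (𝓡 m) (𝓡 d) f p (Y.1 p))
      (covAlong g f (fun q => mfderiv (𝓡 m) (𝓡 d) f q (Z.1 q)) p (X.1 p))
    have h5 := hgM.symm p (Y.1 p) (leviCivita (inducedMetric (m := m) g f) Z.1 p (X.1 p))
    have h6 := h1.symm.trans (h3.trans h2)
    show _ - _ = -(_ - _)
    unfold leviCivita at h5 ⊢
    linarith

end Gauss

/-! ### The Weingarten formula and shape operators -/

section ShapeOperator

variable {m d : ℕ}
  {M : Type*} [TopologicalSpace M] [ChartedSpace (Eu m) M] [IsManifold (𝓡 m) ∞ M]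
  {N : Type*} [TopologicalSpace N] [ChartedSpace (Eu d) N] [IsManifold (𝓡 d) ∞ N]
  {f : M → N} {p : M} {g : FormField d N} {ζ : ∀ q : M, TangentSpace (𝓡 d) (f q)}

theorem g_shapeOp (hg : IsRiemannianForm g) (hf : IsSubmanifoldMap (m := m) (d := d) f)
    (u w : TangentSpace (𝓡 m) p) :
    inducedMetric (m := m) g f p (shapeOp (m := m) g f ζ p u) w =
      -g (f p) (covAlong g f ζ p u) (mfderiv (𝓡 m) (𝓡 d) f p w) := by
  have h := tanPart_spec hg (hf.2 p) (covAlong g f ζ p u) w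
  have h1 : inducedMetric (m := m) g f p (tanPart g f p (covAlong g f ζ p u)) w = _ := h
  rw [shapeOp, map_neg, ← h1]
  rfl

theorem g_covAlong_normal (hg : IsRiemannianForm g) (hf : IsSubmanifoldMap (m := m) (d := d) f)
    (hζ : SmoothAlongAt (m := m) f ζ p)
    (hn : ∀ q (w : TangentSpace (𝓡 m) q), g (f q) (ζ q) (mfderiv (𝓡 m) (𝓡 d) f q w) = 0)
    {Y : ∀ q : M, TangentSpace (𝓡 m) q} (hY : IsSmoothVF Y) (u : TangentSpace (𝓡 m) p) :
    g (f p) (covAlong g f ζ p u) (mfderiv (𝓡 m) (𝓡 d) f p (Y p)) =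
      -g (f p) (ζ p) (covAlong g f (fun q => mfderiv (𝓡 m) (𝓡 d) f q (Y q)) p u) := by
  have h1 := derivAt_metric hg hζ (SmoothVFAt.pushforward (hf.1 p) (hY p)) u
  have h2 : (fun q => g (f q) (ζ q) (mfderiv (𝓡 m) (𝓡 d) f q (Y q))) = fun _ => 0 :=
    funext fun q => hn q _
  rw [h2, derivAt_const] at h1
  have h3 : (0 : ℝ) = _ := h1
  linarith

variable [T2Space M]

/-- The shape operators are self-adjoint. -/
theorem g_shapeOp_symm (hg : IsRiemannianForm g) (hf : IsSubmanifoldMap (m := m) (d := d) f)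
    (hζ : SmoothAlongAt (m := m) f ζ p)
    (hn : ∀ q (w : TangentSpace (𝓡 m) q), g (f q) (ζ q) (mfderiv (𝓡 m) (𝓡 d) f q w) = 0)
    (u w : TangentSpace (𝓡 m) p) :
    inducedMetric (m := m) g f p (shapeOp (m := m) g f ζ p u) w =
      inducedMetric (m := m) g f p (shapeOp (m := m) g f ζ p w) u := by
  obtain ⟨U, hU, rfl⟩ := exists_isSmoothVF p u
  obtain ⟨W, hW, rfl⟩ := exists_isSmoothVF p w
  rw [g_shapeOp hg hf, g_shapeOp hg hf, g_covAlong_normal hg hf hζ hn hU,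
    g_covAlong_normal hg hf hζ hn hW]
  have h := congrArg (g (f p) (ζ p)) (covAlong_mfderiv_sub hg (hf.1 p) (hU p) (hW p))
  rw [map_sub, hn] at h
  linarith

end ShapeOperator

/-! ### Pointwise semi-slant submanifolds and the main identity -/

namespace AlmostContactMetric

variable {m n : ℕ} {N : Type*} [TopologicalSpace N] [ChartedSpace (Eu (2 * n + 1)) N]
  [IsManifold (𝓡 (2 * n + 1)) ∞ N] {S : AlmostContactMetric n N}
  {M : Type*} [TopologicalSpace M] [ChartedSpace (Eu m) M] [IsManifold (𝓡 m) ∞ M]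
  {f : M → N} {D₁ : SubspaceField m M} {θ : M → ℝ}

theorem compat_g (x : N) (u v : TangentSpace (𝓡 (2 * n + 1)) x) :
    S.g x (S.φ x u) (S.φ x v) = S.g x u v - S.η x u * S.η x v := S.compat x u v

theorem η_φ (x : N) (u : TangentSpace (𝓡 (2 * n + 1)) x) : S.η x (S.φ x u) = 0 :=
  (S.point x).η_φ u

variable (S f)

/-- The tangential part of `φ u`, for a tangent vector `u` of the submanifold. -/
def tanφ (p : M) (u : TangentSpace (𝓡 m) p) : TangentSpace (𝓡 m) p :=
  tanPart S.g f p (S.φ (f p) (mfderiv (𝓡 m) (𝓡 (2 * n + 1)) f p u))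

variable {S f}

theorem isRiemannianForm_gM (hf : IsSubmanifoldMap (m := m) (d := 2 * n + 1) f) :
    IsRiemannianForm (S.gM (m := m) f) :=
  isRiemannianForm_inducedMetric S.isRiemannianForm_g hf

theorem gM_tanφ (hf : IsSubmanifoldMap (m := m) (d := 2 * n + 1) f) {p : M}
    (u w : TangentSpace (𝓡 m) p) :
    S.gM f p (S.tanφ f p u) w = S.g (f p) (S.φ (f p) (mfderiv (𝓡 m) (𝓡 (2 * n + 1)) f p u)) (mfderiv (𝓡 m) (𝓡 (2 * n + 1)) f p w) :=
  tanPart_spec S.isRiemannianForm_g (hf.2 p) _ w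

theorem gM_tanφ_skew (hf : IsSubmanifoldMap (m := m) (d := 2 * n + 1) f) {p : M}
    (u w : TangentSpace (𝓡 m) p) :
    S.gM f p (S.tanφ f p u) w = -S.gM f p u (S.tanφ f p w) := by
  rw [gM_tanφ hf, (isRiemannianForm_gM hf).symm p u, gM_tanφ hf, φ_skew,
    S.isRiemannianForm_g.symm (f p) (mfderiv (𝓡 m) (𝓡 (2 * n + 1)) f p u)]

theorem tanφ_add (hf : IsSubmanifoldMap (m := m) (d := 2 * n + 1) f) {p : M}
    (u w : TangentSpace (𝓡 m) p) :
    S.tanφ f p (u + w) = S.tanφ f p u + S.tanφ f p w := by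
  refine (isRiemannianForm_gM (S := S) hf).ext_iff.2 fun v => ?_
  rw [ContinuousLinearMap.map_add₂, gM_tanφ hf, gM_tanφ hf, gM_tanφ hf, map_add, map_add,
    ContinuousLinearMap.map_add₂]

theorem isSmoothVF_T (hf : IsSubmanifoldMap (m := m) (d := 2 * n + 1) f)
    {X : ∀ q : M, TangentSpace (𝓡 m) q} (hX : IsSmoothVF X) : IsSmoothVF (S.T f X) := fun p =>
  SmoothAlongAt.tanPart S.isRiemannianForm_g hf.2
    (SmoothAlongAt.endApply (S.contMDiffAt_endCoeff (f p)) (SmoothVFAt.pushforward (hf.1 p) (hX p)))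

theorem F_eq (X : ∀ q : M, TangentSpace (𝓡 m) q) :
    S.F f X = fun q => S.φ (f q) (mfderiv (𝓡 m) (𝓡 (2 * n + 1)) f q (X q)) - mfderiv (𝓡 m) (𝓡 (2 * n + 1)) f q (S.T f X q) := rfl

theorem smoothAlongAt_φ (hf : IsSubmanifoldMap (m := m) (d := 2 * n + 1) f)
    {X : ∀ q : M, TangentSpace (𝓡 m) q} (hX : IsSmoothVF X) (p : M) :
    SmoothAlongAt (m := m) f (fun q => S.φ (f q) (mfderiv (𝓡 m) (𝓡 (2 * n + 1)) f q (X q))) p :=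
  SmoothAlongAt.endApply (S.contMDiffAt_endCoeff (f p)) (SmoothVFAt.pushforward (hf.1 p) (hX p))

theorem smoothAlongAt_F (hf : IsSubmanifoldMap (m := m) (d := 2 * n + 1) f)
    {X : ∀ q : M, TangentSpace (𝓡 m) q} (hX : IsSmoothVF X) (p : M) :
    SmoothAlongAt (m := m) f (S.F f X) p :=
  (smoothAlongAt_φ hf hX p).sub (SmoothVFAt.pushforward (hf.1 p) (isSmoothVF_T hf hX p))

theorem g_F (hf : IsSubmanifoldMap (m := m) (d := 2 * n + 1) f)
    (X : ∀ q : M, TangentSpace (𝓡 m) q) (q : M) (w : TangentSpace (𝓡 m) q) :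
    S.g (f q) (S.F f X q) (mfderiv (𝓡 m) (𝓡 (2 * n + 1)) f q w) = 0 :=
  norPart_spec S.isRiemannianForm_g (hf.2 q) _ w

/-- The Weingarten formula for the normal part of `φ Z`. -/
theorem gM_shapeOp_F (hf : IsSubmanifoldMap (m := m) (d := 2 * n + 1) f)
    {Z : ∀ q : M, TangentSpace (𝓡 m) q} (hZ : IsSmoothVF Z) {p : M}
    (u w : TangentSpace (𝓡 m) p) :
    S.gM f p (shapeOp S.g f (S.F f Z) p u) w =
      S.g (f p) (covAlong S.g f (fun q => mfderiv (𝓡 m) (𝓡 (2 * n + 1)) f q (S.T f Z q)) p u) (mfderiv (𝓡 m) (𝓡 (2 * n + 1)) f p w) -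
      S.g (f p) (S.φ (f p) (covAlong S.g f (fun q => mfderiv (𝓡 m) (𝓡 (2 * n + 1)) f q (Z q)) p u)) (mfderiv (𝓡 m) (𝓡 (2 * n + 1)) f p w) -
      S.g (f p) (S.P (f p) (mfderiv (𝓡 m) (𝓡 (2 * n + 1)) f p u) (mfderiv (𝓡 m) (𝓡 (2 * n + 1)) f p (Z p))) (mfderiv (𝓡 m) (𝓡 (2 * n + 1)) f p w) := by
  have h1 := g_shapeOp (m := m) (ζ := S.F f Z) S.isRiemannianForm_g hf u w
  have h2 := covAlong_sub S.isRiemannianForm_g (smoothAlongAt_φ (S := S) hf hZ p)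
    (SmoothVFAt.pushforward (hf.1 p) (isSmoothVF_T (S := S) hf hZ p)) u
  have h3 := covAlong_end (g := S.g) (S.contMDiffAt_endCoeff (f p))
    (SmoothVFAt.pushforward (hf.1 p) (hZ p)) u
  rw [h3] at h2
  refine h1.trans ?_
  rw [F_eq, h2, ContinuousLinearMap.map_sub₂, ContinuousLinearMap.map_add₂]
  show -(_ + S.g (f p) (S.P (f p) (mfderiv (𝓡 m) (𝓡 (2 * n + 1)) f p u) (mfderiv (𝓡 m) (𝓡 (2 * n + 1)) f p (Z p))) (mfderiv (𝓡 m) (𝓡 (2 * n + 1)) f p w) - _) = _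
  ring

namespace IsPointwiseSemiSlant

variable (hM : S.IsPointwiseSemiSlant f D₁ θ) {p : M}
include hM

theorem push_tanφ {u : TangentSpace (𝓡 m) p} (hu : u ∈ D₁ p) :
    S.tanφ f p u ∈ D₁ p ∧ mfderiv (𝓡 m) (𝓡 (2 * n + 1)) f p (S.tanφ f p u) = S.φ (f p) (mfderiv (𝓡 m) (𝓡 (2 * n + 1)) f p u) := by
  obtain ⟨w, hw, h⟩ := hM.2.2.1 p u hu
  have h1 : S.tanφ f p u = w := by
    rw [tanφ, ← h, tanPart_mfderiv S.isRiemannianForm_g (hM.1.2 p)]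
  rw [h1]
  exact ⟨hw, h⟩

/-- `T` is skew and preserves `D₁`, so it preserves the orthogonal complement. -/
theorem tanφ_mem {z : TangentSpace (𝓡 m) p} (hz : z ∈ S.D₂ f D₁ p) :
    S.tanφ f p z ∈ S.D₂ f D₁ p := fun u hu => by
  have h := gM_tanφ_skew (S := S) hM.1 u z
  rw [hz _ (hM.push_tanφ hu).1] at h
  linarith

/-- For `ξ` tangent, split `ξ = x + y` along `D₁` and `D₂`. From `φξ = 0` the components `Tx` and
`Ty` add up to zero while being orthogonal, so `φx = 0` and then `φy = 0`. As `φ` has no zeros on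
`D₂` except `0`, `ξ` lies in `D₁`. -/
theorem η_push_eq_zero (hξ : S.XiTangent (m := m) f ∨ S.XiNormal (m := m) f)
    {z : TangentSpace (𝓡 m) p} (hz : z ∈ S.D₂ f D₁ p) : S.η (f p) (mfderiv (𝓡 m) (𝓡 (2 * n + 1)) f p z) = 0 := by
  have hgM := isRiemannianForm_gM (S := S) hM.1
  rw [← g_ξ]
  rcases hξ with hξ | hξ
  · obtain ⟨v, hv⟩ := hξ p
    obtain ⟨x, hx, y, hy, rfl⟩ := exists_add_of_orthoCompl hgM D₁ p v
    have h1 : S.tanφ f p (x + y) = 0 := by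
      refine hgM.ext_iff.2 fun w => ?_
      rw [gM_tanφ hM.1, hv, φ_ξ, ContinuousLinearMap.map_zero₂, ContinuousLinearMap.map_zero₂]
    rw [tanφ_add hM.1] at h1
    have h2 : S.tanφ f p x = 0 := by
      have h3 : S.tanφ f p x = -S.tanφ f p y := eq_neg_of_add_eq_zero_left h1
      by_contra hne
      refine (hgM.pos p _ hne).ne' ((hM.tanφ_mem hy) _ (hM.push_tanφ hx).1 |> fun h => ?_)
      nth_rewrite 2 [h3]
      rw [map_neg, h, neg_zero]
    have h3 : S.φ (f p) (mfderiv (𝓡 m) (𝓡 (2 * n + 1)) f p y) = 0 := by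
      have h4 : S.φ (f p) (mfderiv (𝓡 m) (𝓡 (2 * n + 1)) f p (x + y)) = 0 := by rw [hv, φ_ξ]
      rw [map_add, map_add, ← (hM.push_tanφ hx).2, h2, map_zero, zero_add] at h4
      exact h4
    have h4 : y = 0 := by
      by_contra hne
      exact (hM.2.2.2 p y hy hne).1 h3
    rw [h4, add_zero] at hv
    rw [← hv, S.isRiemannianForm_g.symm]
    exact hz x hx
  · rw [S.isRiemannianForm_g.symm]
    exact hξ p z

/-- The projection of `φz` to `D₂` is `Tz`, and `φz` has the length of `z` because `η z = 0`; the
cosine of the slant angle is the quotient of the two lengths. -/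
theorem gM_tanφ_self (hξ : S.XiTangent (m := m) f ∨ S.XiNormal (m := m) f)
    (hθ : θ p ∈ Ioo 0 (Real.pi / 2)) {z : TangentSpace (𝓡 m) p} (hz : z ∈ S.D₂ f D₁ p) :
    S.gM f p (S.tanφ f p z) (S.tanφ f p z) = Real.cos (θ p) ^ 2 * S.gM f p z z := by
  have hgM := isRiemannianForm_gM (S := S) hM.1
  have hg := S.isRiemannianForm_g
  rcases eq_or_ne z 0 with rfl | hne
  · have h0 : S.tanφ f p (0 : TangentSpace (𝓡 m) p) = 0 := by
      have := tanφ_add (S := S) hM.1 (0 : TangentSpace (𝓡 m) p) 0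
      rw [add_zero] at this
      exact left_eq_add.1 this
    rw [h0, map_zero, mul_zero]
  obtain ⟨h1, h2⟩ := hM.2.2.2 p z hz hne
  let W : Submodule ℝ (TangentSpace (𝓡 (2 * n + 1)) (f p)) :=
    (S.D₂ f D₁ p).map (mfderiv (𝓡 m) (𝓡 (2 * n + 1)) f p).toLinearMap
  let t : W := ⟨mfderiv (𝓡 m) (𝓡 (2 * n + 1)) f p (S.tanφ f p z), Submodule.mem_map_of_mem (hM.tanφ_mem hz)⟩
  have h3 : pullProj (S.g (f p)) W.subtypeL (S.φ (f p) (mfderiv (𝓡 m) (𝓡 (2 * n + 1)) f p z)) = t := by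
    refine pullProj_eq (hg.pos _) W.injective_subtype ?_
    rintro ⟨_, w, hw, rfl⟩
    exact gM_tanφ (S := S) hM.1 z w
  have h4 : S.g (f p) (S.φ (f p) (mfderiv (𝓡 m) (𝓡 (2 * n + 1)) f p z)) (S.φ (f p) (mfderiv (𝓡 m) (𝓡 (2 * n + 1)) f p z)) = S.gM f p z z := by
    rw [compat_g, hM.η_push_eq_zero hξ hz, mul_zero, sub_zero]
    rfl
  have h5 : angleToSubspace (S.g (f p)) (S.φ (f p) (mfderiv (𝓡 m) (𝓡 (2 * n + 1)) f p z)) W =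
      Real.arccos (Real.sqrt (S.gM f p (S.tanφ f p z) (S.tanφ f p z)) /
        Real.sqrt (S.gM f p z z)) := by
    unfold angleToSubspace
    rw [h3, h4]
    rfl
  have hpos := hgM.pos p z hne
  have hnn : 0 ≤ S.gM f p (S.tanφ f p z) (S.tanφ f p z) := by
    rcases eq_or_ne (S.tanφ f p z) 0 with h | h
    · rw [h, map_zero]
    · exact (hgM.pos p _ h).le
  have h6 := h5.symm.trans h2
  generalize S.gM f p (S.tanφ f p z) (S.tanφ f p z) = a at h6 hnn ⊢
  generalize S.gM f p z z = b at h6 hpos ⊢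
  -- `Real.arccos` is zero on arguments above `1`, so `0 < θ p` already excludes a larger quotient.
  have h7 : Real.sqrt a / Real.sqrt b ≤ 1 := by
    by_contra hlt
    rw [Real.arccos_of_one_le (not_le.1 hlt).le] at h6
    exact hθ.1.ne h6
  rw [← h6, Real.cos_arccos (by linarith [show 0 ≤ Real.sqrt a / Real.sqrt b by positivity]) h7,
    div_pow, Real.sq_sqrt hnn, Real.sq_sqrt hpos.le, div_mul_cancel₀ _ hpos.ne']

/-- The pointwise slant condition. -/
theorem tanφ_tanφ (hξ : S.XiTangent (m := m) f ∨ S.XiNormal (m := m) f)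
    (hθ : θ p ∈ Ioo 0 (Real.pi / 2)) {z : TangentSpace (𝓡 m) p} (hz : z ∈ S.D₂ f D₁ p) :
    S.tanφ f p (S.tanφ f p z) = -(Real.cos (θ p) ^ 2 • z) := by
  have hgM := isRiemannianForm_gM (S := S) hM.1
  refine hgM.ext_iff.2 fun v => ?_
  obtain ⟨x, hx, w, hw, rfl⟩ := exists_add_of_orthoCompl hgM D₁ p v
  have h1 := hM.gM_tanφ_self hξ hθ hz
  have h2 := hM.gM_tanφ_self hξ hθ hw
  have h3 := hM.gM_tanφ_self hξ hθ (add_mem hz hw)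
  -- Polarization of `gM_tanφ_self`, followed by skewness of `T`.
  have hadd : ∀ a b : TangentSpace (𝓡 m) p, S.gM f p (a + b) (a + b) =
      S.gM f p a a + 2 * S.gM f p a b + S.gM f p b b := fun a b => by
    rw [ContinuousLinearMap.map_add₂, map_add, map_add, hgM.symm p b a]
    ring
  rw [tanφ_add hM.1, hadd, hadd] at h3
  have h4 : S.gM f p (S.tanφ f p (S.tanφ f p z)) x = 0 := by
    rw [hgM.symm]; exact hM.tanφ_mem (hM.tanφ_mem hz) x hx
  have h5 : S.gM f p z x = 0 := by rw [hgM.symm]; exact hz x hx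
  have h6 : S.gM f p (-(Real.cos (θ p) ^ 2 • z)) (x + w) =
      -(Real.cos (θ p) ^ 2 * (S.gM f p z x + S.gM f p z w)) := by
    rw [map_add, ← neg_smul, ContinuousLinearMap.map_smul₂, ContinuousLinearMap.map_smul₂,
      smul_eq_mul, smul_eq_mul]
    ring
  rw [h6, map_add, h4, h5, gM_tanφ_skew hM.1]
  linarith

theorem isSectionOf_T {Z : ∀ q : M, TangentSpace (𝓡 m) q} (hZ : IsSectionOf (S.D₂ f D₁) Z) :
    IsSectionOf (S.D₂ f D₁) (S.T f Z) :=
  ⟨isSmoothVF_T hM.1 hZ.1, fun q => hM.tanφ_mem (hZ.2 q)⟩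

theorem gM_leviCivita {X Z : ∀ q : M, TangentSpace (𝓡 m) q} (hX : IsSectionOf D₁ X)
    (hZ : IsSectionOf (S.D₂ f D₁) Z) (u : TangentSpace (𝓡 m) p) :
    S.gM f p (leviCivita (S.gM f) Z p u) (X p) =
      -S.gM f p (Z p) (leviCivita (S.gM f) X p u) := by
  have hgM := isRiemannianForm_gM (S := S) hM.1
  have h1 := derivAt_metric (f := fun q : M => q) hgM (hZ.1 p) (hX.1 p) u
  have h2 : (fun q => S.gM f q (Z q) (X q)) = fun _ => 0 :=
    funext fun q => (hgM.symm q _ _).trans (hZ.2 q _ (hX.2 q))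
  rw [h2, derivAt_const] at h1
  have h3 : (0 : ℝ) = _ := h1
  unfold leviCivita
  linarith

/-- Derivative of `η(Z) = 0`, which holds along the whole submanifold. -/
theorem η_covAlong (hξ : S.XiTangent (m := m) f ∨ S.XiNormal (m := m) f)
    {Z : ∀ q : M, TangentSpace (𝓡 m) q} (hZ : IsSectionOf (S.D₂ f D₁) Z)
    (u : TangentSpace (𝓡 m) p) :
    S.η (f p) (covAlong S.g f (fun q => mfderiv (𝓡 m) (𝓡 (2 * n + 1)) f q (Z q)) p u) =
      -S.g (f p) (mfderiv (𝓡 m) (𝓡 (2 * n + 1)) f p (Z p)) (S.α (f p) (mfderiv (𝓡 m) (𝓡 (2 * n + 1)) f p u)) := by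
  have hξs : SmoothAlongAt (m := m) f (fun q => S.ξ (f q)) p :=
    SmoothAlongAt.comp (f := fun y : N => y) (S.smooth_ξ (f p)) (hM.1.1 p)
  have h1 := derivAt_metric S.isRiemannianForm_g (SmoothVFAt.pushforward (hM.1.1 p) (hZ.1 p)) hξs u
  have h2 : (fun q => S.g (f q) (mfderiv (𝓡 m) (𝓡 (2 * n + 1)) f q (Z q)) (S.ξ (f q))) = fun _ => 0 :=
    funext fun q => (g_ξ _ _).trans (hM.η_push_eq_zero hξ (hZ.2 q))
  have h3 : covAlong S.g f (fun q => S.ξ (f q)) p u = S.α (f p) (mfderiv (𝓡 m) (𝓡 (2 * n + 1)) f p u) :=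
    covAlong_comp (f := fun y : N => y) hξs.mdiff_base (S.smooth_ξ (f p)) u
  rw [h2, derivAt_const, h3, g_ξ] at h1
  have h4 : (0 : ℝ) = _ := h1
  linarith

variable [T2Space M]

/-- Self-adjointness moves `u` into the differentiating slot of both shape operators, where `FZ = φZ
- TZ` is expanded. The terms in `∇_u(TZ)` cancel because `φ` is skew. What remains is `-g(φ∇_u Z,
φX) - g(∇_u T²Z, X)`, up to `∇φ`; the first term contributes `-1` and the second `cos²θ` to the
factor of `g(∇_u Z, X)`. -/
theorem gM_shapeDefect (hξ : S.XiTangent (m := m) f ∨ S.XiNormal (m := m) f)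
    (hθ : θ p ∈ Ioo 0 (Real.pi / 2))
    {X Z : ∀ q : M, TangentSpace (𝓡 m) q} (hX : IsSectionOf D₁ X)
    (hZ : IsSectionOf (S.D₂ f D₁) Z) (u : TangentSpace (𝓡 m) p) :
    S.gM f p (S.shapeDefect f X Z p) u =
      -(Real.sin (θ p) ^ 2 * S.gM f p (leviCivita (S.gM f) Z p u) (X p)) -
      S.g (f p) (mfderiv (𝓡 m) (𝓡 (2 * n + 1)) f p (Z p)) (S.α (f p) (mfderiv (𝓡 m) (𝓡 (2 * n + 1)) f p u)) * S.η (f p) (mfderiv (𝓡 m) (𝓡 (2 * n + 1)) f p (X p)) -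
      S.g (f p) (S.P (f p) (mfderiv (𝓡 m) (𝓡 (2 * n + 1)) f p u) (mfderiv (𝓡 m) (𝓡 (2 * n + 1)) f p (Z p))) (S.φ (f p) (mfderiv (𝓡 m) (𝓡 (2 * n + 1)) f p (X p))) +
      S.g (f p) (S.P (f p) (mfderiv (𝓡 m) (𝓡 (2 * n + 1)) f p u) (mfderiv (𝓡 m) (𝓡 (2 * n + 1)) f p (S.tanφ f p (Z p)))) (mfderiv (𝓡 m) (𝓡 (2 * n + 1)) f p (X p)) := by
  have hg := S.isRiemannianForm_g
  have hTZ := hM.isSectionOf_T hZ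
  have hTTZ := hM.isSectionOf_T hTZ
  have hA : S.gM f p (shapeOp S.g f (S.F f Z) p (S.T f X p)) u =
      S.gM f p (shapeOp S.g f (S.F f Z) p u) (S.T f X p) :=
    g_shapeOp_symm hg hM.1 (smoothAlongAt_F hM.1 hZ.1 p) (g_F hM.1 Z) _ _
  have hB : S.gM f p (shapeOp S.g f (S.F f (S.T f Z)) p (X p)) u =
      S.gM f p (shapeOp S.g f (S.F f (S.T f Z)) p u) (X p) :=
    g_shapeOp_symm hg hM.1 (smoothAlongAt_F hM.1 hTZ.1 p) (g_F hM.1 _) _ _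
  have hC : S.g (f p) (covAlong S.g f (fun q => mfderiv (𝓡 m) (𝓡 (2 * n + 1)) f q (S.T f (S.T f Z) q)) p u) (mfderiv (𝓡 m) (𝓡 (2 * n + 1)) f p (X p)) =
      S.gM f p (leviCivita (S.gM f) (S.T f (S.T f Z)) p u) (X p) :=
    g_covAlong_mfderiv hg hM.1 hTTZ.1 u (X p)
  have hD : S.g (f p) (covAlong S.g f (fun q => mfderiv (𝓡 m) (𝓡 (2 * n + 1)) f q (Z q)) p u) (mfderiv (𝓡 m) (𝓡 (2 * n + 1)) f p (X p)) =
      S.gM f p (leviCivita (S.gM f) Z p u) (X p) :=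
    g_covAlong_mfderiv hg hM.1 hZ.1 u (X p)
  have hE : S.T f (S.T f Z) p = -(Real.cos (θ p) ^ 2 • Z p) := hM.tanφ_tanφ hξ hθ (hZ.2 p)
  have hTX : mfderiv (𝓡 m) (𝓡 (2 * n + 1)) f p (S.T f X p) = S.φ (f p) (mfderiv (𝓡 m) (𝓡 (2 * n + 1)) f p (X p)) := (hM.push_tanφ (hX.2 p)).2
  -- The derivative is shifted from `T²Z` to `X`, so that `T²Z = -cos²θ Z` is used at `p` only. No
  -- derivative of `θ` occurs.
  have hF := hM.gM_leviCivita (p := p) hX hTTZ u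
  rw [hE, ← neg_smul, ContinuousLinearMap.map_smul₂, smul_eq_mul] at hF
  have hG := hM.gM_leviCivita (p := p) hX hZ u
  have hH := φ_skew (S := S) (f p) (covAlong S.g f (fun q => mfderiv (𝓡 m) (𝓡 (2 * n + 1)) f q (S.T f Z q)) p u) (mfderiv (𝓡 m) (𝓡 (2 * n + 1)) f p (X p))
  have hI := compat_g (S := S) (f p) (covAlong S.g f (fun q => mfderiv (𝓡 m) (𝓡 (2 * n + 1)) f q (Z q)) p u) (mfderiv (𝓡 m) (𝓡 (2 * n + 1)) f p (X p))
  rw [hM.η_covAlong hξ hZ] at hI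
  rw [shapeDefect, ContinuousLinearMap.map_sub₂, hA, hB, gM_shapeOp_F hM.1 hZ.1,
    gM_shapeOp_F hM.1 hTZ.1, hTX, hC, hF, hH, hI, hD, Real.sin_sq]
  show _ = _ + S.g (f p) (S.P (f p) (mfderiv (𝓡 m) (𝓡 (2 * n + 1)) f p u) (mfderiv (𝓡 m) (𝓡 (2 * n + 1)) f p (S.T f Z p))) (mfderiv (𝓡 m) (𝓡 (2 * n + 1)) f p (X p))
  rw [hG]
  ring

end IsPointwiseSemiSlant

end AlmostContactMetric

/-! ### The main identity in the three classes and the resulting criteria -/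

namespace AlmostContactMetric

variable {m n : ℕ} {N : Type*} [TopologicalSpace N] [ChartedSpace (Eu (2 * n + 1)) N]
  [IsManifold (𝓡 (2 * n + 1)) ∞ N] {S : AlmostContactMetric n N}
  {M : Type*} [TopologicalSpace M] [ChartedSpace (Eu m) M] [IsManifold (𝓡 m) ∞ M]
  {f : M → N} {D₁ : SubspaceField m M} {θ : M → ℝ} [T2Space N] [T2Space M]
  {X Z : ∀ q : M, TangentSpace (𝓡 m) q}

namespace IsProperPointwiseSemiSlant

theorem gM_shapeDefect_of_isCosymplectic (hM : S.IsProperPointwiseSemiSlant f D₁ θ)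
    (hξ : S.XiTangent (m := m) f ∨ S.XiNormal (m := m) f) (hS : S.IsCosymplectic)
    (hX : IsSectionOf D₁ X) (hZ : IsSectionOf (S.D₂ f D₁) Z) {p : M} (u : TangentSpace (𝓡 m) p) :
    S.gM f p (S.shapeDefect f X Z p) u =
      -(Real.sin (θ p) ^ 2 * S.gM f p (leviCivita (S.gM f) Z p u) (X p)) := by
  rw [hM.1.gM_shapeDefect hξ (hM.2 p) hX hZ, α_eq, hS.P_eq_zero, hS.P_eq_zero, hS.P_eq_zero,
    map_zero, map_zero, ContinuousLinearMap.map_zero₂, ContinuousLinearMap.map_zero₂]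
  ring

/-- Here `∇_u ξ = -φu`, so the `∇ξ` term is `g(Z, φu) η(X)`; the term with `TZ` is `g(u, TZ) η(X)`,
its negative. The remaining one pairs `ξ` with `φX` and vanishes. -/
theorem gM_shapeDefect_of_isSasakian (hM : S.IsProperPointwiseSemiSlant f D₁ θ)
    (hξ : S.XiTangent (m := m) f ∨ S.XiNormal (m := m) f) (hS : S.IsSasakian)
    (hX : IsSectionOf D₁ X) (hZ : IsSectionOf (S.D₂ f D₁) Z) {p : M} (u : TangentSpace (𝓡 m) p) :
    S.gM f p (S.shapeDefect f X Z p) u =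
      -(Real.sin (θ p) ^ 2 * S.gM f p (leviCivita (S.gM f) Z p u) (X p)) := by
  have hg := S.isRiemannianForm_g
  have h1 := hM.1.η_push_eq_zero hξ (hZ.2 p)
  have h2 := hM.1.η_push_eq_zero hξ (hM.1.tanφ_mem (hZ.2 p))
  have h3 : S.g (f p) (mfderiv (𝓡 m) (𝓡 (2 * n + 1)) f p u) (mfderiv (𝓡 m) (𝓡 (2 * n + 1)) f p (S.tanφ f p (Z p))) =
      S.g (f p) (S.φ (f p) (mfderiv (𝓡 m) (𝓡 (2 * n + 1)) f p (Z p))) (mfderiv (𝓡 m) (𝓡 (2 * n + 1)) f p u) := by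
    rw [hg.symm]
    exact gM_tanφ (S := S) hM.1.1 (Z p) u
  have h4 := φ_skew (S := S) (f p) (mfderiv (𝓡 m) (𝓡 (2 * n + 1)) f p (Z p)) (mfderiv (𝓡 m) (𝓡 (2 * n + 1)) f p u)
  rw [hM.1.gM_shapeDefect hξ (hM.2 p) hX hZ, α_eq, hS.P_eq, hS.P_eq, hS.P_eq, h1, h2, h3, h4,
    S.η_ξ, one_smul, zero_smul, sub_zero, sub_zero, map_sub, map_smul, φ_ξ, smul_zero,
    zero_sub, map_neg, ContinuousLinearMap.map_smul₂, ContinuousLinearMap.map_smul₂,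
    hg.symm (f p) (S.ξ (f p)), hg.symm (f p) (S.ξ (f p)), g_ξ, g_ξ, η_φ, smul_eq_mul, smul_eq_mul]
  ring

/-- Here `∇_u ξ = u - η(u)ξ`, so the `∇ξ` term is `-g(u, Z) η(X)`; the term with `TZ` returns
`cos²θ` times its negative through `T² = -cos²θ`. The sum is the `sin²θ` correction. -/
theorem gM_shapeDefect_of_isKenmotsu (hM : S.IsProperPointwiseSemiSlant f D₁ θ)
    (hξ : S.XiTangent (m := m) f ∨ S.XiNormal (m := m) f) (hS : S.IsKenmotsu)
    (hX : IsSectionOf D₁ X) (hZ : IsSectionOf (S.D₂ f D₁) Z) {p : M} (u : TangentSpace (𝓡 m) p) :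
    S.gM f p (S.shapeDefect f X Z p) u =
      -(Real.sin (θ p) ^ 2 * S.gM f p (leviCivita (S.gM f) Z p u) (X p)) -
      Real.sin (θ p) ^ 2 * S.η (f p) (mfderiv (𝓡 m) (𝓡 (2 * n + 1)) f p (X p)) * S.gM f p u (Z p) := by
  have hg := S.isRiemannianForm_g
  have h1 := hM.1.η_push_eq_zero hξ (hZ.2 p)
  have h2 := hM.1.η_push_eq_zero hξ (hM.1.tanφ_mem (hZ.2 p))
  have h3 : S.g (f p) (S.φ (f p) (mfderiv (𝓡 m) (𝓡 (2 * n + 1)) f p u)) (mfderiv (𝓡 m) (𝓡 (2 * n + 1)) f p (S.tanφ f p (Z p))) =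
      Real.cos (θ p) ^ 2 * S.gM f p u (Z p) := by
    refine (gM_tanφ (S := S) hM.1.1 u (S.tanφ f p (Z p))).symm.trans ?_
    rw [gM_tanφ_skew hM.1.1, hM.1.tanφ_tanφ hξ (hM.2 p) (hZ.2 p), map_neg, map_smul, smul_eq_mul,
      neg_neg]
  have h4 : S.g (f p) (mfderiv (𝓡 m) (𝓡 (2 * n + 1)) f p (Z p)) (S.φ (f p) (S.φ (f p) (mfderiv (𝓡 m) (𝓡 (2 * n + 1)) f p u))) = -S.gM f p u (Z p) := by
    rw [S.φ_φ, map_add, map_smul, g_ξ, h1, smul_zero, add_zero, map_neg, hg.symm]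
    rfl
  rw [hM.1.gM_shapeDefect hξ (hM.2 p) hX hZ, α_eq, hS.P_eq, hS.P_eq, hS.P_eq, h1, h2, h3,
    S.η_ξ, one_smul, zero_smul, sub_zero, sub_zero, map_sub, map_smul, φ_ξ, smul_zero,
    zero_sub, map_neg, h4, ContinuousLinearMap.map_smul₂, ContinuousLinearMap.map_smul₂,
    hg.symm (f p) (S.ξ (f p)), hg.symm (f p) (S.ξ (f p)), g_ξ, g_ξ, η_φ, smul_eq_mul, smul_eq_mul,
    Real.sin_sq]
  ring

theorem sin_sq_ne_zero (hM : S.IsProperPointwiseSemiSlant f D₁ θ) (p : M) :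
    Real.sin (θ p) ^ 2 ≠ 0 :=
  pow_ne_zero _ (Real.sin_pos_of_pos_of_lt_pi (hM.2 p).1
    (by linarith [(hM.2 p).2, Real.pi_pos])).ne'

theorem isTotallyGeodesic_D₂_iff (hM : S.IsProperPointwiseSemiSlant f D₁ θ) :
    IsTotallyGeodesic (S.gM f) (S.D₂ f D₁) ↔ ∀ X Z W, IsSectionOf D₁ X →
      IsSectionOf (S.D₂ f D₁) Z → IsSectionOf (S.D₂ f D₁) W →
      ∀ p, S.gM f p (leviCivita (S.gM f) Z p (W p)) (X p) = 0 := by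
  have hgM := isRiemannianForm_gM (S := S) hM.1.1
  have h : orthoCompl (S.gM f) (S.D₂ f D₁) = D₁ := orthoCompl_orthoCompl hgM D₁
  unfold IsTotallyGeodesic
  rw [h]
  constructor
  · intro hT X Z W hX hZ hW p
    rw [hM.1.gM_leviCivita hX hZ, hgM.symm, hT W Z X hW hZ hX p, neg_zero]
  · intro hT W Z X hW hZ hX p
    have := hT X Z W hX hZ hW p
    rw [hM.1.gM_leviCivita hX hZ, hgM.symm] at this
    exact neg_eq_zero.1 this

/-- Since `sin²θ ≠ 0`, the defect and the second fundamental form vanish together, the roles of the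
two sections of `D₁` being exchanged. -/
theorem definesTotallyGeodesicFoliation_D₁_iff (hM : S.IsProperPointwiseSemiSlant f D₁ θ)
    (h : ∀ X Y Z, IsSectionOf D₁ X → IsSectionOf D₁ Y → IsSectionOf (S.D₂ f D₁) Z → ∀ p,
      S.gM f p (S.shapeDefect f X Z p) (Y p) =
        -(Real.sin (θ p) ^ 2 * S.gM f p (leviCivita (S.gM f) Z p (Y p)) (X p))) :
    DefinesTotallyGeodesicFoliation (S.gM f) D₁ ↔ ∀ X Y Z, IsSectionOf D₁ X →
      IsSectionOf D₁ Y → IsSectionOf (S.D₂ f D₁) Z →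
      ∀ p, S.gM f p (S.shapeDefect f X Z p) (Y p) = 0 := by
  rw [definesTotallyGeodesicFoliation_iff (isRiemannianForm_gM hM.1.1) hM.1.2.1]
  constructor
  · intro hT X Y Z hX hY hZ p
    rw [h X Y Z hX hY hZ, hT Y X Z hY hX hZ p, mul_zero, neg_zero]
  · intro hT Y X Z hY hX hZ p
    have := hT X Y Z hX hY hZ p
    rw [h X Y Z hX hY hZ] at this
    exact (mul_eq_zero.1 (neg_eq_zero.1 this)).resolve_left (hM.sin_sq_ne_zero p)

/-- The criterion is stated for an arbitrary expression `c`, so that the Kenmotsu case with its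
correction term is an instance. -/
theorem definesTotallyGeodesicFoliation_D₂_iff (hM : S.IsProperPointwiseSemiSlant f D₁ θ)
    {c : (∀ q : M, TangentSpace (𝓡 m) q) → (∀ q : M, TangentSpace (𝓡 m) q) →
      (∀ q : M, TangentSpace (𝓡 m) q) → M → ℝ}
    (h : ∀ X Z W, IsSectionOf D₁ X → IsSectionOf (S.D₂ f D₁) Z → IsSectionOf (S.D₂ f D₁) W → ∀ p,
      c X Z W p = -(Real.sin (θ p) ^ 2 * S.gM f p (leviCivita (S.gM f) Z p (W p)) (X p))) :
    DefinesTotallyGeodesicFoliation (S.gM f) (S.D₂ f D₁) ↔ ∀ X Z W, IsSectionOf D₁ X →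
      IsSectionOf (S.D₂ f D₁) Z → IsSectionOf (S.D₂ f D₁) W → ∀ p, c X Z W p = 0 := by
  have hgM := isRiemannianForm_gM (S := S) hM.1.1
  have hD : IsDistribution (S.D₂ f D₁) := hM.1.2.1.orthoCompl hgM
  rw [definesTotallyGeodesicFoliation_iff hgM hD, hM.isTotallyGeodesic_D₂_iff]
  refine forall₃_congr fun X Z W => forall₃_congr fun hX hZ hW => forall_congr' fun p => ?_
  rw [h X Z W hX hZ hW, neg_eq_zero, mul_eq_zero, or_iff_right (hM.sin_sq_ne_zero p)]

theorem isLocallyRiemannianProduct_iff (hM : S.IsProperPointwiseSemiSlant f D₁ θ)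
    (h : ∀ X Z, IsSectionOf D₁ X → IsSectionOf (S.D₂ f D₁) Z → ∀ (p : M) (u : TangentSpace (𝓡 m) p),
      S.gM f p (S.shapeDefect f X Z p) u =
        -(Real.sin (θ p) ^ 2 * S.gM f p (leviCivita (S.gM f) Z p u) (X p))) :
    IsLocallyRiemannianProduct (S.gM f) D₁ (S.D₂ f D₁) ↔ ∀ X Z, IsSectionOf D₁ X →
      IsSectionOf (S.D₂ f D₁) Z → ∀ p, shapeOp S.g f (S.F f Z) p (S.T f X p) =
        shapeOp S.g f (S.F f (S.T f Z)) p (X p) := by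
  have hgM := isRiemannianForm_gM (S := S) hM.1.1
  have hD := hM.1.2.1
  have hD' : IsDistribution (S.D₂ f D₁) := hD.orthoCompl hgM
  refine (SemiSlant.isLocallyRiemannianProduct_iff hgM hD).trans ?_
  rw [← definesTotallyGeodesicFoliation_iff hgM hD,
    ← definesTotallyGeodesicFoliation_iff hgM (hD.orthoCompl hgM),
    hM.definesTotallyGeodesicFoliation_D₁_iff fun X Y Z hX _ hZ p => h X Z hX hZ p (Y p)]
  refine (and_congr_right fun _ => hM.definesTotallyGeodesicFoliation_D₂_iff
    fun X Z W hX hZ _ p => h X Z hX hZ p (W p)).trans ⟨fun ⟨h₁, h₂⟩ X Z hX hZ p => ?_, fun h' => ?_⟩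
  · refine sub_eq_zero.1 (hgM.ext_iff.2 fun u => ?_)
    -- The two foliation criteria test the defect against `D₁` and against `D₂`; these span the
    -- tangent space, so together they say that the defect is zero.
    obtain ⟨y, hy, w, hw, rfl⟩ := exists_add_of_orthoCompl hgM D₁ p u
    obtain ⟨Y, hY, rfl⟩ := hD.exists_section hy
    obtain ⟨W, hW, rfl⟩ := hD'.exists_section hw
    rw [ContinuousLinearMap.map_zero₂, map_add]
    exact (congrArg₂ (· + ·) (h₁ X Y Z hX hY hZ p) (h₂ X Z W hX hZ hW p)).trans (add_zero 0)
  · have h0 : ∀ X Z, IsSectionOf D₁ X → IsSectionOf (S.D₂ f D₁) Z → ∀ p,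
        S.shapeDefect f X Z p = 0 := fun X Z hX hZ p => sub_eq_zero.2 (h' X Z hX hZ p)
    refine ⟨fun X Y Z hX _ hZ p => ?_, fun X Z W hX hZ _ p => ?_⟩ <;>
    rw [h0 X Z hX hZ, ContinuousLinearMap.map_zero₂]

end IsProperPointwiseSemiSlant

end AlmostContactMetric

end SemiSlant

end

theorem theorem8p5 {m n : ℕ}
    {N : Type*} [TopologicalSpace N] [T2Space N]
    [ChartedSpace (SemiSlant.Eu (2 * n + 1)) N] [IsManifold (𝓡 (2 * n + 1)) ∞ N]
    {M : Type*} [TopologicalSpace M] [T2Space M]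
    [ChartedSpace (SemiSlant.Eu m) M] [IsManifold (𝓡 m) ∞ M]
    (S : SemiSlant.AlmostContactMetric n N) (f : M → N)
    (D₁ : SemiSlant.SubspaceField m M) (θ : M → ℝ)
    (hM : S.IsProperPointwiseSemiSlant f D₁ θ) :
    -- `ξ` tangent: criterion for `D₁`
    (S.XiTangent (m := m) f → S.IsCosymplectic ∨ S.IsSasakian ∨ S.IsKenmotsu →
      (SemiSlant.DefinesTotallyGeodesicFoliation (S.gM f) D₁ ↔
        ∀ X Y Z : ∀ p : M, TangentSpace (𝓡 m) p, SemiSlant.IsSectionOf D₁ X →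
          SemiSlant.IsSectionOf D₁ Y → SemiSlant.IsSectionOf (S.D₂ f D₁) Z →
          ∀ p, S.gM f p (S.shapeDefect f X Z p) (Y p) = 0)) ∧
    -- `ξ` normal: criterion for `D₁`
    (S.XiNormal (m := m) f → S.IsCosymplectic ∨ S.IsKenmotsu →
      (SemiSlant.DefinesTotallyGeodesicFoliation (S.gM f) D₁ ↔
        ∀ X Y Z : ∀ p : M, TangentSpace (𝓡 m) p, SemiSlant.IsSectionOf D₁ X →
          SemiSlant.IsSectionOf D₁ Y → SemiSlant.IsSectionOf (S.D₂ f D₁) Z →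
          ∀ p, S.gM f p (S.shapeDefect f X Z p) (Y p) = 0)) ∧
    -- `ξ` normal: criterion for `D₂`
    (S.XiNormal (m := m) f → S.IsCosymplectic ∨ S.IsKenmotsu →
      (SemiSlant.DefinesTotallyGeodesicFoliation (S.gM f) (S.D₂ f D₁) ↔
        ∀ X Z W : ∀ p : M, TangentSpace (𝓡 m) p, SemiSlant.IsSectionOf D₁ X →
          SemiSlant.IsSectionOf (S.D₂ f D₁) Z → SemiSlant.IsSectionOf (S.D₂ f D₁) W →
          ∀ p, S.gM f p (S.shapeDefect f X Z p) (W p) = 0)) ∧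
    -- `ξ` tangent: criterion for `D₂`, cosymplectic and Sasakian cases
    (S.XiTangent (m := m) f → S.IsCosymplectic ∨ S.IsSasakian →
      (SemiSlant.DefinesTotallyGeodesicFoliation (S.gM f) (S.D₂ f D₁) ↔
        ∀ X Z W : ∀ p : M, TangentSpace (𝓡 m) p, SemiSlant.IsSectionOf D₁ X →
          SemiSlant.IsSectionOf (S.D₂ f D₁) Z → SemiSlant.IsSectionOf (S.D₂ f D₁) W →
          ∀ p, S.gM f p (S.shapeDefect f X Z p) (W p) = 0)) ∧
    -- `ξ` tangent: criterion for `D₂`, Kenmotsu case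
    (S.XiTangent (m := m) f → S.IsKenmotsu →
      (SemiSlant.DefinesTotallyGeodesicFoliation (S.gM f) (S.D₂ f D₁) ↔
        ∀ X Z W : ∀ p : M, TangentSpace (𝓡 m) p, SemiSlant.IsSectionOf D₁ X →
          SemiSlant.IsSectionOf (S.D₂ f D₁) Z → SemiSlant.IsSectionOf (S.D₂ f D₁) W →
          ∀ p, S.gM f p (S.shapeDefect f X Z p) (W p) +
            Real.sin (θ p) ^ 2 * S.η (f p) (mfderiv (𝓡 m) (𝓡 (2 * n + 1)) f p (X p)) *
              S.gM f p (W p) (Z p) = 0)) ∧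
    -- `ξ` tangent: local Riemannian product
    (S.XiTangent (m := m) f → S.IsCosymplectic ∨ S.IsSasakian →
      (SemiSlant.IsLocallyRiemannianProduct (S.gM f) D₁ (S.D₂ f D₁) ↔
        ∀ X Z : ∀ p : M, TangentSpace (𝓡 m) p, SemiSlant.IsSectionOf D₁ X →
          SemiSlant.IsSectionOf (S.D₂ f D₁) Z →
          ∀ p, SemiSlant.shapeOp S.g f (S.F f Z) p (S.T f X p) =
            SemiSlant.shapeOp S.g f (S.F f (S.T f Z)) p (X p))) ∧
    -- `ξ` normal: local Riemannian product
    (S.XiNormal (m := m) f → S.IsCosymplectic ∨ S.IsKenmotsu →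
      (SemiSlant.IsLocallyRiemannianProduct (S.gM f) D₁ (S.D₂ f D₁) ↔
        ∀ X Z : ∀ p : M, TangentSpace (𝓡 m) p, SemiSlant.IsSectionOf D₁ X →
          SemiSlant.IsSectionOf (S.D₂ f D₁) Z →
          ∀ p, SemiSlant.shapeOp S.g f (S.F f Z) p (S.T f X p) =
            SemiSlant.shapeOp S.g f (S.F f (S.T f Z)) p (X p))) := by
  -- For `ξ` normal, `η` vanishes on tangent vectors and the Kenmotsu correction drops out.
  have hkn : S.XiNormal (m := m) f → S.IsKenmotsu → ∀ (X Z : ∀ p : M, TangentSpace (𝓡 m) p),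
      SemiSlant.IsSectionOf D₁ X → SemiSlant.IsSectionOf (S.D₂ f D₁) Z →
      ∀ (p : M) (u : TangentSpace (𝓡 m) p), S.gM f p (S.shapeDefect f X Z p) u =
        -(Real.sin (θ p) ^ 2 *
          S.gM f p (SemiSlant.leviCivita (S.gM f) Z p u) (X p)) := by
    intro hξ hS X Z hX hZ p u
    have h0 : S.η (f p) (mfderiv (𝓡 m) (𝓡 (2 * n + 1)) f p (X p)) = 0 := by
      rw [← SemiSlant.AlmostContactMetric.g_ξ, S.isRiemannianForm_g.symm]
      exact hξ p (X p)
    rw [hM.gM_shapeDefect_of_isKenmotsu (Or.inr hξ) hS hX hZ, h0, mul_zero, zero_mul, sub_zero]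
  have htan : S.XiTangent (m := m) f → S.IsCosymplectic ∨ S.IsSasakian →
      ∀ (X Z : ∀ p : M, TangentSpace (𝓡 m) p),
      SemiSlant.IsSectionOf D₁ X → SemiSlant.IsSectionOf (S.D₂ f D₁) Z →
      ∀ (p : M) (u : TangentSpace (𝓡 m) p), S.gM f p (S.shapeDefect f X Z p) u =
        -(Real.sin (θ p) ^ 2 *
          S.gM f p (SemiSlant.leviCivita (S.gM f) Z p u) (X p)) := by
    rintro hξ (hS | hS) X Z hX hZ p u
    · exact hM.gM_shapeDefect_of_isCosymplectic (Or.inl hξ) hS hX hZ u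
    · exact hM.gM_shapeDefect_of_isSasakian (Or.inl hξ) hS hX hZ u
  have hnor : S.XiNormal (m := m) f → S.IsCosymplectic ∨ S.IsKenmotsu →
      ∀ (X Z : ∀ p : M, TangentSpace (𝓡 m) p),
      SemiSlant.IsSectionOf D₁ X → SemiSlant.IsSectionOf (S.D₂ f D₁) Z →
      ∀ (p : M) (u : TangentSpace (𝓡 m) p), S.gM f p (S.shapeDefect f X Z p) u =
        -(Real.sin (θ p) ^ 2 *
          S.gM f p (SemiSlant.leviCivita (S.gM f) Z p u) (X p)) := by
    rintro hξ (hS | hS) X Z hX hZ p u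
    · exact hM.gM_shapeDefect_of_isCosymplectic (Or.inr hξ) hS hX hZ u
    · exact hkn hξ hS X Z hX hZ p u
  refine ⟨fun hξ hS => ?_, fun hξ hS => ?_, fun hξ hS => ?_, fun hξ hS => ?_, fun hξ hS => ?_,
    fun hξ hS => ?_, fun hξ hS => ?_⟩
  · refine hM.definesTotallyGeodesicFoliation_D₁_iff fun X Y Z hX hY hZ p => ?_
    rcases hS with hS | hS | hS
    · exact htan hξ (Or.inl hS) X Z hX hZ p _
    · exact htan hξ (Or.inr hS) X Z hX hZ p _
    -- For `ξ` tangent the correction is harmless on `D₁`, since it contains the factor `g(Y, Z) =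
    -- 0`.
    · rw [hM.gM_shapeDefect_of_isKenmotsu (Or.inl hξ) hS hX hZ, hZ.2 p _ (hY.2 p), mul_zero,
        sub_zero]
  · exact hM.definesTotallyGeodesicFoliation_D₁_iff
      fun X Y Z hX _ hZ p => hnor hξ hS X Z hX hZ p _
  · exact hM.definesTotallyGeodesicFoliation_D₂_iff
      fun X Z W hX hZ _ p => hnor hξ hS X Z hX hZ p _
  · exact hM.definesTotallyGeodesicFoliation_D₂_iff
      fun X Z W hX hZ _ p => htan hξ hS X Z hX hZ p _
  · refine hM.definesTotallyGeodesicFoliation_D₂_iff fun X Z W hX hZ _ p => ?_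
    rw [hM.gM_shapeDefect_of_isKenmotsu (Or.inl hξ) hS hX hZ, sub_add_cancel]
  · exact hM.isLocallyRiemannianProduct_iff (htan hξ hS)
  · exact hM.isLocallyRiemannianProduct_iff (hnor hξ hS)
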